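/- **Setting.** For each sample size $n=|\mathcal S|$ there are $n$ units with controls $X_i\in\mathbb R^p$, treated status $D_i\in\{0,1\}$ and outcome $Y_i\in\mathbb R$. The subsample $\mathcal S^*\subseteq\mathcal S$, the covariate function $s:\mathbb R^p\to\mathbb R^q$ and the conditional law $F$ of $Y$ given $(X,D)$ are functions of $\{(X_i,D_i)\}_{i\in\mathcal S}$; given $\{(X_i,D_i)\}_{i\in\mathcal S}$ the $Y_i$ are independent with laws $F(\cdot\mid X_i,D_i)$. All statements below are conditional on a fixed realization $\{(x_i,d_i)\}_{i\in\mathcal S}$ for each $n$, limits are as $n\to\infty$, and "bounded" means bounded by a constant not depending on $n$ (for all large $n$). Write $f(x,d)=E_F[Y\mid X=x,D=d]$, $U=Y-f(X,D)$, $Z=(1,D,s(X)')'$, $\mathcal S^{*d}=\{i\in\mathcal S^*:D_i=d\}$, $\mathbb X^{*d}=\{X_i:i\in\mathcal S^{*d}\}$, and let $\mathbb G^{*d}$ be the empirical distribution of $X_i$, $i\in\mathcal S^{*d}$. The means $f(X_i,D_i)$, $f(X_i,0)$, $i\in\mathcal S^*$, are assumed to exist. Let $$\Gamma^*=\tfrac1{|\mathcal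 S^*|}\sum_{i\in\mathcal S^*}Z_iZ_i',\qquad \Delta^*=\tfrac1{|\mathcal S^*|}\sum_{i\in\mathcal S^*}Z_iZ_i'E_F[U^2\mid X=X_i,D=D_i],$$ $$\hat\theta^*=(\Gamma^*)^{-1}\tfrac1{|\mathcal S^*|}\sum_{i\in\mathcal S^*}Z_iY_i,\qquad \theta^*=(\Gamma^*)^{-1}\tfrac1{|\mathcal S^*|}\sum_{i\in\mathcal S^*}Z_if(X_i,D_i),$$ let $\hat\beta^*$ be the second component of $\hat\theta^*$, and $$\tau^*=\tau_{\mathbb G^{*1},F}=\tfrac1{|\mathcal S^{*1}|}\sum_{i\in\mathcal S^{*1}}\bigl(f(X_i,1)-f(X_i,0)\bigr).$$ **Standard error.** Let $\psi$ be a metric on $\mathbb R^p$ with $\psi(x,y)\le K\|x-y\|$ for a constant $K$, and $\kappa>0$. For $i\in\mathcal S^*$ let $l(i)$ be a minimizer of $\psi(x_i,x_j)+\kappa|d_i-d_j|$ over $j\in\mathcal S^*\setminus\{i\}$. With $\hat E_i=Y_i-Z_i'\hat\theta^*$ let $$\hat\Delta^*=\tfrac1{2|\mathcal S^*|}\sum_{i\in\mathcal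 S^*}(Z_i\hat E_i-Z_{l(i)}\hat E_{l(i)})(Z_i\hat E_i-Z_{l(i)}\hat E_{l(i)})',$$ and let $se^*$ be $|\mathcal S^*|^{-1/2}$ times the square root of the second diagonal entry of $(\Gamma^*)^{-1}\hat\Delta^*(\Gamma^*)^{-1}$. **Assumptions.** (a) $|\mathcal S^*|\to\infty$. (b) $\liminf\lambda_{\min}[\Gamma^*]>0$ and $\liminf\lambda_{\min}[\Delta^*]>0$. (c) For some $\delta>0$ and each $d$, $E_F[\|ZU\|^{2}\mid X=x,D=d]$ and $E_F[\|ZU\|^{2+\delta}\mid X=x,D=d]$ are bounded over $x\in\mathbb X^{*d}$. (d) For each $d$, all components $Z_j,Z_k$ and all integers $0\le a,b\le2$, $0\le c\le a+b$, the moment $E_F[Z_j^aZ_k^b(Y-Z'\theta^*)^c\mid X=x,D=d]$ exists, is bounded over $x\in\mathbb X^{*d}$, and is $\psi$-Lipschitz in $x\in\mathbb X^{*d}$ with a bounded Lipschitz constant; the diameters of $\mathbb X^{*d}$ are bounded. (e) Either $\psi$ is induced by a norm and, for all large $n$, the minimizers $l(i)$ are unique; or no unit $j$ is the match $l(i)$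 of more than $K'$ units $i\in\mathcal S^*$, for a constant $K'$ and all large $n$. (The first alternative implies the second.) **Misspecification and imbalance.** Let $h^*(x)=f(x,0)-(1,0,s(x)')\theta^*$. The pair $(m^*,c^*)=(m_{\mathbb G^*,F},c_{\mathbb G^*})$ is one of the following: * *Kolmogorov–Smirnov* ($p=1$): $c^*=\sup_{t}|\mathbb G^{*1}((-\infty,t])-\mathbb G^{*0}((-\infty,t])|$, and $m^*$ is the infimum of the total variations on $\mathbb R$ of all continuous bounded extensions of $h^*|_{\mathbb X^{*1}\cup\mathbb X^{*0}}$. * *Monge–Kantorovich/Wasserstein*: $c^*$ is the infimum of $\int\|x_1-x_2\|\,d\pi$ over the couplings $\pi$ of $\mathbb G^{*1}$ and $\mathbb G^{*0}$, and $m^*$ is the Lipschitz seminorm of $h^*$ on $\mathbb X^{*1}\cup\mathbb X^{*0}$. * *Mean difference*, with summaries $r=(r_1,\dots,r_J)$ (which may be functions of $\{(X_i,D_i)\}_{i\in\mathcal S}$) and $L\in[0,\infty]$: $c^*_j=|E_{\mathbb G^{*1}}[r_j]-E_{\mathbb G^{*0}}[r_j]|$ and $m^*_j=\max(|\zeta_{1,j}|,|\zeta_{-1,j}|)$,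 where for $\sigma=\pm1$, $\zeta_\sigma$ is part of a solution of: minimize $\|\zeta\|^2+L\sum_{d}\sum_{x\in\mathbb X^{*d}}\xi^d(x)$ over $\zeta\in\mathbb R^J$, $\xi^d\ge0$ subject to $\sigma h^*\le\sigma r'\zeta+\xi^1$ on $\mathbb X^{*1}$ and $\sigma h^*\ge\sigma r'\zeta-\xi^0$ on $\mathbb X^{*0}$; it is assumed that these solutions have zero slacks $\xi^d$ (sharp separation). Here $m\,c$ denotes the product, or the inner product for mean differences. Assume the local-misspecification condition $m^*c^*=v/\sqrt{|\mathcal S^*|}$ for all large $n$, where $v$ is a positive function of $\{(X_i,D_i)\}_{i\in\mathcal S}$. **Conclusion.** (1) Let $\tau_0^*$ be a function of $\{(X_i,D_i)\}_{i\in\mathcal S}$, and $t^*=(\hat\beta^*-\tau_0^*)/se^*$. Under $H_0:\tau^*=\tau_0^*$, for all $z\in\mathbb R$, $$\Phi(z)\le\liminf_{n\to\infty}\Pr_F\Bigl[t^*-\frac{v}{\sqrt{|\mathcal S^*|}\,se^*}\le z\Bigm|\{(X_i,D_i)\}_{i\in\mathcal S}\Bigr],\qquad \limsup_{n\to\infty}\Pr_F\Bigl[t^*+\frac{v}{\sqrt{|\mathcal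 S^*|}\,se^*}\le z\Bigm|\{(X_i,D_i)\}_{i\in\mathcal S}\Bigr]\le\Phi(z),$$ where $\Phi$ is the standard normal distribution function. (2) Let $\alpha\in(0,1)$, $z_a=\Phi^{-1}(a)$, and $$C_\alpha(m)=\bigl\{\tau:\hat\beta^*-z_{1-\alpha/2}\,se^*-m\,c^*<\tau\le\hat\beta^*-z_{\alpha/2}\,se^*+m\,c^*\bigr\}.$$ If $m\ge m^*$ for all large $n$ (componentwise for mean differences; $m$ may vary with $n$), then $$\liminf_{n\to\infty}\Pr_F\bigl[\tau^*\in C_\alpha(m)\bigm|\{(X_i,D_i)\}_{i\in\mathcal S}\bigr]\ge1-\alpha.$$ -/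

import Mathlib

open MeasureTheory ProbabilityTheory Filter Topology
open scoped ENNReal Matrix

namespace DesignPhase

noncomputable section

/-! ### Samples, subsamples, conditional law of the outcomes -/

/-- The space `ℝ^p` of controls, with its Euclidean norm. -/
abbrev Ctrl (p : ℕ) : Type := EuclideanSpace ℝ (Fin p)

/-- Values of `(X, D)`: controls and treated status (`true` is treated, `false` is untreated). -/
abbrev Obs (p : ℕ) : Type := Ctrl p × Bool

/-- The indicator `D ∈ {0, 1}` as a real number. -/
def treat (d : Bool) : ℝ := if d then 1 else 0

/-- All that is fixed once the controls and the treated statuses of the `n` units are given: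
their values, the selected subsample, the covariate function `s : ℝ^p → ℝ^q`, and the
conditional distribution `F` of `Y` given `(X, D)`. -/
structure Given (p q n : ℕ) where
  obs : Fin n → Obs p
  sub : Finset (Fin n)
  cov : Ctrl p → Fin q → ℝ
  law : Kernel (Obs p) ℝ
  markov : IsMarkovKernel law

/-- The subsample, the covariate function and the conditional distribution of the outcome, each
of them a function of the controls and treated statuses of all `n` units of the sample. -/
structure Setup (p q : ℕ) where
  sub : ∀ n : ℕ, (Fin n → Obs p) → Finset (Fin n)
  cov : ∀ n : ℕ, (Fin n → Obs p) → Ctrl p → Fin q → ℝ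
  law : ∀ n : ℕ, (Fin n → Obs p) → Kernel (Obs p) ℝ
  markov : ∀ (n : ℕ) (w : Fin n → Obs p), IsMarkovKernel (law n w)

/-- The setup, given the realized controls and treated statuses `w` of a sample of `n` units. -/
def Setup.given {p q : ℕ} (P : Setup p q) {n : ℕ} (w : Fin n → Obs p) : Given p q n where
  obs := w
  sub := P.sub n w
  cov := P.cov n w
  law := P.law n w
  markov := P.markov n w

/-- The smallest eigenvalue of a (symmetric) matrix. -/
def lambdaMin {k : ℕ} (A : Matrix (Fin k) (Fin k) ℝ) : ℝ := sInf (spectrum ℝ A)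

/-- The distribution function of the standard normal distribution. -/
def Phi (z : ℝ) : ℝ := cdf (gaussianReal 0 1) z

/-- The standard normal quantile `z_a`, for `a ∈ (0, 1)`. -/
def quantile (a : ℝ) : ℝ := sInf {z : ℝ | a ≤ Phi z}

namespace Given

variable {p q n : ℕ}

/-- The conditional joint law of the outcomes of a random sample, given all the controls and
treated statuses: the `Y i` are independent and `Y i` has law `F(· | X i, D i)`. -/
def condLaw (P : Given p q n) : Measure (Fin n → ℝ) := Measure.pi fun i => P.law (P.obs i)

/-- The controls `X i`. -/
def X (P : Given p q n) (i : Fin n) : Ctrl p := (P.obs i).1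

/-- The units of the subsample with treated status `d`. -/
def arm (P : Given p q n) (d : Bool) : Finset (Fin n) := {i ∈ P.sub | (P.obs i).2 = d}

/-- The size of the subsample, as a real number. -/
def size (P : Given p q n) : ℝ := (P.sub.card : ℝ)

/-- `f(x, d)`, the conditional expectation of `Y` given `(X, D) = (x, d)`. -/
def cexp (P : Given p q n) (o : Obs p) : ℝ := ∫ y, y ∂(P.law o)

/-- The conditional expectation of `U ^ 2`, `U = Y - f(X, D)`, given `(X, D)`. -/
def cvar (P : Given p q n) (o : Obs p) : ℝ := ∫ y, (y - P.cexp o) ^ 2 ∂(P.law o)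

/-- The regressors `Z = (1, D, s(X)')'`. The component with index `1` is `D`. -/
def Z (P : Given p q n) (o : Obs p) : Fin (q + 2) → ℝ :=
  Matrix.vecCons 1 (Matrix.vecCons (treat o.2) (P.cov o.1))

/-- The regressors of unit `i`. -/
def reg (P : Given p q n) (i : Fin n) : Fin (q + 2) → ℝ := P.Z (P.obs i)

/-- The conditional moment `E[‖Z U‖ ^ r | X, D]` (Euclidean norm). -/
def momentZU (P : Given p q n) (r : ℝ) (o : Obs p) : ℝ≥0∞ :=
  ∫⁻ y, ‖WithLp.toLp 2 ((y - P.cexp o) • P.Z o)‖ₑ ^ r ∂(P.law o)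

/-! ### Least squares within the subsample -/

/-- `Γ*`, the average of `Z Z'` over the subsample. -/
def Gam (P : Given p q n) : Matrix (Fin (q + 2)) (Fin (q + 2)) ℝ :=
  P.size⁻¹ • ∑ i ∈ P.sub, Matrix.vecMulVec (P.reg i) (P.reg i)

/-- `Δ*`, the average of `Z Z' E[U ^ 2 | X, D]` over the subsample. -/
def Del (P : Given p q n) : Matrix (Fin (q + 2)) (Fin (q + 2)) ℝ :=
  P.size⁻¹ • ∑ i ∈ P.sub, P.cvar (P.obs i) • Matrix.vecMulVec (P.reg i) (P.reg i)

/-- The least squares coefficients from regressing `y` on `Z` within the subsample. -/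
def lsq (P : Given p q n) (y : Fin n → ℝ) : Fin (q + 2) → ℝ :=
  P.Gam⁻¹ *ᵥ (P.size⁻¹ • ∑ i ∈ P.sub, y i • P.reg i)

/-- The least squares estimator of the coefficient of `D`. -/
def betaHat (P : Given p q n) (Y : Fin n → ℝ) : ℝ := P.lsq Y 1

/-- The regression estimand: the coefficients from the hypothetical regression of
`f(X i, D i)` on `Z i` within the subsample. -/
def theta (P : Given p q n) : Fin (q + 2) → ℝ := P.lsq fun i => P.cexp (P.obs i)

/-- The parameter of interest: the average of `f(X i, 1) - f(X i, 0)` over the treated units of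
the subsample. -/
def tau (P : Given p q n) : ℝ :=
  ((P.arm true).card : ℝ)⁻¹ *
    ∑ i ∈ P.arm true, (P.cexp (P.X i, true) - P.cexp (P.X i, false))

/-- The misspecification function: `f(x, 0)` minus the value at `(x, 0)` of the regression
function at the regression estimand. -/
def dev (P : Given p q n) (x : Ctrl p) : ℝ :=
  P.cexp (x, false) - P.Z (x, false) ⬝ᵥ P.theta

/-! ### The standard error -/

/-- The distance `ψ(x_i, x_j) + κ |d_i - d_j|` between units. -/
def nu (P : Given p q n) (ψ : Ctrl p → Ctrl p → ℝ) (κ : ℝ) (i j : Fin n) : ℝ :=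
  ψ (P.X i) (P.X j) + κ * |treat (P.obs i).2 - treat (P.obs j).2|

/-- `l i` is, for every `i` in the subsample, a closest other unit of the subsample. -/
def IsMatch (P : Given p q n) (ψ : Ctrl p → Ctrl p → ℝ) (κ : ℝ) (l : Fin n → Fin n) : Prop :=
  ∀ i ∈ P.sub, l i ∈ P.sub ∧ l i ≠ i ∧ ∀ j ∈ P.sub, j ≠ i → P.nu ψ κ i (l i) ≤ P.nu ψ κ i j

/-- No ties: the closest other unit is unique. -/
def NoTies (P : Given p q n) (ψ : Ctrl p → Ctrl p → ℝ) (κ : ℝ) (l : Fin n → Fin n) : Prop :=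
  ∀ i ∈ P.sub, ∀ j ∈ P.sub, j ≠ i → j ≠ l i → P.nu ψ κ i (l i) < P.nu ψ κ i j

/-- The residuals of the least squares regression within the subsample. -/
def resid (P : Given p q n) (Y : Fin n → ℝ) (i : Fin n) : ℝ := Y i - P.reg i ⬝ᵥ P.lsq Y

/-- The matching estimator of `Δ*`. -/
def DelHat (P : Given p q n) (l : Fin n → Fin n) (Y : Fin n → ℝ) :
    Matrix (Fin (q + 2)) (Fin (q + 2)) ℝ :=
  (2 * P.size)⁻¹ • ∑ i ∈ P.sub,
    Matrix.vecMulVec (P.resid Y i • P.reg i - P.resid Y (l i) • P.reg (l i))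
      (P.resid Y i • P.reg i - P.resid Y (l i) • P.reg (l i))

/-- The estimator `(Γ*)⁻¹ Δ̂* (Γ*)⁻¹` of the asymptotic variance. -/
def SigHat (P : Given p q n) (l : Fin n → Fin n) (Y : Fin n → ℝ) :
    Matrix (Fin (q + 2)) (Fin (q + 2)) ℝ :=
  P.Gam⁻¹ * P.DelHat l Y * P.Gam⁻¹

/-- The standard error of `betaHat`. -/
def se (P : Given p q n) (l : Fin n → Fin n) (Y : Fin n → ℝ) : ℝ :=
  √(P.SigHat l Y 1 1) / √P.size

/-- The t-statistic for the null value `τ₀`. -/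
def tStat (P : Given p q n) (l : Fin n → Fin n) (τ₀ : ℝ) (Y : Fin n → ℝ) : ℝ :=
  (P.betaHat Y - τ₀) / P.se l Y

/-- The conditional moment `E[Z_j ^ a * Z_k ^ b * (Y - Z'θ) ^ c | X, D]`, with `θ` the regression
estimand. -/
def moment (P : Given p q n) (j k : Fin (q + 2)) (a b c : ℕ) (o : Obs p) : ℝ :=
  ∫ y, P.Z o j ^ a * P.Z o k ^ b * (y - P.Z o ⬝ᵥ P.theta) ^ c ∂(P.law o)

/-- Regularity of the conditional moments and of the supports of the controls in each arm of the
subsample, with constant `M` and with respect to the metric `ψ`. -/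
structure MomentRegular (P : Given p q n) (ψ : Ctrl p → Ctrl p → ℝ) (M : ℝ) : Prop where
  integrable : ∀ (j k : Fin (q + 2)) (a b c : ℕ), a ≤ 2 → b ≤ 2 → c ≤ a + b → ∀ i ∈ P.sub,
    Integrable (fun y : ℝ => P.Z (P.obs i) j ^ a * P.Z (P.obs i) k ^ b *
      (y - P.Z (P.obs i) ⬝ᵥ P.theta) ^ c) (P.law (P.obs i))
  bounded : ∀ (j k : Fin (q + 2)) (a b c : ℕ), a ≤ 2 → b ≤ 2 → c ≤ a + b → ∀ i ∈ P.sub,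
    |P.moment j k a b c (P.obs i)| ≤ M
  lipschitz : ∀ (j k : Fin (q + 2)) (a b c : ℕ), a ≤ 2 → b ≤ 2 → c ≤ a + b →
    ∀ d : Bool, ∀ i ∈ P.arm d, ∀ i' ∈ P.arm d,
    |P.moment j k a b c (P.obs i) - P.moment j k a b c (P.obs i')| ≤ M * ψ (P.X i) (P.X i')
  diam : ∀ d : Bool, ∀ i ∈ P.arm d, ∀ i' ∈ P.arm d, dist (P.X i) (P.X i') ≤ M

/-! ### Covariate imbalance and model misspecification -/

/-- The empirical conditional distribution of `X` given `D = d` within the subsample. -/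
def empirical (P : Given p q n) (d : Bool) : Measure (Ctrl p) :=
  ((P.arm d).card : ℝ≥0∞)⁻¹ • ∑ i ∈ P.arm d, Measure.dirac (P.X i)

/-- Kolmogorov-Smirnov distance between the empirical conditional distributions (`p = 1`). -/
def cKS (P : Given 1 q n) : ℝ :=
  ⨆ t : ℝ, |(P.empirical true).real {x | x 0 ≤ t} - (P.empirical false).real {x | x 0 ≤ t}|

/-- The infimum of the total variations over `ℝ` of the continuous and bounded extensions of the
misspecification function from the controls in the subsample to `ℝ` (`p = 1`). -/
def mKS (P : Given 1 q n) : ℝ :=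
  (⨅ h ∈ {h : ℝ → ℝ | Continuous h ∧ (∃ B : ℝ, ∀ x, |h x| ≤ B) ∧
    ∀ i ∈ P.sub, h (P.X i 0) = P.dev (P.X i)}, eVariationOn h Set.univ).toReal

/-- Monge-Kantorovich/Wasserstein distance between the empirical conditional distributions. -/
def cMKW (P : Given p q n) : ℝ :=
  (⨅ π ∈ {π : Measure (Ctrl p × Ctrl p) |
      π.map Prod.fst = P.empirical true ∧ π.map Prod.snd = P.empirical false},
    ∫⁻ x, ENNReal.ofReal ‖x.1 - x.2‖ ∂π).toReal

/-- The Lipschitz seminorm of the misspecification function on the controls in the subsample. -/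
def mMKW (P : Given p q n) : ℝ :=
  (⨆ x ∈ {x : Ctrl p × Ctrl p | x.1 ≠ x.2 ∧ x.1 ∈ P.X '' P.sub ∧ x.2 ∈ P.X '' P.sub},
    ENNReal.ofReal (|P.dev x.1 - P.dev x.2| / ‖x.1 - x.2‖)).toReal

/-- Absolute values of the mean differences of the summaries `r`. -/
def cMD (P : Given p q n) {J : ℕ} (r : Ctrl p → Fin J → ℝ) (j : Fin J) : ℝ :=
  |∫ x, r x j ∂(P.empirical true) - ∫ x, r x j ∂(P.empirical false)|

open scoped Classical in
/-- The support of the empirical conditional distribution of `X` given `D = d`. -/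
def supp (P : Given p q n) (d : Bool) : Finset (Ctrl p) := (P.arm d).image P.X

/-- The constraints of the separation problem with sign `σ`, summaries `r`, separating vector
`ζ` and slacks `ξ d`. -/
def SepFeasible (P : Given p q n) {J : ℕ} (r : Ctrl p → Fin J → ℝ) (σ : ℝ)
    (ζ : Fin J → ℝ) (ξ : Bool → Ctrl p → NNReal) : Prop :=
  (∀ x ∈ P.supp true, σ * P.dev x ≤ σ * (r x ⬝ᵥ ζ) + ξ true x) ∧
  (∀ x ∈ P.supp false, σ * (r x ⬝ᵥ ζ) - ξ false x ≤ σ * P.dev x)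

/-- The objective `‖ζ‖ ^ 2 + L * (sum of all slacks)` of the separation problem, `L ∈ [0, ∞]`. -/
def sepObjective (P : Given p q n) {J : ℕ} (L : ℝ≥0∞)
    (ζ : Fin J → ℝ) (ξ : Bool → Ctrl p → NNReal) : ℝ≥0∞ :=
  ENNReal.ofReal (∑ j, ζ j ^ 2) + L * ∑ d : Bool, ∑ x ∈ P.supp d, (ξ d x : ℝ≥0∞)

/-- `(ζ, ξ)` solves the separation problem with sign `σ`. -/
def SepSolution (P : Given p q n) {J : ℕ} (r : Ctrl p → Fin J → ℝ) (L : ℝ≥0∞) (σ : ℝ)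
    (ζ : Fin J → ℝ) (ξ : Bool → Ctrl p → NNReal) : Prop :=
  P.SepFeasible r σ ζ ξ ∧
    ∀ ζ' ξ', P.SepFeasible r σ ζ' ξ' → P.sepObjective L ζ ξ ≤ P.sepObjective L ζ' ξ'

end Given

/-- The three ways of measuring imbalance and misspecification: Kolmogorov-Smirnov (for
one-dimensional controls), Monge-Kantorovich/Wasserstein, and mean differences of `J` summaries
(which may be functions of the controls and treated statuses in the sample), with slack penalty
`L ∈ [0, ∞]`. -/
inductive BalanceMetric : ℕ → Type
  | ks : BalanceMetric 1
  | mkw {p : ℕ} : BalanceMetric p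
  | md {p : ℕ} (J : ℕ) (r : ∀ n : ℕ, (Fin n → Obs p) → Ctrl p → Fin J → ℝ) (L : ℝ≥0∞) :
      BalanceMetric p

/-- Number of components of the measurements of imbalance and misspecification. -/
def BalanceMetric.dim : {p : ℕ} → BalanceMetric p → ℕ
  | _, .ks => 1
  | _, .mkw => 1
  | _, .md J _ _ => J

/-- The covariate imbalance `c` of the subsample. -/
def BalanceMetric.imbalance {q n : ℕ} : {p : ℕ} → (κ : BalanceMetric p) → Given p q n → Fin κ.dim → ℝ
  | _, .ks, P => fun _ => P.cKS
  | _, .mkw, P => fun _ => P.cMKW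
  | _, .md _ r _, P => P.cMD (r n P.obs)

/-- `m` is the degree of misspecification within the subsample. For mean differences it is
`|ζ₁| ∨ |ζ₋₁|` componentwise, where `ζ₁` and `ζ₋₁` solve the two separation problems with zero
slacks, i.e. both attain sharp separation. -/
def BalanceMetric.IsMisspec {q n : ℕ} : {p : ℕ} → (κ : BalanceMetric p) → Given p q n → (Fin κ.dim → ℝ) → Prop
  | _, .ks, P, m => ∀ j, m j = P.mKS
  | _, .mkw, P, m => ∀ j, m j = P.mMKW
  | _, .md J r L, P, m => ∃ ζ₁ ζ₂ : Fin J → ℝ,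
      P.SepSolution (r n P.obs) L 1 ζ₁ 0 ∧ P.SepSolution (r n P.obs) L (-1) ζ₂ 0 ∧
      ∀ j : Fin J, m j = max |ζ₁ j| |ζ₂ j|

/-- The robustified interval `C_α(m)`; `mc` stands for the (inner) product of `m` and `c`. -/
def Given.robustCI {p q n : ℕ} (P : Given p q n) (l : Fin n → Fin n) (α mc : ℝ)
    (Y : Fin n → ℝ) : Set ℝ :=
  Set.Ioc (P.betaHat Y - quantile (1 - α / 2) * P.se l Y - mc)
    (P.betaHat Y - quantile (α / 2) * P.se l Y + mc)

/-- `ψ` is a metric. -/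
structure IsMetric {E : Type} (ψ : E → E → ℝ) : Prop where
  eq_zero_iff : ∀ x y, ψ x y = 0 ↔ x = y
  symm : ∀ x y, ψ x y = ψ y x
  triangle : ∀ x y z, ψ x z ≤ ψ x y + ψ y z

end

end DesignPhase

open DesignPhase

/-!
Given the controls and treatments, `betaHat - tau` splits into a deterministic bias `theta 1 - tau`
and the centred sum `betaHat - theta 1`.

The bias equals the difference of the means of the misspecification function over the two arms,
because the residuals of the regression defining `theta` are orthogonal to the intercept and to the
treatment indicator. Each balance metric is dual to its measure of misspecification, so the bias is
at most `m ⬝ᵥ c`.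

The centred sum is a weighted sum of independent outcomes with bounded fourth moments, to which the
central limit theorem applies: the characteristic function of each summand is compared with that of
a normal variable of the same variance. The limiting variance is estimated by half the average
squared difference of the influences of matched units. Boundedness of the set of controls makes all
but boundedly many matches close, and boundedly many units share a match, so this average has
vanishing variance and the correct limiting mean. Slutsky's lemma turns this into a normal limit
for the t-statistic, which a bias of at most `m ⬝ᵥ c` shifts by at most `m ⬝ᵥ c / se`.
-/

namespace DesignPhase

section Coercive

variable {ι : Type*} [Fintype ι]

/-- The quadratic form of `A` is bounded below by `c` times the square of the Euclidean norm.
For a symmetric matrix this says that `c` is at most the smallest eigenvalue, but it does not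
mention the spectrum and needs no symmetry. -/
def IsCoerciveWith (A : Matrix ι ι ℝ) (c : ℝ) : Prop :=
  ∀ x, c * (x ⬝ᵥ x) ≤ x ⬝ᵥ A *ᵥ x

lemma dotProduct_sq_le (x y : ι → ℝ) : (x ⬝ᵥ y) ^ 2 ≤ (x ⬝ᵥ x) * (y ⬝ᵥ y) := by
  simpa only [dotProduct, sq] using Finset.sum_mul_sq_le_sq_mul_sq Finset.univ x y

lemma zero_le_dotProduct_self (x : ι → ℝ) : 0 ≤ x ⬝ᵥ x :=
  Finset.sum_nonneg fun _ _ => mul_self_nonneg _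

namespace IsCoerciveWith

variable {A : Matrix ι ι ℝ} {c : ℝ}

lemma mono {c' : ℝ} (h : IsCoerciveWith A c) (hc : c' ≤ c) : IsCoerciveWith A c' := fun x =>
  (mul_le_mul_of_nonneg_right hc (zero_le_dotProduct_self x)).trans (h x)

lemma sq_mul_dotProduct_self_le (h : IsCoerciveWith A c) (hc : 0 < c) (x : ι → ℝ) :
    c ^ 2 * (x ⬝ᵥ x) ≤ (A *ᵥ x) ⬝ᵥ (A *ᵥ x) := by
  rcases (zero_le_dotProduct_self x).eq_or_lt with hx | hx
  · simpa only [← hx, mul_zero] using zero_le_dotProduct_self (A *ᵥ x)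
  refine le_of_mul_le_mul_left ?_ hx
  calc (x ⬝ᵥ x) * (c ^ 2 * (x ⬝ᵥ x)) = (c * (x ⬝ᵥ x)) ^ 2 := by ring
    _ ≤ (x ⬝ᵥ A *ᵥ x) ^ 2 := pow_le_pow_left₀ (by positivity) (h x) 2
    _ ≤ (x ⬝ᵥ x) * ((A *ᵥ x) ⬝ᵥ (A *ᵥ x)) := dotProduct_sq_le _ _

lemma isUnit [DecidableEq ι] (h : IsCoerciveWith A c) (hc : 0 < c) : IsUnit A := by
  rw [← Matrix.mulVec_injective_iff_isUnit]
  intro x y hxy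
  have hker : A *ᵥ (x - y) = 0 := by rw [Matrix.mulVec_sub, sub_eq_zero]; exact hxy
  have hle := h.sq_mul_dotProduct_self_le hc (x - y)
  rw [hker, dotProduct_zero] at hle
  have hzero : (x - y) ⬝ᵥ (x - y) = 0 :=
    (nonpos_of_mul_nonpos_right hle (by positivity)).antisymm (zero_le_dotProduct_self _)
  exact sub_eq_zero.1 (dotProduct_self_eq_zero.1 hzero)

end IsCoerciveWith

lemma isCoerciveWith_of_le_lambdaMin {k : ℕ} {A : Matrix (Fin k) (Fin k) ℝ} (hA : A.IsHermitian)
    {c : ℝ} (hc : c ≤ lambdaMin A) : IsCoerciveWith A c := by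
  have hbdd : BddBelow (spectrum ℝ A) := by
    rw [hA.spectrum_real_eq_range_eigenvalues]
    exact (Set.finite_range _).bddBelow
  have hpsd : (A - algebraMap ℝ _ c).PosSemidef := by
    rw [Matrix.posSemidef_iff_isHermitian_and_spectrum_nonneg]
    refine ⟨hA.sub (by simp [Matrix.IsHermitian, Matrix.algebraMap_eq_diagonal]), fun μ hμ => ?_⟩
    rw [← spectrum.sub_singleton_eq] at hμ
    obtain ⟨a, ha, _, rfl, rfl⟩ := Set.mem_sub.1 hμ
    exact sub_nonneg.2 (hc.trans (csInf_le hbdd ha))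
  intro x
  have h := hpsd.dotProduct_mulVec_nonneg x
  rwa [Matrix.sub_mulVec, dotProduct_sub, Algebra.algebraMap_eq_smul_one, Matrix.smul_mulVec,
    Matrix.one_mulVec, dotProduct_smul, star_trivial, smul_eq_mul, sub_nonneg] at h

lemma eventually_isCoerciveWith_of_lt_liminf_lambdaMin {α : Type*} {f : Filter α} {k : ℕ}
    {A : α → Matrix (Fin k) (Fin k) ℝ} (hA : ∀ a, (A a).IsHermitian) {c : ℝ}
    (hc : (c : EReal) < liminf (fun a => (lambdaMin (A a) : EReal)) f) :
    ∀ᶠ a in f, IsCoerciveWith (A a) c :=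
  (eventually_lt_of_lt_liminf hc).mono fun a ha =>
    isCoerciveWith_of_le_lambdaMin (hA a) (EReal.coe_lt_coe_iff.1 ha).le

lemma dotProduct_sum_smul_vecMulVec_mulVec {σ : Type*} (s : Finset σ) (c : σ → ℝ)
    (z z' : σ → ι → ℝ) (x y : ι → ℝ) :
    x ⬝ᵥ (∑ i ∈ s, c i • Matrix.vecMulVec (z i) (z' i)) *ᵥ y =
      ∑ i ∈ s, c i * ((z i ⬝ᵥ x) * (z' i ⬝ᵥ y)) := by
  rw [Matrix.sum_mulVec, dotProduct_sum]
  refine Finset.sum_congr rfl fun i _ => ?_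
  rw [Matrix.smul_mulVec, dotProduct_smul, Matrix.vecMulVec_mulVec, dotProduct_smul,
    dotProduct_comm x]
  simp

end Coercive

namespace Given

section LeastSquares

variable {p q n : ℕ} (P : Given p q n)

lemma dotProduct_Gam_mulVec (x y : Fin (q + 2) → ℝ) :
    x ⬝ᵥ P.Gam *ᵥ y = P.size⁻¹ * ∑ i ∈ P.sub, (P.reg i ⬝ᵥ x) * (P.reg i ⬝ᵥ y) := by
  have h := dotProduct_sum_smul_vecMulVec_mulVec P.sub (fun _ => 1) P.reg P.reg x y
  simp only [one_smul, one_mul] at h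
  rw [Gam, Matrix.smul_mulVec, dotProduct_smul, h, smul_eq_mul]

lemma dotProduct_Del_mulVec (x y : Fin (q + 2) → ℝ) :
    x ⬝ᵥ P.Del *ᵥ y =
      P.size⁻¹ * ∑ i ∈ P.sub, P.cvar (P.obs i) * ((P.reg i ⬝ᵥ x) * (P.reg i ⬝ᵥ y)) := by
  rw [Del, Matrix.smul_mulVec, dotProduct_smul, dotProduct_sum_smul_vecMulVec_mulVec, smul_eq_mul]

lemma isHermitian_Gam : P.Gam.IsHermitian := by
  ext i j
  simp [Gam, Matrix.sum_apply, Matrix.vecMulVec_apply, mul_comm]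

lemma isHermitian_Del : P.Del.IsHermitian := by
  ext i j
  simp [Del, Matrix.sum_apply, Matrix.vecMulVec_apply, mul_comm]

lemma mem_arm {d : Bool} {i : Fin n} : i ∈ P.arm d ↔ i ∈ P.sub ∧ (P.obs i).2 = d :=
  Finset.mem_filter

lemma arm_subset (d : Bool) : P.arm d ⊆ P.sub := Finset.filter_subset _ _

lemma obs_eq_of_mem_arm {d : Bool} {i : Fin n} (hi : i ∈ P.arm d) : P.obs i = (P.X i, d) :=
  Prod.ext rfl (P.mem_arm.1 hi).2

lemma reg_one (i : Fin n) : P.reg i 1 = treat (P.obs i).2 := rfl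

lemma Z_true_dotProduct (x : Ctrl p) (θ : Fin (q + 2) → ℝ) :
    P.Z (x, true) ⬝ᵥ θ = P.Z (x, false) ⬝ᵥ θ + θ 1 := by
  simp only [Z, dotProduct, Fin.sum_univ_succ]
  simp [treat]
  ring

lemma exists_reg_dotProduct_eq_ite (d : Bool) :
    ∃ e : Fin (q + 2) → ℝ, e ≠ 0 ∧ ∀ i, P.reg i ⬝ᵥ e = if (P.obs i).2 = d then 1 else 0 := by
  have hreg_zero : ∀ i, P.reg i 0 = 1 := fun _ => rfl
  cases d with
  | true =>
    refine ⟨Pi.single 1 1, by simp, fun i => ?_⟩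
    rw [dotProduct_single, reg_one, treat, mul_one]
  | false =>
    refine ⟨Pi.single 0 1 - Pi.single 1 1, fun h => ?_, fun i => ?_⟩
    · simpa using congrFun h 0
    · rw [dotProduct_sub, dotProduct_single, dotProduct_single, hreg_zero, reg_one, treat]
      cases (P.obs i).2 <;> simp

variable {P}

lemma arm_nonempty (h : IsUnit P.Gam) (d : Bool) : (P.arm d).Nonempty := by
  by_contra hne
  obtain ⟨e, he0, he⟩ := P.exists_reg_dotProduct_eq_ite d
  have hreg : ∀ i ∈ P.sub, P.reg i ⬝ᵥ e = 0 := fun i hi => by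
    rw [he, if_neg fun hd => hne ⟨i, P.mem_arm.2 ⟨hi, hd⟩⟩]
  have hker : P.Gam *ᵥ e = 0 := dotProduct_eq_zero _ fun x => by
    rw [dotProduct_comm, dotProduct_Gam_mulVec,
      Finset.sum_eq_zero fun i hi => by rw [hreg i hi, mul_zero], mul_zero]
  exact he0 (Matrix.mulVec_injective_of_isUnit h (hker.trans (Matrix.mulVec_zero _).symm))

lemma size_pos (h : IsUnit P.Gam) : 0 < P.size :=
  Nat.cast_pos.2 (Finset.card_pos.2 ((arm_nonempty h true).mono (P.arm_subset _)))

lemma sum_resid_mul_reg_dotProduct (h : IsUnit P.Gam) (y : Fin n → ℝ) (x : Fin (q + 2) → ℝ) :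
    ∑ i ∈ P.sub, P.resid y i * (P.reg i ⬝ᵥ x) = 0 := by
  have hnormal : P.Gam *ᵥ P.lsq y = P.size⁻¹ • ∑ i ∈ P.sub, y i • P.reg i := by
    rw [lsq, Matrix.mulVec_mulVec, Matrix.mul_nonsing_inv _ ((Matrix.isUnit_iff_isUnit_det _).1 h),
      Matrix.one_mulVec]
  have hx := congrArg (fun v => x ⬝ᵥ v) hnormal
  simp only [dotProduct_Gam_mulVec, dotProduct_smul, dotProduct_sum, smul_eq_mul] at hx
  have hsum := mul_left_cancel₀ (inv_ne_zero (size_pos h).ne') hx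
  simp only [resid, sub_mul, Finset.sum_sub_distrib, sub_eq_zero]
  simpa only [dotProduct_comm x, mul_comm] using hsum.symm

lemma sum_arm_resid (h : IsUnit P.Gam) (y : Fin n → ℝ) (d : Bool) :
    ∑ i ∈ P.arm d, P.resid y i = 0 := by
  obtain ⟨e, -, he⟩ := P.exists_reg_dotProduct_eq_ite d
  simpa only [he, mul_ite, mul_one, mul_zero, arm, Finset.sum_filter] using
    sum_resid_mul_reg_dotProduct h y e

variable (P)

lemma integrable_empirical (d : Bool) (h : Ctrl p → ℝ) : Integrable h (P.empirical d) := by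
  rcases (P.arm d).eq_empty_or_nonempty with hd | hd
  · simp [empirical, hd]
  · exact (integrable_finsetSum_measure.2 fun i _ => integrable_dirac (by finiteness)).smul_measure
      (by simpa using hd.ne_empty)

lemma integral_empirical (d : Bool) (h : Ctrl p → ℝ) :
    ∫ x, h x ∂(P.empirical d) = ((P.arm d).card : ℝ)⁻¹ * ∑ i ∈ P.arm d, h (P.X i) := by
  rw [empirical, integral_smul_measure,
    integral_finsetSum_measure fun i _ => integrable_dirac (by finiteness)]
  simp

variable {P}

lemma theta_one_sub_tau (h : IsUnit P.Gam) :
    P.theta 1 - P.tau = ∫ x, P.dev x ∂(P.empirical true) - ∫ x, P.dev x ∂(P.empirical false) := by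
  have hcard : ((P.arm true).card : ℝ) ≠ 0 :=
    Nat.cast_ne_zero.2 (Finset.card_ne_zero.2 (arm_nonempty h true))
  have hsum := sum_arm_resid h fun i => P.cexp (P.obs i)
  have huntreated : ∑ i ∈ P.arm false, P.dev (P.X i) = 0 := by
    rw [← hsum false]
    refine Finset.sum_congr rfl fun i hi => ?_
    rw [resid, reg, P.obs_eq_of_mem_arm hi]
    rfl
  have htreated : ∑ i ∈ P.arm true, (P.cexp (P.X i, true) - P.cexp (P.X i, false)) =
      ∑ i ∈ P.arm true, (P.theta 1 - P.dev (P.X i)) := by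
    rw [← sub_eq_zero, ← Finset.sum_sub_distrib, ← hsum true]
    refine Finset.sum_congr rfl fun i hi => ?_
    rw [resid, reg, P.obs_eq_of_mem_arm hi, Z_true_dotProduct, dev, theta]
    ring
  rw [tau, htreated, integral_empirical, integral_empirical, huntreated, Finset.sum_sub_distrib,
    Finset.sum_const, nsmul_eq_mul, mul_sub, inv_mul_cancel_left₀ hcard]
  ring

end LeastSquares

end Given

section BoundedVariation

variable {α : Type*} [LinearOrder α]

lemma dist_add_toReal_eVariationOn_Iic_le {E : Type*} [PseudoMetricSpace E] {h : α → E}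
    (hh : BoundedVariationOn h Set.univ) {a b : α} (hab : a ≤ b) :
    dist (h a) (h b) + (eVariationOn h (Set.Iic a)).toReal ≤
      (eVariationOn h (Set.Iic b)).toReal := by
  have hfin : ∀ s, eVariationOn h s ≠ ⊤ := fun s => hh.mono (Set.subset_univ s)
  have hdist : dist (h a) (h b) ≤ (eVariationOn h (Set.Icc a b)).toReal :=
    BoundedVariationOn.dist_le (hfin _) ⟨le_rfl, hab⟩ ⟨hab, le_rfl⟩
  have hunion : eVariationOn h (Set.Iic a) + eVariationOn h (Set.Icc a b) ≤
      eVariationOn h (Set.Iic b) :=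
    (eVariationOn.add_le_union h fun x hx y hy => hx.trans hy.1).trans_eq
      (by rw [Set.Iic_union_Icc_eq_Iic hab])
  have hreal := ENNReal.toReal_mono (hfin _) hunion
  rw [ENNReal.toReal_add (hfin _) (hfin _)] at hreal
  linarith

-- Summation by parts.
lemma abs_sum_mul_sub_le_mul_eVariationOn {h : α → ℝ} (hh : BoundedVariationOn h Set.univ) {c : ℝ}
    (hc : 0 ≤ c) (w : α → ℝ) (s : Finset α) (hw : ∀ t ∈ s, |∑ x ∈ s with x ≤ t, w x| ≤ c) {b : α}
    (hb : ∀ x ∈ s, x ≤ b) :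
    |∑ x ∈ s, w x * h x - (∑ x ∈ s, w x) * h b| ≤ c * (eVariationOn h (Set.Iic b)).toReal := by
  induction s using Finset.induction_on_max generalizing b with
  | empty => simpa using mul_nonneg hc ENNReal.toReal_nonneg
  | insert a s ha ih =>
    have has : a ∉ s := fun hmem => lt_irrefl a (ha a hmem)
    have hinit : |∑ x ∈ s, w x * h x - (∑ x ∈ s, w x) * h a| ≤
        c * (eVariationOn h (Set.Iic a)).toReal := by
      refine ih (fun t ht => ?_) fun x hx => (ha x hx).le
      simpa only [Finset.filter_insert, if_neg (ha t ht).not_ge] using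
        hw t (Finset.mem_insert_of_mem ht)
    have htotal : |∑ x ∈ insert a s, w x| ≤ c := by
      have hwa := hw a (Finset.mem_insert_self _ _)
      have hall : ∀ x ∈ insert a s, x ≤ a :=
        (Finset.forall_mem_insert _ _ _).2 ⟨le_rfl, fun x hx => (ha x hx).le⟩
      rwa [Finset.filter_true_of_mem hall] at hwa
    have hlast := dist_add_toReal_eVariationOn_Iic_le hh (hb a (Finset.mem_insert_self _ _))
    calc |∑ x ∈ insert a s, w x * h x - (∑ x ∈ insert a s, w x) * h b|
        = |(∑ x ∈ s, w x * h x - (∑ x ∈ s, w x) * h a) +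
            (∑ x ∈ insert a s, w x) * (h a - h b)| := by
          rw [Finset.sum_insert has, Finset.sum_insert has]
          ring_nf
      _ ≤ |∑ x ∈ s, w x * h x - (∑ x ∈ s, w x) * h a| +
            |∑ x ∈ insert a s, w x| * |h a - h b| := (abs_add_le _ _).trans_eq (by rw [abs_mul])
      _ ≤ c * (eVariationOn h (Set.Iic a)).toReal + c * dist (h a) (h b) := by
          rw [Real.dist_eq]
          gcongr
      _ ≤ c * (eVariationOn h (Set.Iic b)).toReal := by
          rw [← mul_add, add_comm]
          exact mul_le_mul_of_nonneg_left hlast hc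

end BoundedVariation

section FiniteSupport

variable {α : Type*} [MeasurableSpace α] [MeasurableSingletonClass α] {μ ν : Measure α}
  {s : Finset α}

lemma integral_eq_sum_of_ae_mem_finset [IsFiniteMeasure μ] (hμ : ∀ᵐ x ∂μ, x ∈ s) (h : α → ℝ) :
    ∫ x, h x ∂μ = ∑ x ∈ s, μ.real {x} * h x := by
  calc ∫ x, h x ∂μ = ∫ x in s, h x ∂μ := by rw [Measure.restrict_eq_self_of_ae_mem hμ]
    _ = ∑ x ∈ s, μ.real {x} * h x := by
      simp only [setIntegral_finset s (.of_finite s.finite_toSet), smul_eq_mul]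

lemma measureReal_eq_sum_of_ae_mem_finset [IsFiniteMeasure μ] (hμ : ∀ᵐ x ∂μ, x ∈ s) (t : Set α)
    [DecidablePred (· ∈ t)] : μ.real t = ∑ x ∈ s with x ∈ t, μ.real {x} := by
  rw [sum_measureReal_singleton, Finset.coe_filter]
  refine measureReal_congr ?_
  filter_upwards [hμ] with x hx
  exact propext (and_iff_right hx).symm

lemma abs_integral_sub_integral_le_mul_eVariationOn [LinearOrder α] [IsProbabilityMeasure μ]
    [IsProbabilityMeasure ν] (hμ : ∀ᵐ x ∂μ, x ∈ s) (hν : ∀ᵐ x ∂ν, x ∈ s) {h : α → ℝ}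
    (hh : BoundedVariationOn h Set.univ) {c : ℝ}
    (hc : ∀ t, |μ.real (Set.Iic t) - ν.real (Set.Iic t)| ≤ c) :
    |∫ x, h x ∂μ - ∫ x, h x ∂ν| ≤ c * (eVariationOn h Set.univ).toReal := by
  have hs : s.Nonempty := hμ.exists
  have hc0 : 0 ≤ c := (abs_nonneg _).trans (hc (s.max' hs))
  have hpartial : ∀ t ∈ s, |∑ x ∈ s with x ≤ t, (μ.real {x} - ν.real {x})| ≤ c := fun t _ => by
    have ht := hc t
    rwa [measureReal_eq_sum_of_ae_mem_finset hμ, measureReal_eq_sum_of_ae_mem_finset hν,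
      ← Finset.sum_sub_distrib] at ht
  have htotal : ∑ x ∈ s, (μ.real {x} - ν.real {x}) = 0 := by
    have hone := measureReal_eq_sum_of_ae_mem_finset hμ Set.univ
    have hone' := measureReal_eq_sum_of_ae_mem_finset hν Set.univ
    simp only [Set.mem_univ, Finset.filter_true, probReal_univ] at hone hone'
    rw [Finset.sum_sub_distrib, ← hone, ← hone', sub_self]
  have hparts := abs_sum_mul_sub_le_mul_eVariationOn hh hc0 _ s hpartial (b := s.max' hs)
    fun x hx => s.le_max' x hx
  rw [htotal, zero_mul, sub_zero] at hparts
  rw [integral_eq_sum_of_ae_mem_finset hμ, integral_eq_sum_of_ae_mem_finset hν,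
    ← Finset.sum_sub_distrib]
  simp only [← sub_mul]
  exact hparts.trans (mul_le_mul_of_nonneg_left
    (ENNReal.toReal_mono hh (eVariationOn.mono h (Set.subset_univ _))) hc0)

end FiniteSupport

lemma enorm_integral_map_fst_sub_integral_map_snd_le {α : Type*} [MeasurableSpace α]
    {π : Measure (α × α)} {g : α → ℝ} (hfst : Integrable g (π.map Prod.fst))
    (hsnd : Integrable g (π.map Prod.snd)) :
    ‖∫ x, g x ∂(π.map Prod.fst) - ∫ x, g x ∂(π.map Prod.snd)‖ₑ ≤
      ∫⁻ x, ‖g x.1 - g x.2‖ₑ ∂π := by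
  have hsub : ∫ x, (g x.1 - g x.2) ∂π = ∫ x, g x.1 ∂π - ∫ x, g x.2 ∂π :=
    integral_sub (hfst.comp_measurable measurable_fst) (hsnd.comp_measurable measurable_snd)
  rw [integral_map measurable_fst.aemeasurable hfst.aestronglyMeasurable,
    integral_map measurable_snd.aemeasurable hsnd.aestronglyMeasurable, ← hsub]
  exact enorm_integral_le_lintegral_enorm _

namespace Given

section Empirical

variable {p q n : ℕ} (P : Given p q n)

lemma isProbabilityMeasure_empirical {d : Bool} (h : (P.arm d).Nonempty) :
    IsProbabilityMeasure (P.empirical d) := by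
  have hcard : ((P.arm d).card : ℝ≥0∞) ≠ 0 := Nat.cast_ne_zero.2 h.card_ne_zero
  constructor
  simp [empirical, ENNReal.inv_mul_cancel hcard]

lemma ae_empirical {d : Bool} {s : Ctrl p → Prop} (h : ∀ i ∈ P.arm d, s (P.X i)) :
    ∀ᵐ x ∂(P.empirical d), s x := by
  refine Measure.ae_smul_measure ?_ _
  simpa [ae_finsetSum_measure_iff] using h

end Empirical

section KolmogorovSmirnov

variable {q n : ℕ} (P : Given 1 q n)

lemma cKS_nonneg : 0 ≤ P.cKS := Real.iSup_nonneg fun _ => abs_nonneg _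

variable {P}

lemma abs_measureReal_Iic_sub_le_cKS (hne : ∀ d, (P.arm d).Nonempty) (t : ℝ) :
    |(P.empirical true).real {x | x 0 ≤ t} - (P.empirical false).real {x | x 0 ≤ t}| ≤ P.cKS := by
  have := P.isProbabilityMeasure_empirical (hne true)
  have := P.isProbabilityMeasure_empirical (hne false)
  refine le_ciSup (f := fun t : ℝ => |(P.empirical true).real {x | x 0 ≤ t} -
    (P.empirical false).real {x | x 0 ≤ t}|) ⟨1, ?_⟩ t
  rintro _ ⟨t, rfl⟩
  exact abs_sub_le_of_nonneg_of_le measureReal_nonneg measureReal_le_one measureReal_nonneg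
    measureReal_le_one

lemma abs_integral_sub_le_cKS_mul_eVariationOn (hne : ∀ d, (P.arm d).Nonempty) {h : ℝ → ℝ}
    (hmeas : Measurable h) (hh : BoundedVariationOn h Set.univ) :
    |∫ x, h (x 0) ∂(P.empirical true) - ∫ x, h (x 0) ∂(P.empirical false)| ≤
      P.cKS * (eVariationOn h Set.univ).toReal := by
  have hcoord : Measurable fun x : Ctrl 1 => x 0 := by fun_prop
  have hprob : ∀ d, IsProbabilityMeasure ((P.empirical d).map fun x => x 0) := fun d =>
    have := P.isProbabilityMeasure_empirical (hne d)
    Measure.isProbabilityMeasure_map hcoord.aemeasurable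
  have hsupp : ∀ d, ∀ᵐ t ∂((P.empirical d).map fun x => x 0), t ∈ P.sub.image fun i => P.X i 0 :=
    fun d => (ae_map_iff hcoord.aemeasurable (Finset.measurableSet _)).2 <|
      P.ae_empirical fun i hi => Finset.mem_image_of_mem (fun i => P.X i 0) (P.arm_subset d hi)
  have hKS : ∀ t, |((P.empirical true).map fun x => x 0).real (Set.Iic t) -
      ((P.empirical false).map fun x => x 0).real (Set.Iic t)| ≤ P.cKS := fun t => by
    rw [map_measureReal_apply hcoord measurableSet_Iic,
      map_measureReal_apply hcoord measurableSet_Iic]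
    exact abs_measureReal_Iic_sub_le_cKS hne t
  have := hprob true
  have := hprob false
  have hbound := abs_integral_sub_integral_le_mul_eVariationOn (hsupp true) (hsupp false) hh hKS
  rwa [integral_map hcoord.aemeasurable hmeas.aestronglyMeasurable,
    integral_map hcoord.aemeasurable hmeas.aestronglyMeasurable] at hbound

lemma abs_integral_dev_sub_le_mKS_mul_cKS (hne : ∀ d, (P.arm d).Nonempty)
    (hpos : 0 < P.mKS * P.cKS) :
    |∫ x, P.dev x ∂(P.empirical true) - ∫ x, P.dev x ∂(P.empirical false)| ≤
      P.mKS * P.cKS := by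
  have hc : 0 < P.cKS := P.cKS_nonneg.lt_of_ne (right_ne_zero_of_mul hpos.ne').symm
  have hm : 0 < P.mKS := pos_of_mul_pos_left hpos hc.le
  rw [← div_le_iff₀ hc, mKS,
    ← ENNReal.ofReal_le_iff_le_toReal (ENNReal.toReal_pos_iff.1 hm).2.ne]
  refine le_iInf₂ fun h ⟨hcont, _, hext⟩ => ?_
  rcases eq_or_ne (eVariationOn h Set.univ) ⊤ with htop | hh
  · exact le_top.trans_eq htop.symm
  have hdev : ∀ d, ∫ x, P.dev x ∂(P.empirical d) = ∫ x, h (x 0) ∂(P.empirical d) := fun d =>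
    integral_congr_ae (P.ae_empirical fun i hi => (hext i (P.arm_subset d hi)).symm)
  rw [ENNReal.ofReal_le_iff_le_toReal hh, div_le_iff₀' hc, hdev, hdev]
  exact abs_integral_sub_le_cKS_mul_eVariationOn hne hcont.measurable hh

end KolmogorovSmirnov

section MongeKantorovich

variable {p q n : ℕ} {P : Given p q n}

lemma abs_dev_sub_le_mMKW (hm : 0 < P.mMKW) {x y : Ctrl p} (hx : x ∈ P.X '' P.sub)
    (hy : y ∈ P.X '' P.sub) : |P.dev x - P.dev y| ≤ P.mMKW * ‖x - y‖ := by
  rcases eq_or_ne x y with rfl | hxy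
  · simp
  have htop := (ENNReal.toReal_pos_iff.1 hm).2.ne
  rw [← div_le_iff₀ (norm_sub_pos_iff.2 hxy), mMKW, ← ENNReal.ofReal_le_iff_le_toReal htop]
  exact le_iSup₂ (f := fun (x : Ctrl p × Ctrl p)
    (_ : x ∈ {x : Ctrl p × Ctrl p | x.1 ≠ x.2 ∧ x.1 ∈ P.X '' P.sub ∧ x.2 ∈ P.X '' P.sub}) =>
    ENNReal.ofReal (|P.dev x.1 - P.dev x.2| / ‖x.1 - x.2‖)) (x, y) ⟨hxy, hx, hy⟩

lemma abs_integral_dev_sub_le_mMKW_mul_cMKW (hpos : 0 < P.mMKW * P.cMKW) :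
    |∫ x, P.dev x ∂(P.empirical true) - ∫ x, P.dev x ∂(P.empirical false)| ≤
      P.mMKW * P.cMKW := by
  have hc : 0 < P.cMKW :=
    ENNReal.toReal_nonneg.lt_of_ne (right_ne_zero_of_mul hpos.ne').symm
  have hm : 0 < P.mMKW := pos_of_mul_pos_left hpos hc.le
  rw [← div_le_iff₀' hm, cMKW,
    ← ENNReal.ofReal_le_iff_le_toReal (ENNReal.toReal_pos_iff.1 hc).2.ne]
  refine le_iInf₂ fun π ⟨hfst, hsnd⟩ => ?_
  rw [ENNReal.ofReal_div_of_pos hm, ← Real.enorm_eq_ofReal_abs]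
  refine ENNReal.div_le_of_le_mul' ?_
  have hmem : ∀ d, ∀ᵐ x ∂(P.empirical d), x ∈ P.X '' P.sub := fun d =>
    P.ae_empirical fun i hi => Set.mem_image_of_mem _ (P.arm_subset d hi)
  calc ‖∫ x, P.dev x ∂(P.empirical true) - ∫ x, P.dev x ∂(P.empirical false)‖ₑ
      ≤ ∫⁻ x, ‖P.dev x.1 - P.dev x.2‖ₑ ∂π := by
        simpa only [hfst, hsnd] using enorm_integral_map_fst_sub_integral_map_snd_le (π := π)
          (hfst ▸ P.integrable_empirical true P.dev) (hsnd ▸ P.integrable_empirical false P.dev)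
    _ ≤ ∫⁻ x, ENNReal.ofReal P.mMKW * ENNReal.ofReal ‖x.1 - x.2‖ ∂π := by
        refine lintegral_mono_ae ?_
        filter_upwards [ae_of_ae_map measurable_fst.aemeasurable (hfst ▸ hmem true),
          ae_of_ae_map measurable_snd.aemeasurable (hsnd ▸ hmem false)] with x hx₁ hx₂
        rw [← ENNReal.ofReal_mul hm.le, Real.enorm_eq_ofReal_abs]
        exact ENNReal.ofReal_le_ofReal (abs_dev_sub_le_mMKW hm hx₁ hx₂)
    _ = ENNReal.ofReal P.mMKW * ∫⁻ x, ENNReal.ofReal ‖x.1 - x.2‖ ∂π :=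
        lintegral_const_mul' _ _ ENNReal.ofReal_ne_top

end MongeKantorovich

section MeanDifference

variable {p q n J : ℕ} (P : Given p q n)

lemma abs_integral_dotProduct_sub_le (r : Ctrl p → Fin J → ℝ) (ζ : Fin J → ℝ) :
    |∫ x, r x ⬝ᵥ ζ ∂(P.empirical true) - ∫ x, r x ⬝ᵥ ζ ∂(P.empirical false)| ≤
      (fun j => |ζ j|) ⬝ᵥ P.cMD r := by
  have hlin : ∀ d, ∫ x, r x ⬝ᵥ ζ ∂(P.empirical d) = ∑ j, (∫ x, r x j ∂(P.empirical d)) * ζ j :=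
    fun d => by
      simp only [dotProduct]
      rw [integral_finsetSum _ fun j _ => P.integrable_empirical d _]
      simp only [integral_mul_const]
  rw [hlin, hlin, ← Finset.sum_sub_distrib]
  refine (Finset.abs_sum_le_sum_abs _ _).trans_eq (Finset.sum_congr rfl fun j _ => ?_)
  rw [← sub_mul, abs_mul, mul_comm, cMD]

variable {P}

lemma mul_integral_dev_sub_le_of_sepFeasible {r : Ctrl p → Fin J → ℝ} {σ : ℝ} (hσ : |σ| = 1)
    {ζ : Fin J → ℝ} (h : P.SepFeasible r σ ζ 0) :
    σ * (∫ x, P.dev x ∂(P.empirical true) - ∫ x, P.dev x ∂(P.empirical false)) ≤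
      (fun j => |ζ j|) ⬝ᵥ P.cMD r := by
  have hsupp : ∀ d, ∀ i ∈ P.arm d, P.X i ∈ P.supp d := fun d i hi => by
    rw [supp, Finset.mem_image]
    exact ⟨i, hi, rfl⟩
  have htreated : ∫ x, σ * P.dev x ∂(P.empirical true) ≤
      ∫ x, σ * (r x ⬝ᵥ ζ) ∂(P.empirical true) :=
    integral_mono_ae (P.integrable_empirical _ _) (P.integrable_empirical _ _) <|
      P.ae_empirical fun i hi => by simpa using h.1 _ (hsupp _ i hi)
  have huntreated : ∫ x, σ * (r x ⬝ᵥ ζ) ∂(P.empirical false) ≤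
      ∫ x, σ * P.dev x ∂(P.empirical false) :=
    integral_mono_ae (P.integrable_empirical _ _) (P.integrable_empirical _ _) <|
      P.ae_empirical fun i hi => by simpa using h.2 _ (hsupp _ i hi)
  simp only [integral_const_mul] at htreated huntreated
  calc σ * (∫ x, P.dev x ∂(P.empirical true) - ∫ x, P.dev x ∂(P.empirical false))
      ≤ σ * (∫ x, r x ⬝ᵥ ζ ∂(P.empirical true) - ∫ x, r x ⬝ᵥ ζ ∂(P.empirical false)) := by
        linarith
    _ ≤ |∫ x, r x ⬝ᵥ ζ ∂(P.empirical true) - ∫ x, r x ⬝ᵥ ζ ∂(P.empirical false)| := by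
        refine (le_abs_self _).trans_eq ?_
        rw [abs_mul, hσ, one_mul]
    _ ≤ (fun j => |ζ j|) ⬝ᵥ P.cMD r := P.abs_integral_dotProduct_sub_le r ζ

end MeanDifference

end Given

section Bias

variable {p q n : ℕ}

lemma BalanceMetric.imbalance_nonneg (B : BalanceMetric p) (P : Given p q n) :
    0 ≤ B.imbalance P := by
  intro j
  cases B with
  | ks => exact P.cKS_nonneg
  | mkw => exact ENNReal.toReal_nonneg
  | md J r L => exact abs_nonneg _

lemma abs_integral_dev_sub_le_dotProduct_cMD {J : ℕ} {P : Given p q n} {r : Ctrl p → Fin J → ℝ}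
    {ζ₁ ζ₂ m : Fin J → ℝ} (h₁ : P.SepFeasible r 1 ζ₁ 0) (h₂ : P.SepFeasible r (-1) ζ₂ 0)
    (hm : ∀ j, m j = max |ζ₁ j| |ζ₂ j|) :
    |∫ x, P.dev x ∂(P.empirical true) - ∫ x, P.dev x ∂(P.empirical false)| ≤ m ⬝ᵥ P.cMD r := by
  have hle : ∀ ζ : Fin J → ℝ, (∀ j, |ζ j| ≤ m j) → (fun j => |ζ j|) ⬝ᵥ P.cMD r ≤ m ⬝ᵥ P.cMD r :=
    fun ζ hζ => Finset.sum_le_sum fun j _ => mul_le_mul_of_nonneg_right (hζ j) (abs_nonneg _)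
  have hupper := (Given.mul_integral_dev_sub_le_of_sepFeasible (by simp) h₁).trans
    (hle ζ₁ fun j => (le_max_left _ _).trans_eq (hm j).symm)
  have hlower := (Given.mul_integral_dev_sub_le_of_sepFeasible (by simp) h₂).trans
    (hle ζ₂ fun j => (le_max_right _ _).trans_eq (hm j).symm)
  exact abs_le.2 ⟨by linarith, by linarith⟩

lemma abs_theta_one_sub_tau_le {B : BalanceMetric p} {P : Given p q n} (hG : IsUnit P.Gam)
    {m : Fin B.dim → ℝ} (hm : B.IsMisspec P m) (hpos : 0 < m ⬝ᵥ B.imbalance P) :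
    |P.theta 1 - P.tau| ≤ m ⬝ᵥ B.imbalance P := by
  rw [Given.theta_one_sub_tau hG]
  cases B with
  | ks =>
    have hprod : m ⬝ᵥ BalanceMetric.ks.imbalance P = P.mKS * P.cKS := by
      rw [funext hm]
      exact Fin.sum_univ_one _
    rw [hprod] at hpos ⊢
    exact Given.abs_integral_dev_sub_le_mKS_mul_cKS (Given.arm_nonempty hG) hpos
  | mkw =>
    have hprod : m ⬝ᵥ BalanceMetric.mkw.imbalance P = P.mMKW * P.cMKW := by
      rw [funext hm]
      exact Fin.sum_univ_one _
    rw [hprod] at hpos ⊢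
    exact Given.abs_integral_dev_sub_le_mMKW_mul_cMKW hpos
  | md J r L =>
    obtain ⟨ζ₁, ζ₂, h₁, h₂, hmax⟩ := hm
    exact abs_integral_dev_sub_le_dotProduct_cMD h₁.1 h₂.1 hmax

end Bias

section ProductsAndExponentials

lemma norm_prod_sub_prod_le_sum {ι : Type*} (s : Finset ι) {a b : ι → ℂ}
    (ha : ∀ i ∈ s, ‖a i‖ ≤ 1) (hb : ∀ i ∈ s, ‖b i‖ ≤ 1) :
    ‖∏ i ∈ s, a i - ∏ i ∈ s, b i‖ ≤ ∑ i ∈ s, ‖a i - b i‖ := by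
  classical
  induction s using Finset.induction_on with
  | empty => simp
  | insert j s hj ih =>
    rw [Finset.forall_mem_insert] at ha hb
    have hprod : ‖∏ i ∈ s, b i‖ ≤ 1 := by
      rw [norm_prod]
      exact Finset.prod_le_one (fun _ _ => norm_nonneg _) hb.2
    rw [Finset.prod_insert hj, Finset.prod_insert hj, Finset.sum_insert hj]
    calc ‖a j * ∏ i ∈ s, a i - b j * ∏ i ∈ s, b i‖
        = ‖(a j - b j) * ∏ i ∈ s, b i + a j * (∏ i ∈ s, a i - ∏ i ∈ s, b i)‖ := by ring_nf
      _ ≤ ‖a j - b j‖ * ‖∏ i ∈ s, b i‖ + ‖a j‖ * ‖∏ i ∈ s, a i - ∏ i ∈ s, b i‖ :=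
          (norm_add_le _ _).trans_eq (by rw [norm_mul, norm_mul])
      _ ≤ ‖a j - b j‖ + ∑ i ∈ s, ‖a i - b i‖ :=
          add_le_add (mul_le_of_le_one_right (norm_nonneg _) hprod)
            ((mul_le_of_le_one_left (norm_nonneg _) ha.1).trans (ih ha.2 hb.2))

lemma norm_exp_mul_I_sub_taylor_two_le (y : ℝ) :
    ‖Complex.exp (y * Complex.I) - (1 + y * Complex.I - (y : ℂ) ^ 2 / 2)‖ ≤ 4 * |y| ^ 3 := by
  rcases le_total |y| 1 with h | h
  · have hnorm : ‖(y : ℂ) * Complex.I‖ = |y| := by simp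
    have htaylor : ∑ m ∈ Finset.range 3, ((y : ℂ) * Complex.I) ^ m / (m.factorial : ℂ) =
        1 + y * Complex.I - (y : ℂ) ^ 2 / 2 := by
      simp [Finset.sum_range_succ, mul_pow]
      ring
    have hbound := Complex.exp_bound (hnorm.trans_le h) (n := 3) (by norm_num)
    rw [hnorm, htaylor] at hbound
    refine hbound.trans ((mul_le_mul_of_nonneg_left ?_ (by positivity)).trans_eq (mul_comm _ 4))
    norm_num [Nat.factorial]
  · have htriangle : ‖Complex.exp (y * Complex.I) - (1 + y * Complex.I - (y : ℂ) ^ 2 / 2)‖ ≤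
        1 + (1 + |y| + |y| ^ 2 / 2) := by
      refine (norm_sub_le _ _).trans (add_le_add (Complex.norm_exp_ofReal_mul_I _).le ?_)
      refine (norm_sub_le _ _).trans (add_le_add ((norm_add_le _ _).trans ?_) ?_) <;> simp
    have hsq : |y| ≤ |y| ^ 2 := by nlinarith
    have hcube : |y| ^ 2 ≤ |y| ^ 3 := pow_le_pow_right₀ h (by norm_num)
    linarith

lemma abs_exp_neg_sub_le {x : ℝ} (hx : 0 ≤ x) : |Real.exp (-x) - (1 - x)| ≤ x ^ 2 := by
  rw [abs_of_nonneg (sub_nonneg.2 (Real.one_sub_le_exp_neg x))]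
  rcases le_total x 1 with h | h
  · have hbound := Real.abs_exp_sub_one_sub_id_le (x := -x) (by rwa [abs_neg, abs_of_nonneg hx])
    linarith [le_abs_self (Real.exp (-x) - 1 - -x)]
  · nlinarith [Real.exp_le_one_iff.2 (neg_nonpos.2 hx)]

end ProductsAndExponentials

section FourthMoments

variable {Ω : Type*} {mΩ : MeasurableSpace Ω} {μ : Measure Ω} [IsProbabilityMeasure μ]
  {X : Ω → ℝ} {C : ℝ}

lemma abs_pow_le_one_add_pow_four (x : ℝ) {k : ℕ} (hk : k ≤ 4) : |x| ^ k ≤ 1 + x ^ 4 := by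
  have hfour : x ^ 4 = |x| ^ 4 := ((by decide : Even 4).pow_abs x).symm
  rcases le_total |x| 1 with h | h
  · exact (pow_le_one₀ (abs_nonneg x) h).trans (le_add_of_nonneg_right (by positivity))
  · rw [hfour]
    exact (pow_le_pow_right₀ h hk).trans (le_add_of_nonneg_left zero_le_one)

lemma integrable_abs_pow_of_integrable_pow_four (hX : AEStronglyMeasurable X μ)
    (h : Integrable (fun ω => X ω ^ 4) μ) {k : ℕ} (hk : k ≤ 4) :
    Integrable (fun ω => |X ω| ^ k) μ :=
  ((integrable_const (1 : ℝ)).add h).mono' (hX.norm.pow k) <| ae_of_all _ fun ω => by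
    simpa using abs_pow_le_one_add_pow_four (X ω) hk

lemma integrable_of_integrable_pow_four (hX : AEStronglyMeasurable X μ)
    (h : Integrable (fun ω => X ω ^ 4) μ) : Integrable X μ :=
  (integrable_norm_iff hX).1 <| by
    simpa using integrable_abs_pow_of_integrable_pow_four hX h (k := 1) (by norm_num)

lemma integrable_sq_of_integrable_pow_four (hX : AEStronglyMeasurable X μ)
    (h : Integrable (fun ω => X ω ^ 4) μ) : Integrable (fun ω => X ω ^ 2) μ := by
  simpa only [sq_abs] using
    integrable_abs_pow_of_integrable_pow_four hX h (k := 2) (by norm_num)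

lemma integral_abs_pow_le_of_integral_pow_four_le (hX : AEStronglyMeasurable X μ)
    (h : Integrable (fun ω => X ω ^ 4) μ) (hC : ∫ ω, X ω ^ 4 ∂μ ≤ C) {k : ℕ} (hk : k ≤ 4) :
    ∫ ω, |X ω| ^ k ∂μ ≤ 1 + C :=
  calc ∫ ω, |X ω| ^ k ∂μ ≤ ∫ ω, (1 + X ω ^ 4) ∂μ :=
        integral_mono (integrable_abs_pow_of_integrable_pow_four hX h hk)
          ((integrable_const (1 : ℝ)).add h) fun ω => abs_pow_le_one_add_pow_four (X ω) hk
    _ ≤ 1 + C := by simpa [integral_add (integrable_const (1 : ℝ)) h] using hC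

lemma integral_sq_le_of_integral_pow_four_le (hX : AEStronglyMeasurable X μ)
    (h : Integrable (fun ω => X ω ^ 4) μ) (hC : ∫ ω, X ω ^ 4 ∂μ ≤ C) :
    ∫ ω, X ω ^ 2 ∂μ ≤ 1 + C := by
  simpa only [sq_abs] using
    integral_abs_pow_le_of_integral_pow_four_le hX h hC (k := 2) (by norm_num)

lemma integrable_exp_ofReal_mul_I (hX : AEStronglyMeasurable X μ) :
    Integrable (fun ω => Complex.exp (X ω * Complex.I)) μ :=
  .of_bound ((by fun_prop : Continuous fun x : ℝ => Complex.exp (x * Complex.I))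
    |>.comp_aestronglyMeasurable hX) 1
    (ae_of_all _ fun ω => (Complex.norm_exp_ofReal_mul_I _).le)

lemma charFun_map_sub_taylor_two_eq_integral (hX : AEMeasurable X μ)
    (h : Integrable (fun ω => X ω ^ 4) μ) (h0 : ∫ ω, X ω ∂μ = 0) (u : ℝ) :
    charFun (μ.map X) u - (1 - u ^ 2 * ((∫ ω, X ω ^ 2 ∂μ) / 2) : ℝ) =
      ∫ ω, (Complex.exp ((u * X ω : ℝ) * Complex.I) -
        (1 + (u * X ω : ℝ) * Complex.I - ((u * X ω : ℝ) : ℂ) ^ 2 / 2)) ∂μ := by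
  have hXs := hX.aestronglyMeasurable
  have hlin : Integrable (fun ω => ((u * X ω : ℝ) : ℂ) * Complex.I) μ :=
    (((integrable_of_integrable_pow_four hXs h).const_mul u).ofReal (𝕜 := ℂ)).mul_const _
  have hquad : Integrable (fun ω => ((u * X ω : ℝ) : ℂ) ^ 2 / 2) μ := by
    have hsq := ((integrable_sq_of_integrable_pow_four hXs h).const_mul (u ^ 2)).ofReal (𝕜 := ℂ)
    simpa [mul_pow] using hsq.div_const 2
  have hlin_zero : ∫ ω, ((u * X ω : ℝ) : ℂ) * Complex.I ∂μ = 0 := by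
    rw [integral_mul_const, integral_complex_ofReal, integral_const_mul, h0]
    simp
  have hquad_eq : ∫ ω, ((u * X ω : ℝ) : ℂ) ^ 2 / 2 ∂μ =
      ((u ^ 2 * ((∫ ω, X ω ^ 2 ∂μ) / 2) : ℝ) : ℂ) := by
    simp only [← Complex.ofReal_pow, mul_pow]
    rw [integral_div, integral_complex_ofReal, integral_const_mul]
    push_cast
    ring
  have hone_add : Integrable (fun ω => 1 + ((u * X ω : ℝ) : ℂ) * Complex.I) μ :=
    (integrable_const _).add hlin
  have htaylor : Integrable (fun ω => 1 + ((u * X ω : ℝ) : ℂ) * Complex.I -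
      ((u * X ω : ℝ) : ℂ) ^ 2 / 2) μ := hone_add.sub hquad
  rw [integral_sub (integrable_exp_ofReal_mul_I (hXs.const_mul u)) htaylor,
    integral_sub hone_add hquad, integral_add (integrable_const _) hlin, hlin_zero, hquad_eq,
    charFun_apply_real, integral_map hX (by fun_prop)]
  simp

lemma norm_charFun_sub_taylor_two_le (hX : AEMeasurable X μ)
    (h : Integrable (fun ω => X ω ^ 4) μ) (hC : ∫ ω, X ω ^ 4 ∂μ ≤ C) (h0 : ∫ ω, X ω ∂μ = 0)
    (u : ℝ) :
    ‖charFun (μ.map X) u - (1 - u ^ 2 * ((∫ ω, X ω ^ 2 ∂μ) / 2) : ℝ)‖ ≤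
      4 * (1 + C) * |u| ^ 3 := by
  have hXs := hX.aestronglyMeasurable
  rw [charFun_map_sub_taylor_two_eq_integral hX h h0]
  calc ‖∫ ω, (Complex.exp ((u * X ω : ℝ) * Complex.I) -
          (1 + (u * X ω : ℝ) * Complex.I - ((u * X ω : ℝ) : ℂ) ^ 2 / 2)) ∂μ‖
      ≤ ∫ ω, 4 * |u| ^ 3 * |X ω| ^ 3 ∂μ :=
        norm_integral_le_of_norm_le
          ((integrable_abs_pow_of_integrable_pow_four hXs h (by norm_num)).const_mul _) <|
          ae_of_all _ fun ω => (norm_exp_mul_I_sub_taylor_two_le _).trans_eq <| by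
            rw [abs_mul, mul_pow, mul_assoc]
    _ = 4 * (∫ ω, |X ω| ^ 3 ∂μ) * |u| ^ 3 := by rw [integral_const_mul]; ring
    _ ≤ 4 * (1 + C) * |u| ^ 3 := by
        gcongr
        exact integral_abs_pow_le_of_integral_pow_four_le hXs h hC (by norm_num)

lemma norm_charFun_sub_exp_le (hX : AEMeasurable X μ) (h : Integrable (fun ω => X ω ^ 4) μ)
    (hC : ∫ ω, X ω ^ 4 ∂μ ≤ C) (h0 : ∫ ω, X ω ∂μ = 0) (u : ℝ) :
    ‖charFun (μ.map X) u - Complex.exp (-(u ^ 2 * ((∫ ω, X ω ^ 2 ∂μ) / 2)) : ℝ)‖ ≤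
      4 * (1 + C) * |u| ^ 3 + (1 + C) ^ 2 * |u| ^ 4 := by
  have hsq0 : 0 ≤ ∫ ω, X ω ^ 2 ∂μ := integral_nonneg fun ω => sq_nonneg _
  have hsq := integral_sq_le_of_integral_pow_four_le hX.aestronglyMeasurable h hC
  set V := (∫ ω, X ω ^ 2 ∂μ) / 2 with hV_def
  have hV : 0 ≤ V ∧ V ≤ 1 + C := by constructor <;> linarith
  have hexp : ‖((1 - u ^ 2 * V : ℝ) : ℂ) - Complex.exp (-(u ^ 2 * V) : ℝ)‖ ≤
      (1 + C) ^ 2 * |u| ^ 4 := by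
    rw [norm_sub_rev, ← Complex.ofReal_exp, ← Complex.ofReal_sub, Complex.norm_real,
      Real.norm_eq_abs]
    calc |Real.exp (-(u ^ 2 * V)) - (1 - u ^ 2 * V)| ≤ (u ^ 2 * V) ^ 2 :=
          abs_exp_neg_sub_le (mul_nonneg (sq_nonneg u) hV.1)
      _ = V ^ 2 * |u| ^ 4 := by rw [(by decide : Even 4).pow_abs]; ring
      _ ≤ (1 + C) ^ 2 * |u| ^ 4 :=
          mul_le_mul_of_nonneg_right (pow_le_pow_left₀ hV.1 hV.2 2) (by positivity)
  exact (norm_sub_le_norm_sub_add_norm_sub _ _ _).trans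
    (add_le_add (norm_charFun_sub_taylor_two_le hX h hC h0 u) hexp)

end FourthMoments

section TriangularArray

lemma norm_charFun_normalized_sum_sub_le {Ω ι : Type*} [MeasurableSpace Ω] {μ : Measure Ω}
    {s : Finset ι} {X : ι → Ω → ℝ} (hX : ∀ i, Measurable (X i)) (hind : iIndepFun X μ)
    (h0 : ∀ i ∈ s, ∫ ω, X i ω ∂μ = 0) {C : ℝ}
    (h4 : ∀ i ∈ s, Integrable (fun ω => X i ω ^ 4) μ ∧ ∫ ω, X i ω ^ 4 ∂μ ≤ C) {σ : ℝ} (hσ : σ ≠ 0)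
    (hvar : σ ^ 2 = ∑ i ∈ s, ∫ ω, X i ω ^ 2 ∂μ) (t : ℝ) :
    ‖charFun (μ.map fun ω => σ⁻¹ * ∑ i ∈ s, X i ω) t - charFun (gaussianReal 0 1) t‖ ≤
      s.card * (4 * (1 + C) * |σ⁻¹ * t| ^ 3 + (1 + C) ^ 2 * |σ⁻¹ * t| ^ 4) := by
  have := hind.isProbabilityMeasure
  have hchar : charFun (μ.map fun ω => σ⁻¹ * ∑ i ∈ s, X i ω) t =
      ∏ i ∈ s, charFun (μ.map (X i)) (σ⁻¹ * t) := by
    rw [charFun_map_mul_comp (Finset.measurable_fun_sum _ fun i _ => hX i).aemeasurable,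
      (hind.restrict _).charFun_map_fun_finsetSum_eq_prod fun i _ => (hX i).aemeasurable,
      Finset.prod_apply]
  have hgauss : charFun (gaussianReal 0 1) t =
      ∏ i ∈ s, Complex.exp (-((σ⁻¹ * t) ^ 2 * ((∫ ω, X i ω ^ 2 ∂μ) / 2)) : ℝ) := by
    rw [charFun_gaussianReal, ← Complex.exp_sum, ← Complex.ofReal_sum, Finset.sum_neg_distrib,
      ← Finset.mul_sum]
    rw [← Finset.sum_div, ← hvar,
      show (σ⁻¹ * t) ^ 2 * (σ ^ 2 / 2) = t ^ 2 / 2 by field_simp]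
    congr 1
    push_cast
    simp
  have hfactor : ∀ i ∈ s, ‖charFun (μ.map (X i)) (σ⁻¹ * t)‖ ≤ 1 := fun i _ =>
    have := Measure.isProbabilityMeasure_map (μ := μ) (hX i).aemeasurable
    norm_charFun_le_one _
  have hfactor_gauss : ∀ i ∈ s,
      ‖Complex.exp (-((σ⁻¹ * t) ^ 2 * ((∫ ω, X i ω ^ 2 ∂μ) / 2)) : ℝ)‖ ≤ 1 := fun i _ => by
    rw [Complex.norm_exp, Complex.ofReal_re, Real.exp_le_one_iff, neg_nonpos]
    exact mul_nonneg (sq_nonneg _) (div_nonneg (integral_nonneg fun ω => sq_nonneg _) zero_le_two)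
  rw [hchar, hgauss, ← nsmul_eq_mul]
  exact (norm_prod_sub_prod_le_sum s hfactor hfactor_gauss).trans <|
    Finset.sum_le_card_nsmul _ _ _ fun i hi =>
      norm_charFun_sub_exp_le (hX i).aemeasurable (h4 i hi).1 (h4 i hi).2 (h0 i hi) _

lemma tendsto_measureReal_le_of_tendsto_charFun {Ω : ℕ → Type*} [∀ n, MeasurableSpace (Ω n)]
    {μ : ∀ n, Measure (Ω n)} [∀ n, IsProbabilityMeasure (μ n)] {S : ∀ n, Ω n → ℝ}
    (hS : ∀ n, Measurable (S n))
    (h : ∀ t, Tendsto (fun n => charFun ((μ n).map (S n)) t) atTop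
      (𝓝 (charFun (gaussianReal 0 1) t))) (z : ℝ) :
    Tendsto (fun n => (μ n).real {ω | S n ω ≤ z}) atTop (𝓝 (Phi z)) := by
  let γ : ProbabilityMeasure ℝ := ⟨gaussianReal 0 1, inferInstance⟩
  let ρ : ℕ → ProbabilityMeasure ℝ := fun n =>
    ⟨(μ n).map (S n), Measure.isProbabilityMeasure_map (hS n).aemeasurable⟩
  have hlim : Tendsto ρ atTop (𝓝 γ) := ProbabilityMeasure.tendsto_iff_tendsto_charFun.2 h
  have hfrontier : (γ : Measure ℝ) (frontier (Set.Iic z)) = 0 := by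
    have := nullSingletonClass_gaussianReal (μ := 0) (v := 1) one_ne_zero
    rw [frontier_Iic]
    exact measure_singleton (μ := gaussianReal 0 1) z
  have hprob := (ENNReal.tendsto_toReal (measure_ne_top _ _)).comp
    (ProbabilityMeasure.tendsto_measure_of_null_frontier_of_tendsto' hlim hfrontier)
  rw [Phi, cdf_eq_real]
  refine hprob.congr fun n => ?_
  exact congrArg ENNReal.toReal (Measure.map_apply (hS n) measurableSet_Iic)

lemma mul_abs_inv_mul_sq_le {k c σ : ℝ} (hσ : σ ≠ 0) (hc : 0 < c) (h : c * k ≤ σ ^ 2) (t : ℝ) :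
    k * |σ⁻¹ * t| ^ 2 ≤ t ^ 2 / c := by
  rw [sq_abs, mul_pow, inv_pow, le_div_iff₀ hc]
  calc k * ((σ ^ 2)⁻¹ * t ^ 2) * c = c * k * (σ ^ 2)⁻¹ * t ^ 2 := by ring
    _ ≤ σ ^ 2 * (σ ^ 2)⁻¹ * t ^ 2 := by gcongr
    _ = t ^ 2 := by rw [mul_inv_cancel₀ (pow_ne_zero 2 hσ), one_mul]

lemma tendsto_measureReal_normalized_sum_le {Ω ι : ℕ → Type*} [∀ n, MeasurableSpace (Ω n)]
    {μ : ∀ n, Measure (Ω n)} [∀ n, IsProbabilityMeasure (μ n)] {s : ∀ n, Finset (ι n)}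
    {X : ∀ n, ι n → Ω n → ℝ} (hX : ∀ n i, Measurable (X n i)) (hind : ∀ n, iIndepFun (X n) (μ n))
    (hs : Tendsto (fun n => (s n).card) atTop atTop)
    (h0 : ∀ᶠ n in atTop, ∀ i ∈ s n, ∫ ω, X n i ω ∂(μ n) = 0) {C c : ℝ} (hc : 0 < c)
    (h4 : ∀ᶠ n in atTop, ∀ i ∈ s n, Integrable (fun ω => X n i ω ^ 4) (μ n) ∧
      ∫ ω, X n i ω ^ 4 ∂(μ n) ≤ C) {σ : ℕ → ℝ}
    (hσ : ∀ᶠ n in atTop, σ n ^ 2 = ∑ i ∈ s n, ∫ ω, X n i ω ^ 2 ∂(μ n))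
    (hσc : ∀ᶠ n in atTop, c * (s n).card ≤ σ n ^ 2) (z : ℝ) :
    Tendsto (fun n => (μ n).real {ω | (σ n)⁻¹ * ∑ i ∈ s n, X n i ω ≤ z}) atTop (𝓝 (Phi z)) := by
  refine tendsto_measureReal_le_of_tendsto_charFun
    (fun n => (Finset.measurable_fun_sum _ fun i _ => hX n i).const_mul _) (fun t => ?_) z
  have hcard : Tendsto (fun n => ((s n).card : ℝ)) atTop atTop :=
    tendsto_natCast_atTop_atTop.comp hs
  have hsq_atTop : Tendsto (fun n => σ n ^ 2) atTop atTop :=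
    tendsto_atTop_mono' _ hσc (hcard.const_mul_atTop hc)
  have hu : Tendsto (fun n => |(σ n)⁻¹ * t|) atTop (𝓝 0) := by
    have hsqrt := (tendsto_inv_atTop_zero.comp (Real.tendsto_sqrt_atTop.comp hsq_atTop)).mul_const
      |t|
    simpa [Function.comp_def, Real.sqrt_sq_eq_abs, abs_mul] using hsqrt
  refine tendsto_iff_norm_sub_tendsto_zero.2 (squeeze_zero' (Eventually.of_forall fun _ =>
    norm_nonneg _) (g := fun n => t ^ 2 / c *
      (4 * (1 + C) * |(σ n)⁻¹ * t| + (1 + C) ^ 2 * |(σ n)⁻¹ * t| ^ 2)) ?_ ?_)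
  · filter_upwards [h0, h4, hσ, hσc, hsq_atTop.eventually_gt_atTop 0,
      hs.eventually_gt_atTop 0] with n h0 h4 hσ hσc hpos hne
    have hσ0 : σ n ≠ 0 := fun h => by simp [h] at hpos
    have hbound := norm_charFun_normalized_sum_sub_le (hX n) (hind n) h0 h4 hσ0 hσ t
    obtain ⟨i, hi⟩ := Finset.card_pos.1 hne
    have hC : 0 ≤ C := (integral_nonneg fun ω => by positivity).trans (h4 i hi).2
    have hcard_mul := mul_abs_inv_mul_sq_le hσ0 hc hσc t
    set u := |(σ n)⁻¹ * t|
    calc _ ≤ _ := hbound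
      _ = (s n).card * u ^ 2 * (4 * (1 + C) * u + (1 + C) ^ 2 * u ^ 2) := by ring
      _ ≤ t ^ 2 / c * (4 * (1 + C) * u + (1 + C) ^ 2 * u ^ 2) :=
        mul_le_mul_of_nonneg_right hcard_mul (by positivity)
  · have hlim := ((hu.const_mul (4 * (1 + C))).add ((hu.pow 2).const_mul ((1 + C) ^ 2))).const_mul
      (t ^ 2 / c)
    simpa using hlim

end TriangularArray

section Packing

lemma exists_card_le_of_totallyBounded {E : Type*} [PseudoMetricSpace E] {A : Set E}
    (hA : TotallyBounded A) {ε : ℝ} (hε : 0 < ε) :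
    ∃ N : ℕ, ∀ {ι : Type} {s : Finset ι} {x : ι → E}, (∀ i ∈ s, x i ∈ A) →
      (∀ i ∈ s, ∀ j ∈ s, i ≠ j → ε < dist (x i) (x j)) → s.card ≤ N := by
  obtain ⟨t, ht, hcover⟩ := Metric.totallyBounded_iff.1 hA (ε / 2) (half_pos hε)
  refine ⟨ht.toFinset.card, fun {ι} {s} {x} hx hsep => ?_⟩
  rcases s.eq_empty_or_nonempty with rfl | ⟨i₀, -⟩
  · simp
  have : Nonempty E := ⟨x i₀⟩
  have hcenter : ∀ i ∈ s, ∃ y ∈ t, dist (x i) y < ε / 2 := fun i hi => by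
    simpa using hcover (hx i hi)
  choose! φ hφt hφ using hcenter
  refine Finset.card_le_card_of_injOn φ (fun i hi => by simpa using hφt i hi) ?_
  intro i hi j hj hij
  by_contra hne
  have htriangle := dist_triangle_right (x i) (x j) (φ i)
  have hj_close := hφ j hj
  rw [← hij] at hj_close
  linarith [hsep i hi j hj hne, hφ i hi]

variable {E : Type*} [NormedAddCommGroup E] [NormedSpace ℝ E] {N : Seminorm ℝ E}

lemma exists_mul_norm_le_seminorm [FiniteDimensional ℝ E] (h0 : ∀ x, N x = 0 → x = 0) :
    ∃ c > 0, ∀ x, c * ‖x‖ ≤ N x := by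
  rcases subsingleton_or_nontrivial E with hs | hn
  · exact ⟨1, one_pos, fun x => by rw [Subsingleton.elim x 0]; simp⟩
  have := FiniteDimensional.proper_real E
  obtain ⟨x₀, hx₀, hmin⟩ := (isCompact_sphere (0 : E) 1).exists_isMinOn
    (NormedSpace.sphere_nonempty.2 zero_le_one) N.convexOn.locallyLipschitz.continuous.continuousOn
  have hx₀_ne : x₀ ≠ 0 := fun h => by simp [h] at hx₀
  refine ⟨N x₀, (apply_nonneg N _).lt_of_ne' (mt (h0 x₀) hx₀_ne), fun x => ?_⟩
  rcases eq_or_ne x 0 with rfl | hx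
  · simp
  have hpos : 0 < ‖x‖ := norm_pos_iff.2 hx
  have hnormalized : N x₀ ≤ N (‖x‖⁻¹ • x) := hmin (by simp [norm_smul, hpos.ne'])
  rwa [map_smul_eq_mul, norm_inv, norm_norm, ← div_eq_inv_mul, le_div_iff₀ hpos] at hnormalized

lemma one_lt_seminorm_normalize_sub_of_le {E : Type*} [AddCommGroup E] [Module ℝ E]
    {N : Seminorm ℝ E} {u v : E} (hle : N v ≤ N u) (h : N u < N (u - v)) :
    1 < N ((N u)⁻¹ • u - (N v)⁻¹ • v) := by
  have hv : 0 < N v := by linarith [map_sub_le_add N u v]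
  have hu : 0 < N u := hv.trans_le hle
  let a := (N u)⁻¹ • u
  let b := (N v)⁻¹ • v
  have ha : N a = 1 := by
    rw [map_smul_eq_mul, norm_inv, Real.norm_of_nonneg hu.le, inv_mul_cancel₀ hu.ne']
  have hdecomp : u - v = (N u - N v) • a + N v • (a - b) := by
    rw [smul_sub, smul_inv_smul₀ hv.ne', sub_smul, smul_inv_smul₀ hu.ne']
    abel
  have hupper : N (u - v) ≤ N u - N v + N v * N (a - b) :=
    calc N (u - v) ≤ N ((N u - N v) • a) + N (N v • (a - b)) := by
          rw [hdecomp]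
          exact map_add_le_add N _ _
      _ = N u - N v + N v * N (a - b) := by
          rw [map_smul_eq_mul N _ a, map_smul_eq_mul N _ (a - b), ha, mul_one,
            Real.norm_of_nonneg hv.le, Real.norm_of_nonneg (sub_nonneg.2 hle)]
  exact one_lt_of_lt_mul_right₀ hv.le (by linarith)

lemma one_lt_seminorm_normalize_sub {E : Type*} [AddCommGroup E] [Module ℝ E] {N : Seminorm ℝ E}
    {u v : E} (hu : N u < N (u - v)) (hv : N v < N (u - v)) :
    1 < N ((N u)⁻¹ • u - (N v)⁻¹ • v) := by
  rcases le_total (N v) (N u) with hle | hle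
  · exact one_lt_seminorm_normalize_sub_of_le hle hu
  · rw [map_sub_rev] at hv ⊢
    exact one_lt_seminorm_normalize_sub_of_le hle hv

-- The directions of points that are closer to the origin than to each other are separated, so a
-- packing bound on the unit ball applies.
lemma exists_card_le_of_seminorm_lt_seminorm_sub [FiniteDimensional ℝ E]
    (h0 : ∀ x, N x = 0 → x = 0) :
    ∃ B : ℕ, ∀ {ι : Type} {s : Finset ι} {u : ι → E},
      (∀ i ∈ s, ∀ j ∈ s, i ≠ j → N (u i) < N (u i - u j)) → s.card ≤ B := by
  have := FiniteDimensional.proper_real E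
  obtain ⟨c, hc, hcN⟩ := exists_mul_norm_le_seminorm h0
  obtain ⟨C, hC, hNC⟩ :=
    N.bound_of_continuous_normedSpace N.convexOn.locallyLipschitz.continuous
  obtain ⟨B, hB⟩ := exists_card_le_of_totallyBounded
    (isCompact_closedBall (0 : E) c⁻¹).totallyBounded (inv_pos.2 (add_pos hC one_pos))
  refine ⟨B, fun {ι} {s} {u} hu =>
    hB (x := fun i => (N (u i))⁻¹ • u i) (fun i _ => ?_) fun i hi j hj hij => ?_⟩
  · rw [mem_closedBall_zero_iff, ← div_one c, inv_div, le_div_iff₀' hc]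
    refine (hcN _).trans ?_
    rw [map_smul_eq_mul, norm_inv, Real.norm_of_nonneg (apply_nonneg N _)]
    exact inv_mul_le_one
  · have hsep := one_lt_seminorm_normalize_sub (hu i hi j hj hij)
      ((hu j hj i hi hij.symm).trans_eq (map_sub_rev N _ _))
    rw [dist_eq_norm, inv_lt_iff_one_lt_mul₀ (add_pos hC one_pos)]
    nlinarith [hNC ((N (u i))⁻¹ • u i - (N (u j))⁻¹ • u j),
      norm_nonneg ((N (u i))⁻¹ • u i - (N (u j))⁻¹ • u j)]

end Packing

section Matching

lemma IsMetric.nonneg {E : Type} {ψ : E → E → ℝ} (h : IsMetric ψ) (x y : E) : 0 ≤ ψ x y := by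
  have htriangle := h.triangle x y x
  rw [(h.eq_zero_iff x x).2 rfl, h.symm y x] at htriangle
  linarith

namespace Given

variable {p q n : ℕ} {P : Given p q n} {ψ : Ctrl p → Ctrl p → ℝ} {κ : ℝ} {l : Fin n → Fin n}

lemma card_filter_sub_le_two_mul {r : Fin n → Prop} [DecidablePred r] {N : ℕ}
    (h : ∀ d, {i ∈ P.arm d | r i}.card ≤ N) : {i ∈ P.sub | r i}.card ≤ 2 * N := by
  have hsub : {i ∈ P.sub | r i} ⊆ {i ∈ P.arm true | r i} ∪ {i ∈ P.arm false | r i} := fun i hi => by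
    cases hd : (P.obs i).2 <;> simp_all [mem_arm]
  calc {i ∈ P.sub | r i}.card
      ≤ {i ∈ P.arm true | r i}.card + {i ∈ P.arm false | r i}.card :=
        (Finset.card_le_card hsub).trans (Finset.card_union_le _ _)
    _ ≤ 2 * N := by linarith [h true, h false]

variable (P) in
lemma nu_eq (i j : Fin n) :
    P.nu ψ κ i j = ψ (P.X i) (P.X j) + if (P.obs i).2 = (P.obs j).2 then 0 else κ := by
  cases hi : (P.obs i).2 <;> cases hj : (P.obs j).2 <;> simp [nu, treat, hi, hj]

lemma nu_eq_of_mem_arm {d : Bool} {i j : Fin n} (hi : i ∈ P.arm d) (hj : j ∈ P.arm d) :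
    P.nu ψ κ i j = ψ (P.X i) (P.X j) := by
  rw [nu_eq, if_pos ((mem_arm P).1 hi |>.2.trans ((mem_arm P).1 hj).2.symm), add_zero]

lemma IsMatch.close_of_exists_close (hl : P.IsMatch ψ κ l) (hψ : IsMetric ψ) {d : Bool}
    {i j : Fin n} (hi : i ∈ P.arm d) (hj : j ∈ P.arm d) (hne : j ≠ i) {ε : ℝ}
    (hε : ψ (P.X i) (P.X j) ≤ ε) (hκ : ψ (P.X i) (P.X j) < κ) :
    (P.obs (l i)).2 = (P.obs i).2 ∧ ψ (P.X i) (P.X (l i)) ≤ ε := by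
  have hmin := (hl i (P.arm_subset d hi)).2.2 j (P.arm_subset d hj) hne
  rw [nu_eq_of_mem_arm hi hj, nu_eq] at hmin
  have hnonneg := hψ.nonneg (P.X i) (P.X (l i))
  split_ifs at hmin with hd
  · exact ⟨hd.symm, by linarith⟩
  · linarith

end Given

lemma exists_card_not_close_match_le {p : ℕ} (M : ℝ) {K κ ε : ℝ} (hκ : 0 < κ) (hε : 0 < ε)
    {ψ : Ctrl p → Ctrl p → ℝ} (hψ : IsMetric ψ) (hdom : ∀ x y, ψ x y ≤ K * dist x y) :
    ∃ N : ℕ, ∀ {q n : ℕ} {P : Given p q n} {l : Fin n → Fin n}, P.IsMatch ψ κ l →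
      (∀ d : Bool, ∀ i ∈ P.arm d, ∀ i' ∈ P.arm d, dist (P.X i) (P.X i') ≤ M) →
      {i ∈ P.sub | ¬((P.obs (l i)).2 = (P.obs i).2 ∧ ψ (P.X i) (P.X (l i)) ≤ ε)}.card ≤ N := by
  have hK : 0 < |K| + 1 := by positivity
  have hη : 0 < min ε (κ / 2) / (|K| + 1) := by positivity
  obtain ⟨N, hN⟩ := exists_card_le_of_totallyBounded
    (isCompact_closedBall (0 : Ctrl p) M).totallyBounded hη
  refine ⟨2 * N, fun {q n P l} hl hdiam => Given.card_filter_sub_le_two_mul fun d => ?_⟩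
  set bad := {i ∈ P.arm d | ¬((P.obs (l i)).2 = (P.obs i).2 ∧ ψ (P.X i) (P.X (l i)) ≤ ε)}
  rcases bad.eq_empty_or_nonempty with hempty | ⟨i₀, hi₀⟩
  · simp [hempty]
  refine hN (x := fun i => P.X i - P.X i₀) (fun i hi => ?_) fun i hi j hj hij => ?_
  · rw [mem_closedBall_zero_iff, ← dist_eq_norm]
    exact hdiam d i (Finset.mem_filter.1 hi).1 i₀ (Finset.mem_filter.1 hi₀).1
  · by_contra! hclose
    rw [dist_sub_right, le_div_iff₀' hK] at hclose
    have hψ_le : ψ (P.X i) (P.X j) ≤ min ε (κ / 2) :=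
      (hdom _ _).trans <| (mul_le_mul_of_nonneg_right
        ((le_abs_self K).trans (lt_add_one _).le) dist_nonneg).trans hclose
    exact (Finset.mem_filter.1 hi).2 <| hl.close_of_exists_close hψ (Finset.mem_filter.1 hi).1
      (Finset.mem_filter.1 hj).1 hij.symm (hψ_le.trans (min_le_left _ _))
      ((hψ_le.trans (min_le_right _ _)).trans_lt (half_lt_self hκ))

lemma exists_card_matched_le {p : ℕ} {κ : ℝ} (hκ : 0 ≤ κ) {ψ : Ctrl p → Ctrl p → ℝ}
    (hψ : IsMetric ψ) (N : Seminorm ℝ (Ctrl p)) (hN : ∀ x y, ψ x y = N (x - y)) :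
    ∃ B : ℕ, ∀ {q n : ℕ} {P : Given p q n} {l : Fin n → Fin n}, P.IsMatch ψ κ l →
      P.NoTies ψ κ l → ∀ j : Fin n, {i ∈ P.sub | l i = j}.card ≤ B := by
  obtain ⟨B, hB⟩ := exists_card_le_of_seminorm_lt_seminorm_sub (N := N) fun x hx =>
    (hψ.eq_zero_iff x 0).1 (by rw [hN, sub_zero, hx])
  refine ⟨2 * B, fun {q n P l} hl hties j => Given.card_filter_sub_le_two_mul fun d =>
    hB (u := fun i => P.X i - P.X j) fun a ha b hb hab => ?_⟩
  obtain ⟨ha_arm, rfl⟩ := Finset.mem_filter.1 ha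
  obtain ⟨hb_arm, hlb⟩ := Finset.mem_filter.1 hb
  have hb_ne : b ≠ l a := hlb ▸ (hl b (P.arm_subset d hb_arm)).2.1.symm
  have hlt := hties a (P.arm_subset d ha_arm) b (P.arm_subset d hb_arm) hab.symm hb_ne
  rw [Given.nu_eq_of_mem_arm ha_arm hb_arm, Given.nu_eq, hN, hN] at hlt
  rw [sub_sub_sub_cancel_right]
  split_ifs at hlt <;> linarith

end Matching

section ConvergenceInProbability

/-- Convergence to `0` in probability of functions on spaces that vary with the index;
`TendstoInMeasure` needs a common space. No measurability is required. -/
def TendstoZeroInProb {Ω : ℕ → Type*} [∀ n, MeasurableSpace (Ω n)] (μ : ∀ n, Measure (Ω n))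
    (f : ∀ n, Ω n → ℝ) : Prop :=
  ∀ ε > 0, Tendsto (fun n => (μ n).real {ω | ε ≤ |f n ω|}) atTop (𝓝 0)

variable {Ω : ℕ → Type*} [∀ n, MeasurableSpace (Ω n)] {μ : ∀ n, Measure (Ω n)}
  [∀ n, IsFiniteMeasure (μ n)] {f g : ∀ n, Ω n → ℝ}

lemma TendstoZeroInProb.of_mul_abs_le {c : ℝ} (hf : TendstoZeroInProb μ f) (hc : 0 < c)
    (h : ∀ᶠ n in atTop, ∀ ω, c * |g n ω| ≤ |f n ω|) : TendstoZeroInProb μ g := by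
  intro ε hε
  refine squeeze_zero' (.of_forall fun n => measureReal_nonneg) ?_ (hf (c * ε) (mul_pos hc hε))
  filter_upwards [h] with n h
  exact measureReal_mono fun ω hω => (mul_le_mul_of_nonneg_left hω hc.le).trans (h ω)

lemma TendstoZeroInProb.add (hf : TendstoZeroInProb μ f) (hg : TendstoZeroInProb μ g) :
    TendstoZeroInProb μ fun n ω => f n ω + g n ω := by
  intro ε hε
  have hsum := (hf (ε / 2) (half_pos hε)).add (hg (ε / 2) (half_pos hε))
  rw [add_zero] at hsum
  refine squeeze_zero (fun n => measureReal_nonneg) (fun n => ?_) hsum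
  refine (measureReal_mono fun ω (hω : ε ≤ |f n ω + g n ω|) => ?_).trans
    (measureReal_union_le _ _)
  by_contra! hsmall
  simp only [Set.mem_union, Set.mem_ofPred_eq, not_or, not_le] at hsmall
  linarith [abs_add_le (f n ω) (g n ω)]

lemma tendstoZeroInProb_sqrt_of_tendsto_integral (h0 : ∀ n ω, 0 ≤ f n ω)
    (hf : ∀ᶠ n in atTop, Integrable (f n) (μ n))
    (hlim : Tendsto (fun n => ∫ ω, f n ω ∂(μ n)) atTop (𝓝 0)) :
    TendstoZeroInProb μ fun n ω => √(f n ω) := by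
  intro ε hε
  have hbound := hlim.const_mul (ε ^ 2)⁻¹
  rw [mul_zero] at hbound
  refine squeeze_zero' (.of_forall fun n => measureReal_nonneg) ?_ hbound
  filter_upwards [hf] with n hf
  refine (measureReal_mono fun ω hω => ?_).trans ((le_inv_mul_iff₀ (pow_pos hε 2)).2
    (mul_meas_ge_le_integral_of_nonneg (ae_of_all _ (h0 n)) hf (ε ^ 2)))
  rwa [Set.mem_ofPred_eq, abs_of_nonneg (Real.sqrt_nonneg _), Real.le_sqrt' hε] at hω

lemma tendstoZeroInProb_sub_of_tendsto_variance {T : ∀ n, Ω n → ℝ} {a : ℕ → ℝ}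
    (hT : ∀ᶠ n in atTop, MemLp (T n) 2 (μ n))
    (hvar : Tendsto (fun n => Var[T n; μ n]) atTop (𝓝 0))
    (hmean : Tendsto (fun n => ∫ ω, T n ω ∂(μ n) - a n) atTop (𝓝 0)) :
    TendstoZeroInProb μ fun n ω => T n ω - a n := by
  intro ε hε
  have hlim : Tendsto (fun n => Var[T n; μ n] / (ε / 2) ^ 2) atTop (𝓝 0) := by
    simpa using hvar.div_const ((ε / 2) ^ 2)
  refine squeeze_zero' (Eventually.of_forall fun n => measureReal_nonneg) ?_ hlim
  filter_upwards [hT,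
    hmean.abs.eventually_lt_const (u := ε / 2) (by simpa using half_pos hε)] with n hT hmean
  have hsub : {ω | ε ≤ |T n ω - a n|} ⊆ {ω | ε / 2 ≤ |T n ω - ∫ ω, T n ω ∂(μ n)|} := fun ω hω => by
    have htriangle := abs_sub_le (T n ω) (∫ ω, T n ω ∂(μ n)) (a n)
    simp only [Set.mem_ofPred_eq] at hω ⊢
    linarith
  calc (μ n).real {ω | ε ≤ |T n ω - a n|}
      ≤ (μ n).real {ω | ε / 2 ≤ |T n ω - ∫ ω, T n ω ∂(μ n)|} := measureReal_mono hsub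
    _ ≤ Var[T n; μ n] / (ε / 2) ^ 2 := ENNReal.toReal_le_of_le_ofReal
        (div_nonneg (variance_nonneg _ _) (sq_nonneg _))
        (meas_ge_le_variance_div_sq hT (half_pos hε))

end ConvergenceInProbability

section FourthMoments

variable {Ω : Type*} {mΩ : MeasurableSpace Ω} {μ : Measure Ω} {X Y : Ω → ℝ}

lemma sub_pow_four_le (a b : ℝ) : (a - b) ^ 4 ≤ 8 * (a ^ 4 + b ^ 4) := by
  have hsq : (a - b) ^ 2 ≤ 2 * (a ^ 2 + b ^ 2) := by linarith [sq_nonneg (a + b)]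
  have hpow : ((a - b) ^ 2) ^ 2 ≤ (2 * (a ^ 2 + b ^ 2)) ^ 2 :=
    pow_le_pow_left₀ (sq_nonneg _) hsq 2
  linarith [sq_nonneg (a ^ 2 - b ^ 2)]

lemma integrable_sub_pow_four (hX : AEStronglyMeasurable X μ) (hY : AEStronglyMeasurable Y μ)
    (hX4 : Integrable (fun ω => X ω ^ 4) μ) (hY4 : Integrable (fun ω => Y ω ^ 4) μ) :
    Integrable (fun ω => (X ω - Y ω) ^ 4) μ := by
  refine ((hX4.add hY4).const_mul 8).mono' ((hX.sub hY).pow 4) (ae_of_all _ fun ω => ?_)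
  rw [Real.norm_of_nonneg (by positivity)]
  exact sub_pow_four_le _ _

lemma integral_sub_pow_four_le (hX : AEStronglyMeasurable X μ) (hY : AEStronglyMeasurable Y μ)
    (hX4 : Integrable (fun ω => X ω ^ 4) μ) (hY4 : Integrable (fun ω => Y ω ^ 4) μ) :
    ∫ ω, (X ω - Y ω) ^ 4 ∂μ ≤ 8 * (∫ ω, X ω ^ 4 ∂μ + ∫ ω, Y ω ^ 4 ∂μ) := by
  rw [← integral_add hX4 hY4, ← integral_const_mul]
  exact integral_mono (integrable_sub_pow_four hX hY hX4 hY4) ((hX4.add hY4).const_mul 8)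
    fun ω => sub_pow_four_le _ _

lemma memLp_sq_of_integrable_pow_four (hX : AEStronglyMeasurable X μ)
    (hX4 : Integrable (fun ω => X ω ^ 4) μ) : MemLp (fun ω => X ω ^ 2) 2 μ :=
  (memLp_two_iff_integrable_sq (hX.pow 2)).2 <| by
    simpa only [Pi.pow_apply, ← pow_mul, Nat.reduceMul] using hX4

lemma memLp_two_of_integrable_pow_four [IsProbabilityMeasure μ] (hX : AEStronglyMeasurable X μ)
    (hX4 : Integrable (fun ω => X ω ^ 4) μ) : MemLp X 2 μ :=
  (memLp_two_iff_integrable_sq hX).2 (integrable_sq_of_integrable_pow_four hX hX4)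

end FourthMoments

section LocalDependence

variable {Ω : Type*} {mΩ : MeasurableSpace Ω} {μ : Measure Ω} [IsProbabilityMeasure μ]
  {ι : Type*} {s : Finset ι}

lemma covariance_le_half_add {X Y : Ω → ℝ} (hX : MemLp X 2 μ) (hY : MemLp Y 2 μ) :
    cov[X, Y; μ] ≤ (Var[X; μ] + Var[Y; μ]) / 2 := by
  have hvar := variance_nonneg (X - Y) μ
  rw [variance_sub hX hY] at hvar
  linarith

lemma variance_sum_le_of_indepFun {W : ι → Ω → ℝ} {R : ι → ι → Prop} [∀ i, DecidablePred (R i)]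
    {v : ℝ} {D : ℕ} (hW : ∀ i ∈ s, MemLp (W i) 2 μ) (hv : ∀ i ∈ s, Var[W i; μ] ≤ v)
    (hD : ∀ i ∈ s, {j ∈ s | R i j}.card ≤ D)
    (hind : ∀ i ∈ s, ∀ j ∈ s, ¬R i j → IndepFun (W i) (W j) μ) :
    Var[fun ω => ∑ i ∈ s, W i ω; μ] ≤ s.card * (D * v) := by
  rw [variance_fun_sum' hW, ← nsmul_eq_mul]
  refine Finset.sum_le_card_nsmul _ _ _ fun i hi => ?_
  have hv0 : 0 ≤ v := (variance_nonneg _ _).trans (hv i hi)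
  calc ∑ j ∈ s, cov[W i, W j; μ]
      ≤ ∑ j ∈ s, if R i j then v else 0 := Finset.sum_le_sum fun j hj => by
        split_ifs with hR
        · linarith [covariance_le_half_add (hW i hi) (hW j hj), hv i hi, hv j hj]
        · exact ((hind i hi j hj hR).covariance_eq_zero (hW i hi) (hW j hj)).le
    _ = {j ∈ s | R i j}.card * v := by
        rw [← Finset.sum_filter, Finset.sum_const, nsmul_eq_mul]
    _ ≤ D * v := mul_le_mul_of_nonneg_right (mod_cast hD i hi) hv0

lemma card_filter_overlap_le [DecidableEq ι] {l : ι → ι} {B : ℕ}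
    (hB : ∀ j, {i ∈ s | l i = j}.card ≤ B) (i : ι) :
    {j ∈ s | j = i ∨ j = l i ∨ l j = i ∨ l j = l i}.card ≤ 2 + 2 * B := by
  have hsub : {j ∈ s | j = i ∨ j = l i ∨ l j = i ∨ l j = l i} ⊆
      {i, l i} ∪ ({j ∈ s | l j = i} ∪ {j ∈ s | l j = l i}) := fun j hj => by
    simp only [Finset.mem_filter, Finset.mem_union, Finset.mem_insert,
      Finset.mem_singleton] at hj ⊢
    tauto
  calc _ ≤ ({i, l i} : Finset ι).card +
        ({j ∈ s | l j = i}.card + {j ∈ s | l j = l i}.card) :=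
        (Finset.card_le_card hsub).trans <| (Finset.card_union_le _ _).trans <| by
          gcongr
          exact Finset.card_union_le _ _
    _ ≤ 2 + 2 * B := by linarith [Finset.card_le_two (a := i) (b := l i), hB i, hB (l i)]

lemma variance_sum_sq_sub_le [DecidableEq ι] {e : ι → Ω → ℝ} {l : ι → ι} {C : ℝ} {B : ℕ}
    (he : ∀ i, Measurable (e i)) (hind : iIndepFun e μ) (hl : ∀ i ∈ s, l i ∈ s)
    (h4 : ∀ i ∈ s, Integrable (fun ω => e i ω ^ 4) μ ∧ ∫ ω, e i ω ^ 4 ∂μ ≤ C)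
    (hB : ∀ j, {i ∈ s | l i = j}.card ≤ B) :
    Var[fun ω => ∑ i ∈ s, (e i ω - e (l i) ω) ^ 2; μ] ≤ s.card * ((2 + 2 * B) * (16 * C)) := by
  have hmeas := fun i => (he i).aestronglyMeasurable (μ := μ)
  have hsub_meas := fun i => (hmeas i).sub (hmeas (l i))
  have hLp : ∀ i ∈ s, MemLp (fun ω => (e i ω - e (l i) ω) ^ 2) 2 μ := fun i hi =>
    memLp_sq_of_integrable_pow_four (hsub_meas i) <|
      integrable_sub_pow_four (hmeas i) (hmeas (l i)) (h4 i hi).1 (h4 _ (hl i hi)).1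
  have hvar : ∀ i ∈ s, Var[fun ω => (e i ω - e (l i) ω) ^ 2; μ] ≤ 16 * C := fun i hi =>
    calc Var[fun ω => (e i ω - e (l i) ω) ^ 2; μ]
        ≤ ∫ ω, (e i ω - e (l i) ω) ^ 4 ∂μ := by
          refine (variance_le_expectation_sq (hLp i hi).1).trans_eq ?_
          simp only [Pi.pow_apply, ← pow_mul, Nat.reduceMul]
      _ ≤ 16 * C := by
          linarith [integral_sub_pow_four_le (hmeas i) (hmeas (l i)) (h4 i hi).1 (h4 _ (hl i hi)).1,
            (h4 i hi).2, (h4 _ (hl i hi)).2]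
  refine mod_cast variance_sum_le_of_indepFun hLp hvar
    (fun i _ => card_filter_overlap_le hB i) fun i _ j _ hR => ?_
  obtain ⟨hji, hjl, hli, hll⟩ : j ≠ i ∧ j ≠ l i ∧ l j ≠ i ∧ l j ≠ l i := by tauto
  exact (hind.indepFun_prodMk_prodMk he i (l i) j (l j) hji.symm hli.symm hjl.symm hll.symm).comp
    (φ := fun x : ℝ × ℝ => (x.1 - x.2) ^ 2) (ψ := fun x : ℝ × ℝ => (x.1 - x.2) ^ 2)
    (by fun_prop) (by fun_prop)

end LocalDependence

section MatchedDifferences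

/-- The first two moments of `X` and `Y` differ by at most `η`: this is what makes the squared
difference of two independent variables a good proxy for twice their variance. -/
def MomentClose {Ω : Type*} {_ : MeasurableSpace Ω} (μ : Measure Ω) (X Y : Ω → ℝ) (η : ℝ) :
    Prop :=
  |∫ ω, X ω ∂μ - ∫ ω, Y ω ∂μ| ≤ η ∧ |∫ ω, X ω ^ 2 ∂μ - ∫ ω, Y ω ^ 2 ∂μ| ≤ η

lemma MomentClose.mono {Ω : Type*} {_ : MeasurableSpace Ω} {μ : Measure Ω} {X Y : Ω → ℝ}
    {η η' : ℝ} (h : MomentClose μ X Y η) (hη : η ≤ η') : MomentClose μ X Y η' :=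
  ⟨h.1.trans hη, h.2.trans hη⟩

variable {Ω : Type*} {mΩ : MeasurableSpace Ω} {μ : Measure Ω} [IsProbabilityMeasure μ]
  {X Y : Ω → ℝ} {C η : ℝ}

lemma integral_sub_sq_sub_two_mul_variance (hX : MemLp X 2 μ) (hY : MemLp Y 2 μ)
    (hXY : IndepFun X Y μ) :
    ∫ ω, (X ω - Y ω) ^ 2 ∂μ - 2 * Var[X; μ] =
      (∫ ω, Y ω ^ 2 ∂μ - ∫ ω, X ω ^ 2 ∂μ) +
        2 * (∫ ω, X ω ∂μ) * (∫ ω, X ω ∂μ - ∫ ω, Y ω ∂μ) := by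
  have hvar_sub := variance_sub hX hY
  rw [hXY.covariance_eq_zero hX hY, variance_eq_sub (hX.sub hY), variance_eq_sub hX,
    variance_eq_sub hY] at hvar_sub
  simp only [Pi.pow_apply, Pi.sub_apply] at hvar_sub
  rw [integral_sub (hX.integrable one_le_two) (hY.integrable one_le_two)] at hvar_sub
  rw [variance_eq_sub hX]
  simp only [Pi.pow_apply]
  linarith

lemma abs_integral_sub_sq_sub_le_of_momentClose (hX : AEStronglyMeasurable X μ)
    (hY : AEStronglyMeasurable Y μ) (hXY : IndepFun X Y μ)
    (hX4 : Integrable (fun ω => X ω ^ 4) μ) (hY4 : Integrable (fun ω => Y ω ^ 4) μ)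
    (hXC : ∫ ω, X ω ^ 4 ∂μ ≤ C) (hη : MomentClose μ X Y η) :
    |∫ ω, (X ω - Y ω) ^ 2 ∂μ - 2 * Var[X; μ]| ≤ η * (3 + 2 * C) := by
  have hmean : |∫ ω, X ω ∂μ| ≤ 1 + C := abs_integral_le_integral_abs.trans <| by
    simpa using integral_abs_pow_le_of_integral_pow_four_le hX hX4 hXC (k := 1) (by norm_num)
  have hprod : |∫ ω, X ω ∂μ| * |∫ ω, X ω ∂μ - ∫ ω, Y ω ∂μ| ≤ (1 + C) * η :=
    mul_le_mul hmean hη.1 (abs_nonneg _) ((abs_nonneg _).trans hmean)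
  rw [integral_sub_sq_sub_two_mul_variance (memLp_two_of_integrable_pow_four hX hX4)
    (memLp_two_of_integrable_pow_four hY hY4) hXY]
  calc _ ≤ |∫ ω, Y ω ^ 2 ∂μ - ∫ ω, X ω ^ 2 ∂μ| +
        2 * (|∫ ω, X ω ∂μ| * |∫ ω, X ω ∂μ - ∫ ω, Y ω ∂μ|) := by
        refine (abs_add_le _ _).trans_eq ?_
        rw [abs_mul, abs_mul, abs_two, mul_assoc]
    _ ≤ η * (3 + 2 * C) := by
        rw [abs_sub_comm]
        linarith [hη.2]

lemma abs_integral_sub_sq_sub_le (hX : AEStronglyMeasurable X μ) (hY : AEStronglyMeasurable Y μ)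
    (hX4 : Integrable (fun ω => X ω ^ 4) μ) (hY4 : Integrable (fun ω => Y ω ^ 4) μ)
    (hXC : ∫ ω, X ω ^ 4 ∂μ ≤ C) (hYC : ∫ ω, Y ω ^ 4 ∂μ ≤ C) :
    |∫ ω, (X ω - Y ω) ^ 2 ∂μ - 2 * Var[X; μ]| ≤ 4 * (1 + C) := by
  have hX2 := integrable_sq_of_integrable_pow_four hX hX4
  have hY2 := integrable_sq_of_integrable_pow_four hY hY4
  have hXC2 := integral_sq_le_of_integral_pow_four_le hX hX4 hXC
  have hYC2 := integral_sq_le_of_integral_pow_four_le hY hY4 hYC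
  have hX2_nonneg : 0 ≤ ∫ ω, X ω ^ 2 ∂μ := integral_nonneg fun ω => sq_nonneg _
  have hvar : Var[X; μ] ≤ ∫ ω, X ω ^ 2 ∂μ := variance_le_expectation_sq hX
  have hdiff : ∫ ω, (X ω - Y ω) ^ 2 ∂μ ≤ 2 * (∫ ω, X ω ^ 2 ∂μ + ∫ ω, Y ω ^ 2 ∂μ) := by
    rw [← integral_add hX2 hY2, ← integral_const_mul]
    refine integral_mono_of_nonneg (ae_of_all _ fun ω => sq_nonneg _)
      ((hX2.add hY2).const_mul 2) (ae_of_all _ fun ω => ?_)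
    change (X ω - Y ω) ^ 2 ≤ 2 * (X ω ^ 2 + Y ω ^ 2)
    linarith [sq_nonneg (X ω + Y ω)]
  have hdiff_nonneg : 0 ≤ ∫ ω, (X ω - Y ω) ^ 2 ∂μ := integral_nonneg fun ω => sq_nonneg _
  rw [abs_le]
  constructor <;> linarith [variance_nonneg X μ, hX2_nonneg]

open scoped Classical in
lemma abs_integral_sum_sq_sub_sub_le {ι : Type*} {s : Finset ι} {e : ι → Ω → ℝ} {l : ι → ι}
    (he : ∀ i, Measurable (e i)) (hind : iIndepFun e μ) (hl : ∀ i ∈ s, l i ∈ s ∧ l i ≠ i)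
    (h4 : ∀ i ∈ s, Integrable (fun ω => e i ω ^ 4) μ ∧ ∫ ω, e i ω ^ 4 ∂μ ≤ C)
    (hC : 0 ≤ C) (hη : 0 ≤ η) :
    |∫ ω, ∑ i ∈ s, (e i ω - e (l i) ω) ^ 2 ∂μ - 2 * ∑ i ∈ s, Var[e i; μ]| ≤
      s.card * (η * (3 + 2 * C)) +
        {i ∈ s | ¬MomentClose μ (e i) (e (l i)) η}.card * (4 * (1 + C)) := by
  have hmeas := fun i => (he i).aestronglyMeasurable (μ := μ)
  have hint : ∀ i ∈ s, Integrable (fun ω => (e i ω - e (l i) ω) ^ 2) μ := fun i hi =>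
    integrable_sq_of_integrable_pow_four ((hmeas i).sub (hmeas (l i))) <|
      integrable_sub_pow_four (hmeas i) (hmeas (l i)) (h4 i hi).1 (h4 _ (hl i hi).1).1
  rw [integral_finsetSum _ hint, Finset.mul_sum, ← Finset.sum_sub_distrib]
  calc _ ≤ ∑ i ∈ s, |∫ ω, (e i ω - e (l i) ω) ^ 2 ∂μ - 2 * Var[e i; μ]| :=
        Finset.abs_sum_le_sum_abs _ _
    _ ≤ ∑ i ∈ s, (η * (3 + 2 * C) +
        if ¬MomentClose μ (e i) (e (l i)) η then 4 * (1 + C) else 0) :=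
        Finset.sum_le_sum fun i hi => ?_
    _ = _ := by
        rw [Finset.sum_add_distrib, Finset.sum_const, ← Finset.sum_filter, Finset.sum_const,
          nsmul_eq_mul, nsmul_eq_mul]
  obtain ⟨hX4, hXC⟩ := h4 i hi
  obtain ⟨hY4, hYC⟩ := h4 _ (hl i hi).1
  split_ifs with hclose
  · rw [add_zero]
    exact abs_integral_sub_sq_sub_le_of_momentClose (hmeas i) (hmeas (l i))
      (hind.indepFun (hl i hi).2.symm) hX4 hY4 hXC hclose
  · linarith [abs_integral_sub_sq_sub_le (hmeas i) (hmeas (l i)) hX4 hY4 hXC hYC,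
      mul_nonneg hη (by linarith : 0 ≤ 3 + 2 * C)]

end MatchedDifferences

section Consistency

variable {Ω ι : ℕ → Type*} [∀ n, MeasurableSpace (Ω n)] {μ : ∀ n, Measure (Ω n)}
  [∀ n, IsProbabilityMeasure (μ n)] {s : ∀ n, Finset (ι n)} {e : ∀ n, ι n → Ω n → ℝ}
  {l : ∀ n, ι n → ι n} {C : ℝ}

open scoped Classical in
lemma tendsto_integral_matched_difference_sub (he : ∀ n i, Measurable (e n i))
    (hind : ∀ n, iIndepFun (e n) (μ n)) (hs : Tendsto (fun n => (s n).card) atTop atTop)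
    (hl : ∀ᶠ n in atTop, ∀ i ∈ s n, l n i ∈ s n ∧ l n i ≠ i) (hC : 0 ≤ C)
    (h4 : ∀ᶠ n in atTop, ∀ i ∈ s n, Integrable (fun ω => e n i ω ^ 4) (μ n) ∧
      ∫ ω, e n i ω ^ 4 ∂(μ n) ≤ C)
    (hbad : ∀ η > 0, ∃ N : ℕ, ∀ᶠ n in atTop,
      {i ∈ s n | ¬MomentClose (μ n) (e n i) (e n (l n i)) η}.card ≤ N) :
    Tendsto (fun n =>
      ∫ ω, (2 * (s n).card : ℝ)⁻¹ * ∑ i ∈ s n, (e n i ω - e n (l n i) ω) ^ 2 ∂(μ n) -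
        ((s n).card : ℝ)⁻¹ * ∑ i ∈ s n, Var[e n i; μ n]) atTop (𝓝 0) := by
  refine Metric.tendsto_nhds.2 fun ε hε => ?_
  have hcard : Tendsto (fun n => ((s n).card : ℝ)) atTop atTop :=
    tendsto_natCast_atTop_atTop.comp hs
  have hD : 0 < 3 + 2 * C := by positivity
  obtain ⟨N, hN⟩ := hbad (ε / (3 + 2 * C)) (by positivity)
  filter_upwards [hl, h4, hN, hcard.eventually_gt_atTop 0,
    hcard.eventually_gt_atTop (N * (4 * (1 + C)) / ε)] with n hl h4 hN hpos hlarge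
  have hbound := abs_integral_sum_sq_sub_sub_le (he n) (hind n) hl h4 hC (div_pos hε hD).le
  have hbad_le := mul_le_mul_of_nonneg_right (Nat.cast_le (α := ℝ).2 hN)
    (by positivity : 0 ≤ 4 * (1 + C))
  rw [div_mul_cancel₀ _ hD.ne'] at hbound
  rw [div_lt_iff₀ hε] at hlarge
  have hscale : ∀ x y c : ℝ, (2 * c)⁻¹ * x - c⁻¹ * y = (2 * c)⁻¹ * (x - 2 * y) :=
    fun x y c => by rw [mul_inv]; ring
  rw [dist_zero_right, Real.norm_eq_abs, integral_const_mul, hscale, abs_mul,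
    abs_of_pos (by positivity), inv_mul_lt_iff₀ (by positivity)]
  linarith

lemma tendsto_variance_matched_difference [∀ n, DecidableEq (ι n)]
    (he : ∀ n i, Measurable (e n i)) (hind : ∀ n, iIndepFun (e n) (μ n))
    (hs : Tendsto (fun n => (s n).card) atTop atTop)
    (hl : ∀ᶠ n in atTop, ∀ i ∈ s n, l n i ∈ s n)
    (h4 : ∀ᶠ n in atTop, ∀ i ∈ s n, Integrable (fun ω => e n i ω ^ 4) (μ n) ∧
      ∫ ω, e n i ω ^ 4 ∂(μ n) ≤ C)
    {B : ℕ} (hB : ∀ᶠ n in atTop, ∀ j, {i ∈ s n | l n i = j}.card ≤ B) :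
    Tendsto (fun n => Var[fun ω => (2 * (s n).card : ℝ)⁻¹ *
      ∑ i ∈ s n, (e n i ω - e n (l n i) ω) ^ 2; μ n]) atTop (𝓝 0) := by
  have hlim : Tendsto (fun n => ((2 + 2 * B) * (16 * C)) / 4 * ((s n).card : ℝ)⁻¹) atTop (𝓝 0) := by
    simpa using (tendsto_inv_atTop_zero.comp (tendsto_natCast_atTop_atTop.comp hs)).const_mul
      (((2 + 2 * (B : ℝ)) * (16 * C)) / 4)
  refine squeeze_zero' (Eventually.of_forall fun n => variance_nonneg _ _) ?_ hlim
  filter_upwards [hl, h4, hB, hs.eventually_gt_atTop 0] with n hl h4 hB hpos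
  have hne : ((s n).card : ℝ) ≠ 0 := mod_cast hpos.ne'
  rw [variance_const_mul, inv_pow, inv_mul_le_iff₀ (by positivity)]
  refine (variance_sum_sq_sub_le (he n) (hind n) hl h4 hB).trans_eq ?_
  field

open scoped Classical in
lemma tendstoZeroInProb_matched_difference [∀ n, DecidableEq (ι n)]
    (he : ∀ n i, Measurable (e n i)) (hind : ∀ n, iIndepFun (e n) (μ n))
    (hs : Tendsto (fun n => (s n).card) atTop atTop)
    (hl : ∀ᶠ n in atTop, ∀ i ∈ s n, l n i ∈ s n ∧ l n i ≠ i) (hC : 0 ≤ C)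
    (h4 : ∀ᶠ n in atTop, ∀ i ∈ s n, Integrable (fun ω => e n i ω ^ 4) (μ n) ∧
      ∫ ω, e n i ω ^ 4 ∂(μ n) ≤ C)
    {B : ℕ} (hB : ∀ᶠ n in atTop, ∀ j, {i ∈ s n | l n i = j}.card ≤ B)
    (hbad : ∀ η > 0, ∃ N : ℕ, ∀ᶠ n in atTop,
      {i ∈ s n | ¬MomentClose (μ n) (e n i) (e n (l n i)) η}.card ≤ N) :
    TendstoZeroInProb μ fun n ω =>
      (2 * (s n).card : ℝ)⁻¹ * ∑ i ∈ s n, (e n i ω - e n (l n i) ω) ^ 2 -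
        ((s n).card : ℝ)⁻¹ * ∑ i ∈ s n, Var[e n i; μ n] := by
  have hvar := tendsto_variance_matched_difference he hind hs
    (hl.mono fun n h i hi => (h i hi).1) h4 hB
  have hmean := tendsto_integral_matched_difference_sub he hind hs hl hC h4 hbad
  have hmemLp : ∀ᶠ n in atTop, MemLp (fun ω => (2 * (s n).card : ℝ)⁻¹ *
      ∑ i ∈ s n, (e n i ω - e n (l n i) ω) ^ 2) 2 (μ n) := by
    filter_upwards [hl, h4] with n hl h4
    have hmeas := fun i => (he n i).aestronglyMeasurable (μ := μ n)
    have hterm : ∀ i ∈ s n, MemLp (fun ω => (e n i ω - e n (l n i) ω) ^ 2) 2 (μ n) := fun i hi =>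
      memLp_sq_of_integrable_pow_four ((hmeas i).sub (hmeas (l n i))) <|
        integrable_sub_pow_four (hmeas i) (hmeas (l n i)) (h4 i hi).1 (h4 _ (hl i hi).1).1
    exact (memLp_finsetSum _ hterm).const_mul _
  exact tendstoZeroInProb_sub_of_tendsto_variance hmemLp hvar hmean

end Consistency

section SquareRoots

lemma abs_sqrt_sum_sub_sq_sub_le {ι : Type*} (s : Finset ι) (x b : ι → ℝ) :
    |√(∑ i ∈ s, (x i - b i) ^ 2) - √(∑ i ∈ s, x i ^ 2)| ≤ √(∑ i ∈ s, b i ^ 2) := by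
  let toEuclidean (y : ι → ℝ) : EuclideanSpace ℝ s := WithLp.toLp 2 fun i => y i
  have hnorm (y : ι → ℝ) : ‖toEuclidean y‖ = √(∑ i ∈ s, y i ^ 2) := by
    simp [toEuclidean, EuclideanSpace.norm_eq, Finset.sum_attach s fun i => y i ^ 2]
  have hsub : toEuclidean x - toEuclidean b = toEuclidean fun i => x i - b i := rfl
  rw [← hnorm, ← hnorm, ← hnorm, ← hsub]
  simpa using abs_norm_sub_norm_le (toEuclidean x - toEuclidean b) (toEuclidean x)

lemma abs_sqrt_sub_le {x y c : ℝ} (hx : 0 ≤ x) (hc : 0 < c) (hy : c ≤ y) :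
    |√x - √y| ≤ |x - y| / √c := by
  have hfactor : |x - y| = |√x - √y| * (√x + √y) := by
    rw [← abs_of_nonneg (by positivity : 0 ≤ √x + √y), ← abs_mul, mul_comm, ← sq_sub_sq,
      Real.sq_sqrt hx, Real.sq_sqrt (hc.le.trans hy)]
  rw [le_div_iff₀ (Real.sqrt_pos.2 hc), hfactor]
  gcongr
  linarith [Real.sqrt_nonneg x, Real.sqrt_le_sqrt hy]

end SquareRoots

lemma abs_sum_mul_sub_sum_mul_le {ι : Type*} [Fintype ι] {c a b : ι → ℝ}
    {K L : ℝ} (hc : ∀ i, |c i| ≤ K) (hab : ∀ i, |a i - b i| ≤ L) :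
    |∑ i, c i * a i - ∑ i, c i * b i| ≤ Fintype.card ι * (K * L) := by
  have hterm : ∀ i ∈ Finset.univ, |c i * a i - c i * b i| ≤ K * L := fun i _ => by
    rw [← mul_sub, abs_mul]
    exact mul_le_mul (hc i) (hab i) (abs_nonneg _) ((abs_nonneg _).trans (hc i))
  rw [← Finset.sum_sub_distrib, ← nsmul_eq_mul]
  exact (Finset.abs_sum_le_sum_abs _ _).trans (Finset.sum_le_card_nsmul _ _ _ hterm)

namespace Given

section Influence

variable {p q n : ℕ} (P : Given p q n)

instance isProbabilityMeasure_law (o : Obs p) : IsProbabilityMeasure (P.law o) :=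
  have := P.markov
  inferInstance

instance isProbabilityMeasure_condLaw : IsProbabilityMeasure P.condLaw := by
  unfold condLaw
  infer_instance

/-- The row of `(Γ*)⁻¹` that belongs to the coefficient of `D`. -/
noncomputable def slope : Fin (q + 2) → ℝ := P.Gam⁻¹ *ᵥ Pi.single 1 1

/-- The weight of unit `i` in the least squares estimator of the coefficient of `D`, up to the
factor `1 / |S*|`. -/
noncomputable def weight (i : Fin n) : ℝ := P.reg i ⬝ᵥ P.slope

/-- The error `y - Z'θ*` of the outcome `y` of unit `i` with respect to the regression estimand. -/
noncomputable def err (i : Fin n) (y : ℝ) : ℝ := y - P.reg i ⬝ᵥ P.theta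

/-- The influence of unit `i` on the least squares estimator of the coefficient of `D`. The
differences of this variable between matched units estimate the asymptotic variance. -/
noncomputable def influence (i : Fin n) (Y : Fin n → ℝ) : ℝ := P.weight i * P.err i (Y i)

/-- The average of `Z U` over the subsample. -/
noncomputable def noise (Y : Fin n → ℝ) : Fin (q + 2) → ℝ :=
  P.size⁻¹ • ∑ i ∈ P.sub, (Y i - P.cexp (P.obs i)) • P.reg i

/-- The square root of the asymptotic variance of the estimator. -/
noncomputable def sd : ℝ := √(P.slope ⬝ᵥ P.Del *ᵥ P.slope)

/-- The infeasible version of the matching estimator `SigHat l Y 1 1` of `sd ^ 2` that uses the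
errors in place of the residuals. -/
noncomputable def oracleVar (l : Fin n → Fin n) (Y : Fin n → ℝ) : ℝ :=
  (2 * P.size)⁻¹ * ∑ i ∈ P.sub, (P.influence i Y - P.influence (l i) Y) ^ 2

lemma transpose_inv_Gam : P.Gam⁻¹ᵀ = P.Gam⁻¹ := by
  have hsymm := P.isHermitian_Gam
  rw [Matrix.IsHermitian, Matrix.conjTranspose_eq_transpose_of_trivial] at hsymm
  rw [Matrix.transpose_nonsing_inv, hsymm]

lemma inv_Gam_mulVec_one (v : Fin (q + 2) → ℝ) : (P.Gam⁻¹ *ᵥ v) 1 = P.slope ⬝ᵥ v := by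
  rw [slope, dotProduct_comm, Matrix.dotProduct_mulVec, ← Matrix.mulVec_transpose,
    transpose_inv_Gam, dotProduct_single, mul_one]

lemma lsq_sub_theta (Y : Fin n → ℝ) : P.lsq Y - P.theta = P.Gam⁻¹ *ᵥ P.noise Y := by
  simp only [theta, lsq, noise, ← Matrix.mulVec_sub, ← smul_sub, ← Finset.sum_sub_distrib, sub_smul]

lemma betaHat_sub_theta_one (Y : Fin n → ℝ) : P.betaHat Y - P.theta 1 =
    P.size⁻¹ * ∑ i ∈ P.sub, P.weight i * (Y i - P.cexp (P.obs i)) := by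
  have hcoef := congrFun (P.lsq_sub_theta Y) 1
  rw [Pi.sub_apply, inv_Gam_mulVec_one, dotProduct_comm] at hcoef
  simp only [betaHat, hcoef, noise, weight, smul_dotProduct, sum_dotProduct, smul_eq_mul, mul_comm]

lemma SigHat_one_one (l : Fin n → Fin n) (Y : Fin n → ℝ) : P.SigHat l Y 1 1 =
    (2 * P.size)⁻¹ * ∑ i ∈ P.sub,
      (P.weight i * P.resid Y i - P.weight (l i) * P.resid Y (l i)) ^ 2 := by
  have hquad : P.SigHat l Y 1 1 = P.slope ⬝ᵥ P.DelHat l Y *ᵥ P.slope := by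
    rw [← inv_Gam_mulVec_one]
    conv_rhs => rw [slope, Matrix.mulVec_mulVec, Matrix.mulVec_mulVec]
    rw [SigHat, Matrix.mul_assoc, Matrix.mulVec_single_one]
    rfl
  have hsum := dotProduct_sum_smul_vecMulVec_mulVec P.sub (fun _ => 1)
    (fun i => P.resid Y i • P.reg i - P.resid Y (l i) • P.reg (l i))
    (fun i => P.resid Y i • P.reg i - P.resid Y (l i) • P.reg (l i)) P.slope P.slope
  simp only [one_smul, one_mul, sub_dotProduct, smul_dotProduct, smul_eq_mul] at hsum
  rw [hquad, DelHat, Matrix.smul_mulVec, dotProduct_smul, hsum, smul_eq_mul]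
  simp only [weight, mul_comm, sq]

lemma resid_eq (Y : Fin n → ℝ) (i : Fin n) :
    P.resid Y i = P.err i (Y i) - P.reg i ⬝ᵥ (P.lsq Y - P.theta) := by
  rw [resid, err, dotProduct_sub]
  ring

lemma noise_dotProduct_self (Y : Fin n → ℝ) : P.noise Y ⬝ᵥ P.noise Y =
    P.size⁻¹ ^ 2 * ∑ k, (∑ i ∈ P.sub, P.reg i k * (Y i - P.cexp (P.obs i))) ^ 2 := by
  simp only [dotProduct, noise, Pi.smul_apply, Finset.sum_apply, smul_eq_mul,
    Finset.mul_sum _ _ (_ ^ 2), ← sq, mul_pow, mul_comm]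

lemma measurable_err (i : Fin n) : Measurable (P.err i) := by
  unfold err
  fun_prop

lemma measurable_influence (i : Fin n) : Measurable (P.influence i) :=
  ((P.measurable_err i).comp (measurable_pi_apply i)).const_mul _

lemma integral_condLaw {i : Fin n} {f : ℝ → ℝ} (hf : Measurable f) :
    ∫ Y, f (Y i) ∂P.condLaw = ∫ y, f y ∂(P.law (P.obs i)) :=
  integral_comp_eval hf.aestronglyMeasurable

lemma integrable_condLaw {i : Fin n} {f : ℝ → ℝ} (hf : Integrable f (P.law (P.obs i))) :
    Integrable (fun Y => f (Y i)) P.condLaw :=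
  integrable_comp_eval hf

lemma iIndepFun_condLaw {f : Fin n → ℝ → ℝ} (hf : ∀ i, Measurable (f i)) :
    iIndepFun (fun i Y => f i (Y i)) P.condLaw :=
  iIndepFun_pi fun i => (hf i).aemeasurable

lemma iIndepFun_influence : iIndepFun P.influence P.condLaw :=
  P.iIndepFun_condLaw fun i => (P.measurable_err i).const_mul (P.weight i)

lemma cvar_nonneg (o : Obs p) : 0 ≤ P.cvar o := integral_nonneg fun _ => sq_nonneg _

lemma oracleVar_nonneg (l : Fin n → Fin n) (Y : Fin n → ℝ) : 0 ≤ P.oracleVar l Y :=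
  mul_nonneg (by unfold size; positivity) (Finset.sum_nonneg fun _ _ => sq_nonneg _)

end Influence

/-- Bounds on the design and on the fourth moments of the errors. -/
structure Bounded {p q n : ℕ} (P : Given p q n) (lam R C : ℝ) : Prop where
  lam_pos : 0 < lam
  isCoerciveWith_Gam : IsCoerciveWith P.Gam lam
  isCoerciveWith_Del : IsCoerciveWith P.Del lam
  reg_dotProduct_self_le : ∀ i ∈ P.sub, P.reg i ⬝ᵥ P.reg i ≤ R
  integrable_err_pow_four : ∀ i ∈ P.sub, Integrable (fun y => P.err i y ^ 4) (P.law (P.obs i))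
  integral_err_pow_four_le : ∀ i ∈ P.sub, ∫ y, P.err i y ^ 4 ∂(P.law (P.obs i)) ≤ C

namespace Bounded

section Design

variable {p q n : ℕ} {P : Given p q n} {lam R C : ℝ}

lemma isUnit_Gam (h : P.Bounded lam R C) : IsUnit P.Gam := h.isCoerciveWith_Gam.isUnit h.lam_pos

lemma size_pos (h : P.Bounded lam R C) : 0 < P.size := Given.size_pos h.isUnit_Gam

lemma sub_nonempty (h : P.Bounded lam R C) : P.sub.Nonempty :=
  Finset.card_pos.1 (Nat.cast_pos.1 h.size_pos)

lemma R_nonneg (h : P.Bounded lam R C) : 0 ≤ R :=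
  have ⟨i, hi⟩ := h.sub_nonempty
  (zero_le_dotProduct_self _).trans (h.reg_dotProduct_self_le i hi)

lemma C_nonneg (h : P.Bounded lam R C) : 0 ≤ C :=
  have ⟨i, hi⟩ := h.sub_nonempty
  (integral_nonneg fun _ => by positivity).trans (h.integral_err_pow_four_le i hi)

lemma Gam_mulVec_inv_Gam_mulVec (h : P.Bounded lam R C) (v : Fin (q + 2) → ℝ) :
    P.Gam *ᵥ P.Gam⁻¹ *ᵥ v = v := by
  rw [Matrix.mulVec_mulVec,
    Matrix.mul_nonsing_inv _ ((Matrix.isUnit_iff_isUnit_det _).1 h.isUnit_Gam), Matrix.one_mulVec]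

lemma slope_dotProduct_self_le (h : P.Bounded lam R C) : P.slope ⬝ᵥ P.slope ≤ (lam ^ 2)⁻¹ := by
  have hsq := h.isCoerciveWith_Gam.sq_mul_dotProduct_self_le h.lam_pos P.slope
  rw [slope, h.Gam_mulVec_inv_Gam_mulVec, dotProduct_single, Pi.single_eq_same, mul_one,
    ← slope] at hsq
  rwa [← one_div, le_div_iff₀ (pow_pos h.lam_pos 2), mul_comm]

lemma reg_dotProduct_sq_le (h : P.Bounded lam R C) {i : Fin n} (hi : i ∈ P.sub)
    (x : Fin (q + 2) → ℝ) : (P.reg i ⬝ᵥ x) ^ 2 ≤ R * (x ⬝ᵥ x) :=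
  (dotProduct_sq_le _ _).trans
    (mul_le_mul_of_nonneg_right (h.reg_dotProduct_self_le i hi) (zero_le_dotProduct_self _))

lemma weight_sq_le (h : P.Bounded lam R C) {i : Fin n} (hi : i ∈ P.sub) :
    P.weight i ^ 2 ≤ R / lam ^ 2 :=
  calc P.weight i ^ 2 ≤ R * (P.slope ⬝ᵥ P.slope) := h.reg_dotProduct_sq_le hi _
    _ ≤ R * (lam ^ 2)⁻¹ := mul_le_mul_of_nonneg_left h.slope_dotProduct_self_le h.R_nonneg
    _ = R / lam ^ 2 := (div_eq_mul_inv _ _).symm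

lemma weight_pow_four_le (h : P.Bounded lam R C) {i : Fin n} (hi : i ∈ P.sub) :
    P.weight i ^ 4 ≤ (R / lam ^ 2) ^ 2 :=
  calc P.weight i ^ 4 = (P.weight i ^ 2) ^ 2 := pow_mul _ 2 2
    _ ≤ (R / lam ^ 2) ^ 2 := pow_le_pow_left₀ (sq_nonneg _) (h.weight_sq_le hi) 2

-- The weights reproduce the coefficient `1` of `D` on `D` itself, so they cannot all be small.
lemma one_le_mul_slope_dotProduct_self (h : P.Bounded lam R C) :
    1 ≤ R * (P.slope ⬝ᵥ P.slope) := by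
  have hone : 1 = P.size⁻¹ * ∑ i ∈ P.sub, P.reg i 1 * P.weight i := by
    have hGam := P.dotProduct_Gam_mulVec (Pi.single 1 1) P.slope
    rw [slope, h.Gam_mulVec_inv_Gam_mulVec, ← slope] at hGam
    simpa [weight] using hGam
  have hterm : ∀ i ∈ P.sub, P.reg i 1 * P.weight i ≤ (1 + R * (P.slope ⬝ᵥ P.slope)) / 2 := by
    intro i hi
    have hreg : P.reg i 1 ^ 2 ≤ 1 := by
      rw [reg_one, treat]
      split_ifs <;> norm_num
    have hweight : P.weight i ^ 2 ≤ R * (P.slope ⬝ᵥ P.slope) := h.reg_dotProduct_sq_le hi _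
    linarith [two_mul_le_add_sq (P.reg i 1) (P.weight i)]
  have hmean : 1 ≤ (1 + R * (P.slope ⬝ᵥ P.slope)) / 2 :=
    calc 1 = P.size⁻¹ * ∑ i ∈ P.sub, P.reg i 1 * P.weight i := hone
      _ ≤ P.size⁻¹ * (P.size * ((1 + R * (P.slope ⬝ᵥ P.slope)) / 2)) := by
        have := h.size_pos
        gcongr
        simpa only [nsmul_eq_mul, size] using Finset.sum_le_card_nsmul _ _ _ hterm
      _ = _ := inv_mul_cancel_left₀ h.size_pos.ne' _
  linarith

lemma R_pos (h : P.Bounded lam R C) : 0 < R := by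
  refine h.R_nonneg.lt_of_ne fun h0 => ?_
  have hone := h.one_le_mul_slope_dotProduct_self
  rw [← h0, zero_mul] at hone
  linarith

lemma div_pos (h : P.Bounded lam R C) : 0 < lam / R := _root_.div_pos h.lam_pos h.R_pos

lemma le_slope_dotProduct_Del_mulVec (h : P.Bounded lam R C) :
    lam / R ≤ P.slope ⬝ᵥ P.Del *ᵥ P.slope := by
  refine le_trans ?_ (h.isCoerciveWith_Del _)
  rw [div_le_iff₀ h.R_pos, mul_assoc, mul_comm _ R]
  exact le_mul_of_one_le_right h.lam_pos.le h.one_le_mul_slope_dotProduct_self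

lemma sqrt_le_sd (h : P.Bounded lam R C) : √(lam / R) ≤ P.sd :=
  Real.sqrt_le_sqrt h.le_slope_dotProduct_Del_mulVec

lemma sd_pos (h : P.Bounded lam R C) : 0 < P.sd :=
  (Real.sqrt_pos.2 h.div_pos).trans_le h.sqrt_le_sd

lemma sd_sq (h : P.Bounded lam R C) : P.sd ^ 2 = P.slope ⬝ᵥ P.Del *ᵥ P.slope :=
  Real.sq_sqrt (h.div_pos.le.trans h.le_slope_dotProduct_Del_mulVec)

lemma size_mul_sd_sq (h : P.Bounded lam R C) :
    P.size * P.sd ^ 2 = ∑ i ∈ P.sub, P.weight i ^ 2 * P.cvar (P.obs i) := by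
  rw [h.sd_sq, dotProduct_Del_mulVec, mul_inv_cancel_left₀ h.size_pos.ne']
  simp only [weight, sq, mul_comm]

lemma abs_slope_le (h : P.Bounded lam R C) (j : Fin (q + 2)) : |P.slope j| ≤ lam⁻¹ := by
  have hsq : P.slope j ^ 2 ≤ P.slope ⬝ᵥ P.slope := by
    rw [sq]
    exact Finset.single_le_sum (f := fun j => P.slope j * P.slope j)
      (fun i _ => mul_self_nonneg _) (Finset.mem_univ j)
  have hbound := hsq.trans h.slope_dotProduct_self_le
  rw [← inv_pow] at hbound
  exact abs_le_of_sq_le_sq hbound (inv_pos.2 h.lam_pos).le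

end Design

section Moments

variable {p q n : ℕ} {P : Given p q n} {lam R C : ℝ} {i : Fin n}

lemma integrable_err (h : P.Bounded lam R C) (hi : i ∈ P.sub) :
    Integrable (P.err i) (P.law (P.obs i)) :=
  integrable_of_integrable_pow_four (P.measurable_err i).aestronglyMeasurable
    (h.integrable_err_pow_four i hi)

lemma integral_err (h : P.Bounded lam R C) (hi : i ∈ P.sub) :
    ∫ y, P.err i y ∂(P.law (P.obs i)) = P.cexp (P.obs i) - P.reg i ⬝ᵥ P.theta := by
  have hint : Integrable (fun y : ℝ => y) (P.law (P.obs i)) :=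
    ((h.integrable_err hi).add (integrable_const (P.reg i ⬝ᵥ P.theta))).congr
      (ae_of_all _ fun y => sub_add_cancel y _)
  simp only [err]
  rw [integral_sub hint (integrable_const _), cexp, integral_const, probReal_univ, one_smul]

lemma sub_cexp (h : P.Bounded lam R C) (hi : i ∈ P.sub) (y : ℝ) :
    y - P.cexp (P.obs i) = P.err i y - ∫ y, P.err i y ∂(P.law (P.obs i)) := by
  rw [h.integral_err hi, err]
  ring

lemma integral_sub_cexp (h : P.Bounded lam R C) (hi : i ∈ P.sub) :
    ∫ y, (y - P.cexp (P.obs i)) ∂(P.law (P.obs i)) = 0 := by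
  simp only [h.sub_cexp hi]
  rw [integral_sub (h.integrable_err hi) (integrable_const _), integral_const, probReal_univ,
    one_smul, sub_self]

lemma abs_integral_err_le (h : P.Bounded lam R C) (hi : i ∈ P.sub) :
    |∫ y, P.err i y ∂(P.law (P.obs i))| ≤ 1 + C :=
  abs_integral_le_integral_abs.trans <| by
    simpa only [pow_one] using integral_abs_pow_le_of_integral_pow_four_le
      (P.measurable_err i).aestronglyMeasurable (h.integrable_err_pow_four i hi)
      (h.integral_err_pow_four_le i hi) (k := 1) (by norm_num)

lemma integrable_sub_cexp_pow_four (h : P.Bounded lam R C) (hi : i ∈ P.sub) :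
    Integrable (fun y => (y - P.cexp (P.obs i)) ^ 4) (P.law (P.obs i)) := by
  simp only [h.sub_cexp hi]
  exact integrable_sub_pow_four (P.measurable_err i).aestronglyMeasurable
    aestronglyMeasurable_const (h.integrable_err_pow_four i hi) (integrable_const _)

lemma integral_sub_cexp_pow_four_le (h : P.Bounded lam R C) (hi : i ∈ P.sub) :
    ∫ y, (y - P.cexp (P.obs i)) ^ 4 ∂(P.law (P.obs i)) ≤ 8 * (C + (1 + C) ^ 4) := by
  have hmean : (∫ y, P.err i y ∂(P.law (P.obs i))) ^ 4 ≤ (1 + C) ^ 4 := by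
    rw [← Even.pow_abs (by decide : Even 4)]
    exact pow_le_pow_left₀ (abs_nonneg _) (h.abs_integral_err_le hi) 4
  simp only [h.sub_cexp hi]
  refine (integral_sub_pow_four_le (P.measurable_err i).aestronglyMeasurable
    aestronglyMeasurable_const (h.integrable_err_pow_four i hi) (integrable_const _)).trans ?_
  rw [integral_const, probReal_univ, one_smul]
  linarith [h.integral_err_pow_four_le i hi]

lemma memLp_sub_cexp (h : P.Bounded lam R C) (hi : i ∈ P.sub) :
    MemLp (fun y => y - P.cexp (P.obs i)) 2 (P.law (P.obs i)) :=
  memLp_two_of_integrable_pow_four (by fun_prop) (h.integrable_sub_cexp_pow_four hi)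

lemma variance_err (h : P.Bounded lam R C) (hi : i ∈ P.sub) :
    Var[P.err i; P.law (P.obs i)] = P.cvar (P.obs i) := by
  rw [variance_eq_integral (P.measurable_err i).aemeasurable, cvar]
  simp only [h.sub_cexp hi]

lemma cvar_le (h : P.Bounded lam R C) (hi : i ∈ P.sub) : P.cvar (P.obs i) ≤ 1 + C := by
  rw [← h.variance_err hi]
  exact (variance_le_expectation_sq (P.measurable_err i).aestronglyMeasurable).trans
    (integral_sq_le_of_integral_pow_four_le (P.measurable_err i).aestronglyMeasurable
      (h.integrable_err_pow_four i hi) (h.integral_err_pow_four_le i hi))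

lemma variance_influence (h : P.Bounded lam R C) (hi : i ∈ P.sub) :
    Var[P.influence i; P.condLaw] = P.weight i ^ 2 * P.cvar (P.obs i) := by
  rw [show P.influence i = fun Y => P.weight i * P.err i (Y i) from rfl, variance_const_mul,
    ← h.variance_err hi]
  congr 1
  exact (measurePreserving_eval (fun i => P.law (P.obs i)) i).variance_fun_comp
    (P.measurable_err i).aemeasurable

lemma average_variance_influence (h : P.Bounded lam R C) :
    P.size⁻¹ * ∑ i ∈ P.sub, Var[P.influence i; P.condLaw] = P.sd ^ 2 := by
  rw [Finset.sum_congr rfl fun i hi => h.variance_influence hi, ← h.size_mul_sd_sq,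
    inv_mul_cancel_left₀ h.size_pos.ne']

lemma integrable_influence_pow_four (h : P.Bounded lam R C) (hi : i ∈ P.sub) :
    Integrable (fun Y => P.influence i Y ^ 4) P.condLaw := by
  simp only [influence, mul_pow]
  exact (P.integrable_condLaw (h.integrable_err_pow_four i hi)).const_mul _

lemma integral_influence_pow_four_le (h : P.Bounded lam R C) (hi : i ∈ P.sub) :
    ∫ Y, P.influence i Y ^ 4 ∂P.condLaw ≤ (R / lam ^ 2) ^ 2 * C := by
  simp only [influence, mul_pow]
  rw [integral_const_mul, P.integral_condLaw ((P.measurable_err i).pow_const 4)]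
  exact mul_le_mul (h.weight_pow_four_le hi) (h.integral_err_pow_four_le i hi)
    (integral_nonneg fun y => by positivity) (by positivity)

lemma memLp_const_mul_sub_cexp (h : P.Bounded lam R C) (hi : i ∈ P.sub) (c : ℝ) :
    MemLp (fun Y : Fin n → ℝ => c * (Y i - P.cexp (P.obs i))) 2 P.condLaw :=
  ((h.memLp_sub_cexp hi).comp_measurePreserving
    (measurePreserving_eval (fun i => P.law (P.obs i)) i)).const_mul c

lemma integral_const_mul_sub_cexp (h : P.Bounded lam R C) (hi : i ∈ P.sub) (c : ℝ) :
    ∫ Y, c * (Y i - P.cexp (P.obs i)) ∂P.condLaw = 0 := by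
  rw [integral_const_mul, P.integral_condLaw (f := fun y => y - P.cexp (P.obs i)) (by fun_prop),
    h.integral_sub_cexp hi, mul_zero]

lemma integral_const_mul_sub_cexp_sq (P : Given p q n) (i : Fin n) (c : ℝ) :
    ∫ Y, (c * (Y i - P.cexp (P.obs i))) ^ 2 ∂P.condLaw = c ^ 2 * P.cvar (P.obs i) := by
  simp only [mul_pow]
  rw [integral_const_mul, P.integral_condLaw (f := fun y => (y - P.cexp (P.obs i)) ^ 2)
    (by fun_prop), cvar]

lemma integrable_weight_mul_sub_cexp_pow_four (h : P.Bounded lam R C) (hi : i ∈ P.sub) :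
    Integrable (fun Y => (P.weight i * (Y i - P.cexp (P.obs i))) ^ 4) P.condLaw := by
  simp only [mul_pow]
  exact (P.integrable_condLaw (h.integrable_sub_cexp_pow_four hi)).const_mul _

lemma integral_weight_mul_sub_cexp_pow_four_le (h : P.Bounded lam R C) (hi : i ∈ P.sub) :
    ∫ Y, (P.weight i * (Y i - P.cexp (P.obs i))) ^ 4 ∂P.condLaw ≤
      (R / lam ^ 2) ^ 2 * (8 * (C + (1 + C) ^ 4)) := by
  simp only [mul_pow]
  rw [integral_const_mul,
    P.integral_condLaw (f := fun y => (y - P.cexp (P.obs i)) ^ 4) (by fun_prop)]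
  exact mul_le_mul (h.weight_pow_four_le hi) (h.integral_sub_cexp_pow_four_le hi)
    (integral_nonneg fun y => by positivity) (by positivity)

lemma integrable_sum_mul_sub_cexp_sq (h : P.Bounded lam R C) (c : Fin n → ℝ) :
    Integrable (fun Y => (∑ i ∈ P.sub, c i * (Y i - P.cexp (P.obs i))) ^ 2) P.condLaw :=
  (memLp_finsetSum P.sub fun i hi => h.memLp_const_mul_sub_cexp hi (c i)).integrable_sq

lemma integral_sum_mul_sub_cexp_sq (h : P.Bounded lam R C) (c : Fin n → ℝ) :
    ∫ Y, (∑ i ∈ P.sub, c i * (Y i - P.cexp (P.obs i))) ^ 2 ∂P.condLaw =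
      ∑ i ∈ P.sub, c i ^ 2 * P.cvar (P.obs i) := by
  have hmem := fun i hi => h.memLp_const_mul_sub_cexp (i := i) hi (c i)
  have hzero := fun i hi => h.integral_const_mul_sub_cexp (i := i) hi (c i)
  have hind := P.iIndepFun_condLaw (f := fun i y => c i * (y - P.cexp (P.obs i)))
    fun i => by fun_prop
  have hvar := IndepFun.variance_sum hmem fun i _ j _ hij => hind.indepFun hij
  rw [Finset.sum_fn, variance_of_integral_eq_zero (memLp_finsetSum P.sub hmem).1.aemeasurable
    (by rw [integral_finsetSum _ fun i hi => (hmem i hi).integrable (by norm_num),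
      Finset.sum_eq_zero hzero])] at hvar
  rw [hvar]
  refine Finset.sum_congr rfl fun i hi => ?_
  rw [variance_of_integral_eq_zero (hmem i hi).1.aemeasurable (hzero i hi),
    integral_const_mul_sub_cexp_sq]

end Moments

section Coefficients

variable {p q n : ℕ} {P : Given p q n} {lam R C : ℝ}

lemma sq_mul_lsq_sub_theta_dotProduct_self_le (h : P.Bounded lam R C) (Y : Fin n → ℝ) :
    lam ^ 2 * ((P.lsq Y - P.theta) ⬝ᵥ (P.lsq Y - P.theta)) ≤ P.noise Y ⬝ᵥ P.noise Y := by
  have hsq := h.isCoerciveWith_Gam.sq_mul_dotProduct_self_le h.lam_pos (P.lsq Y - P.theta)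
  rwa [lsq_sub_theta, h.Gam_mulVec_inv_Gam_mulVec, ← lsq_sub_theta] at hsq

lemma integrable_noise_dotProduct_self (h : P.Bounded lam R C) :
    Integrable (fun Y => P.noise Y ⬝ᵥ P.noise Y) P.condLaw := by
  simp only [noise_dotProduct_self]
  exact (integrable_finsetSum _ fun k _ =>
    h.integrable_sum_mul_sub_cexp_sq fun i => P.reg i k).const_mul _

lemma integral_noise_dotProduct_self_le (h : P.Bounded lam R C) :
    ∫ Y, P.noise Y ⬝ᵥ P.noise Y ∂P.condLaw ≤ R * (1 + C) / P.size := by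
  have hterm : ∀ i ∈ P.sub, ∑ k, P.reg i k ^ 2 * P.cvar (P.obs i) ≤ R * (1 + C) := by
    intro i hi
    rw [← Finset.sum_mul]
    refine mul_le_mul (le_of_eq_of_le ?_ (h.reg_dotProduct_self_le i hi)) (h.cvar_le hi)
      (P.cvar_nonneg _) h.R_nonneg
    simp only [dotProduct, sq]
  simp only [noise_dotProduct_self]
  rw [integral_const_mul, integral_finsetSum _ fun k _ =>
    h.integrable_sum_mul_sub_cexp_sq fun i => P.reg i k]
  simp only [h.integral_sum_mul_sub_cexp_sq]
  rw [Finset.sum_comm]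
  have hsize := h.size_pos
  calc _ ≤ P.size⁻¹ ^ 2 * (P.size * (R * (1 + C))) := by
        gcongr
        simpa only [nsmul_eq_mul, size] using Finset.sum_le_card_nsmul _ _ _ hterm
    _ = R * (1 + C) / P.size := by field_simp

lemma sq_weight_mul_sub_weight_mul_le (h : P.Bounded lam R C) {i i' : Fin n} (hi : i ∈ P.sub)
    (hi' : i' ∈ P.sub) (x : Fin (q + 2) → ℝ) :
    (P.weight i * (P.reg i ⬝ᵥ x) - P.weight i' * (P.reg i' ⬝ᵥ x)) ^ 2 ≤
      4 * (R / lam ^ 2 * (R * (x ⬝ᵥ x))) := by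
  have hterm : ∀ i ∈ P.sub, (P.weight i * (P.reg i ⬝ᵥ x)) ^ 2 ≤ R / lam ^ 2 * (R * (x ⬝ᵥ x)) := by
    intro i hi
    rw [mul_pow]
    exact mul_le_mul (h.weight_sq_le hi) (h.reg_dotProduct_sq_le hi x) (sq_nonneg _)
      (div_nonneg h.R_nonneg (sq_nonneg _))
  linarith [sq_nonneg (P.weight i * (P.reg i ⬝ᵥ x) + P.weight i' * (P.reg i' ⬝ᵥ x)),
    hterm i hi, hterm i' hi']

lemma abs_sqrt_SigHat_sub_sqrt_oracleVar_le_lsq (h : P.Bounded lam R C) {l : Fin n → Fin n}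
    (hl : ∀ i ∈ P.sub, l i ∈ P.sub) (Y : Fin n → ℝ) :
    |√(P.SigHat l Y 1 1) - √(P.oracleVar l Y)| ≤
      √(2 * (R / lam ^ 2) * R * ((P.lsq Y - P.theta) ⬝ᵥ (P.lsq Y - P.theta))) := by
  set D := P.lsq Y - P.theta
  have hsize := h.size_pos
  have hscale : 0 ≤ (2 * P.size)⁻¹ := by positivity
  have hresid : ∀ i, P.weight i * P.resid Y i - P.weight (l i) * P.resid Y (l i) =
      (P.influence i Y - P.influence (l i) Y) -
        (P.weight i * (P.reg i ⬝ᵥ D) - P.weight (l i) * (P.reg (l i) ⬝ᵥ D)) := fun i => by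
    rw [resid_eq, resid_eq, influence, influence]
    ring
  have hsum := Finset.sum_le_card_nsmul _ _ _ fun i hi =>
    h.sq_weight_mul_sub_weight_mul_le hi (hl i hi) D
  rw [nsmul_eq_mul, ← size] at hsum
  rw [SigHat_one_one, oracleVar, Real.sqrt_mul hscale, Real.sqrt_mul hscale, ← mul_sub, abs_mul,
    abs_of_nonneg (Real.sqrt_nonneg _)]
  simp only [hresid]
  refine (mul_le_mul_of_nonneg_left (abs_sqrt_sum_sub_sq_sub_le P.sub _ _)
    (Real.sqrt_nonneg _)).trans ?_
  rw [← Real.sqrt_mul hscale]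
  refine Real.sqrt_le_sqrt ((mul_le_mul_of_nonneg_left hsum hscale).trans_eq ?_)
  field_simp
  ring

lemma abs_sqrt_SigHat_sub_sqrt_oracleVar_le (h : P.Bounded lam R C) {l : Fin n → Fin n}
    (hl : ∀ i ∈ P.sub, l i ∈ P.sub) (Y : Fin n → ℝ) :
    |√(P.SigHat l Y 1 1) - √(P.oracleVar l Y)| ≤
      √(2 * (R / lam ^ 2) ^ 2) * √(P.noise Y ⬝ᵥ P.noise Y) := by
  refine (h.abs_sqrt_SigHat_sub_sqrt_oracleVar_le_lsq hl Y).trans ?_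
  rw [← Real.sqrt_mul (by positivity)]
  have hlam := h.lam_pos
  refine Real.sqrt_le_sqrt (le_of_eq_of_le ?_ (mul_le_mul_of_nonneg_left
    (h.sq_mul_lsq_sub_theta_dotProduct_self_le Y) (by positivity)))
  field_simp

end Coefficients

end Bounded

section MomentRegularity

variable {p q n : ℕ} {P : Given p q n} {ψ : Ctrl p → Ctrl p → ℝ} {M lam R C : ℝ}

lemma moment_obs (j k : Fin (q + 2)) (a b c : ℕ) (i : Fin n) :
    P.moment j k a b c (P.obs i) =
      P.reg i j ^ a * P.reg i k ^ b * ∫ y, P.err i y ^ c ∂(P.law (P.obs i)) :=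
  integral_const_mul _ _

lemma MomentRegular.reg_dotProduct_self_le (h : P.MomentRegular ψ M) {i : Fin n}
    (hi : i ∈ P.sub) : P.reg i ⬝ᵥ P.reg i ≤ (q + 2) * (1 + M) := by
  have hcoord : ∀ j ∈ (Finset.univ : Finset (Fin (q + 2))), P.reg i j * P.reg i j ≤ 1 + M := by
    intro j _
    have hfour := (le_abs_self _).trans
      (h.bounded j j 2 2 0 (by norm_num) (by norm_num) (by norm_num) i hi)
    simp only [moment_obs, pow_zero, integral_const, probReal_univ, smul_eq_mul, mul_one] at hfour
    linarith [sq_nonneg (P.reg i j ^ 2 - 1), sq_nonneg (P.reg i j ^ 2)]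
  simpa [dotProduct, mul_add] using Finset.sum_le_card_nsmul _ _ _ hcoord

lemma MomentRegular.integrable_err_pow_four (h : P.MomentRegular ψ M) {i : Fin n}
    (hi : i ∈ P.sub) : Integrable (fun y => P.err i y ^ 4) (P.law (P.obs i)) := by
  simpa [Z, err, reg] using h.integrable 0 0 2 2 4 le_rfl le_rfl le_rfl i hi

lemma MomentRegular.integral_err_pow_four_le (h : P.MomentRegular ψ M) {i : Fin n}
    (hi : i ∈ P.sub) : ∫ y, P.err i y ^ 4 ∂(P.law (P.obs i)) ≤ M := by
  have hbound := (le_abs_self _).trans (h.bounded 0 0 2 2 4 le_rfl le_rfl le_rfl i hi)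
  have hreg : P.reg i 0 = 1 := rfl
  simpa only [moment_obs, hreg, one_pow, one_mul] using hbound

lemma MomentRegular.bounded_of_isCoerciveWith (h : P.MomentRegular ψ M) (hlam : 0 < lam)
    (hG : IsCoerciveWith P.Gam lam) (hD : IsCoerciveWith P.Del lam) :
    P.Bounded lam ((q + 2) * (1 + M)) M where
  lam_pos := hlam
  isCoerciveWith_Gam := hG
  isCoerciveWith_Del := hD
  reg_dotProduct_self_le _ hi := h.reg_dotProduct_self_le hi
  integrable_err_pow_four _ hi := h.integrable_err_pow_four hi
  integral_err_pow_four_le _ hi := h.integral_err_pow_four_le hi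

lemma integral_influence (P : Given p q n) (i : Fin n) :
    ∫ Y, P.influence i Y ∂P.condLaw = ∑ j, P.slope j * P.moment j 0 1 0 1 (P.obs i) := by
  simp only [influence]
  rw [integral_const_mul, P.integral_condLaw (P.measurable_err i), weight, dotProduct,
    Finset.sum_mul]
  refine Finset.sum_congr rfl fun j _ => ?_
  simp only [moment_obs, pow_one, pow_zero, mul_one]
  ring

lemma integral_influence_sq (P : Given p q n) (i : Fin n) :
    ∫ Y, P.influence i Y ^ 2 ∂P.condLaw = ∑ jk : Fin (q + 2) × Fin (q + 2),
      P.slope jk.1 * P.slope jk.2 * P.moment jk.1 jk.2 1 1 2 (P.obs i) := by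
  simp only [influence, mul_pow]
  rw [integral_const_mul, P.integral_condLaw ((P.measurable_err i).pow_const 2), weight, dotProduct,
    sq, Finset.sum_mul_sum, ← Finset.sum_product', Finset.univ_product_univ, Finset.sum_mul]
  refine Finset.sum_congr rfl fun jk _ => ?_
  simp only [moment_obs, pow_one]
  ring

lemma Bounded.abs_integral_influence_sub_le (h : P.Bounded lam R C) (hr : P.MomentRegular ψ M)
    {d : Bool} {i i' : Fin n} (hi : i ∈ P.arm d) (hi' : i' ∈ P.arm d) :
    |∫ Y, P.influence i Y ∂P.condLaw - ∫ Y, P.influence i' Y ∂P.condLaw| ≤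
      (q + 2) / lam * (M * ψ (P.X i) (P.X i')) := by
  rw [integral_influence, integral_influence]
  refine (abs_sum_mul_sub_sum_mul_le h.abs_slope_le fun j =>
    hr.lipschitz j 0 1 0 1 (by norm_num) (by norm_num) le_rfl d i hi i' hi').trans_eq ?_
  simp only [Fintype.card_fin]
  push_cast
  ring

lemma Bounded.abs_integral_influence_sq_sub_le (h : P.Bounded lam R C)
    (hr : P.MomentRegular ψ M) {d : Bool} {i i' : Fin n} (hi : i ∈ P.arm d) (hi' : i' ∈ P.arm d) :
    |∫ Y, P.influence i Y ^ 2 ∂P.condLaw - ∫ Y, P.influence i' Y ^ 2 ∂P.condLaw| ≤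
      ((q + 2) / lam) ^ 2 * (M * ψ (P.X i) (P.X i')) := by
  have hslope : ∀ jk : Fin (q + 2) × Fin (q + 2), |P.slope jk.1 * P.slope jk.2| ≤ lam⁻¹ * lam⁻¹ :=
    fun jk => by
      rw [abs_mul]
      exact mul_le_mul (h.abs_slope_le _) (h.abs_slope_le _) (abs_nonneg _)
        (inv_pos.2 h.lam_pos).le
  rw [integral_influence_sq, integral_influence_sq]
  refine (abs_sum_mul_sub_sum_mul_le hslope fun jk =>
    hr.lipschitz jk.1 jk.2 1 1 2 (by norm_num) (by norm_num) le_rfl d i hi i' hi').trans_eq ?_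
  simp only [Fintype.card_prod, Fintype.card_fin]
  push_cast
  ring

lemma Bounded.momentClose_influence (h : P.Bounded lam R C) (hr : P.MomentRegular ψ M) {d : Bool}
    {i i' : Fin n} (hi : i ∈ P.arm d) (hi' : i' ∈ P.arm d) :
    MomentClose P.condLaw (P.influence i) (P.influence i')
      ((1 + (q + 2) / lam) ^ 2 * (M * ψ (P.X i) (P.X i'))) := by
  have hψ : 0 ≤ M * ψ (P.X i) (P.X i') := (abs_nonneg _).trans
    (hr.lipschitz 0 0 0 0 0 (by norm_num) (by norm_num) le_rfl d i hi i' hi')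
  have hK : 0 ≤ (q + 2) / lam := div_nonneg (by positivity) h.lam_pos.le
  exact ⟨(h.abs_integral_influence_sub_le hr hi hi').trans
      (mul_le_mul_of_nonneg_right (by nlinarith) hψ),
    (h.abs_integral_influence_sq_sub_le hr hi hi').trans
      (mul_le_mul_of_nonneg_right (by nlinarith) hψ)⟩

end MomentRegularity

end Given

section NormalDistribution

lemma monotone_Phi : Monotone Phi := monotone_cdf _

lemma continuous_Phi : Continuous Phi := by
  have := nullSingletonClass_gaussianReal (μ := 0) (v := 1) one_ne_zero
  refine continuous_iff_continuousAt.2 fun z => ?_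
  have hjump : (cdf (gaussianReal 0 1)).measure {z} = 0 := by
    rw [measure_cdf, measure_singleton]
  rw [StieltjesFunction.measure_singleton, ENNReal.ofReal_eq_zero, sub_nonpos] at hjump
  refine (monotone_cdf (gaussianReal 0 1)).continuousAt_iff_leftLim_eq_rightLim.2 ?_
  rw [StieltjesFunction.rightLim_eq]
  exact le_antisymm ((monotone_cdf _).leftLim_le le_rfl) hjump

lemma Phi_quantile {a : ℝ} (h0 : 0 < a) (h1 : a < 1) : Phi (quantile a) = a := by
  obtain ⟨x, hx⟩ : ∃ x, Phi x < a := ((tendsto_cdf_atBot _).eventually_lt_const h0).exists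
  obtain ⟨y, hy⟩ : ∃ y, a < Phi y := ((tendsto_cdf_atTop _).eventually_const_lt h1).exists
  obtain ⟨z, hz⟩ := mem_range_of_exists_le_of_exists_ge continuous_Phi ⟨x, hx.le⟩ ⟨y, hy.le⟩
  have hbdd : BddBelow {z : ℝ | a ≤ Phi z} :=
    ⟨x, fun u hu => (monotone_Phi.reflect_lt (hx.trans_le hu)).le⟩
  have hclosed : IsClosed {z : ℝ | a ≤ Phi z} := isClosed_le continuous_const continuous_Phi
  exact le_antisymm ((monotone_Phi (csInf_le hbdd hz.ge)).trans hz.le)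
    (hclosed.csInf_mem ⟨z, hz.ge⟩ hbdd)

end NormalDistribution

section Slutsky

variable {Ω : Type*} {S r : Ω → ℝ} {ε : ℝ}

lemma setOf_le_sub_subset_union (z : ℝ) :
    {ω | S ω ≤ z - |z| * ε} ⊆ {ω | S ω ≤ z * r ω} ∪ {ω | ε ≤ |r ω - 1|} := by
  refine fun ω hω => or_iff_not_imp_right.2 fun hr => ?_
  have hshift := abs_mul (r ω - 1) z ▸ neg_abs_le ((r ω - 1) * z)
  have hsmall := mul_le_mul_of_nonneg_right (not_le.1 hr).le (abs_nonneg z)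
  simp only [Set.mem_ofPred_eq] at hω ⊢
  linarith

lemma setOf_le_mul_subset_union (z : ℝ) :
    {ω | S ω ≤ z * r ω} ⊆ {ω | S ω ≤ z + |z| * ε} ∪ {ω | ε ≤ |r ω - 1|} := by
  refine fun ω hω => or_iff_not_imp_right.2 fun hr => ?_
  have hshift := abs_mul (r ω - 1) z ▸ le_abs_self ((r ω - 1) * z)
  have hsmall := mul_le_mul_of_nonneg_right (not_le.1 hr).le (abs_nonneg z)
  simp only [Set.mem_ofPred_eq] at hω ⊢
  linarith

-- The ratio form of Slutsky's lemma with the denominator multiplied out, so that the denominator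
-- may vanish.
lemma tendsto_measureReal_le_mul {Ω : ℕ → Type*} [∀ n, MeasurableSpace (Ω n)]
    {μ : ∀ n, Measure (Ω n)} [∀ n, IsFiniteMeasure (μ n)] {S r : ∀ n, Ω n → ℝ} {F : ℝ → ℝ}
    (hF : Continuous F)
    (hS : ∀ z, Tendsto (fun n => (μ n).real {ω | S n ω ≤ z}) atTop (𝓝 (F z)))
    (hr : TendstoZeroInProb μ fun n ω => r n ω - 1) (z : ℝ) :
    Tendsto (fun n => (μ n).real {ω | S n ω ≤ z * r n ω}) atTop (𝓝 (F z)) := by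
  have hlim (c : ℝ) : Tendsto (fun ε => F (z + c * ε)) (𝓝[>] 0) (𝓝 (F z)) := by
    have hcont : Continuous fun ε => F (z + c * ε) := hF.comp (by fun_prop)
    simpa using (hcont.tendsto 0).mono_left nhdsWithin_le_nhds
  refine tendsto_order.2 ⟨fun a ha => ?_, fun a ha => ?_⟩
  · obtain ⟨ε, hε, hpos⟩ :=
      (((hlim (-|z|)).eventually_const_lt ha).and self_mem_nhdsWithin).exists
    rw [neg_mul, ← sub_eq_add_neg] at hε
    have hdiff := (hS (z - |z| * ε)).sub (hr ε hpos)
    rw [sub_zero] at hdiff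
    filter_upwards [hdiff.eventually_const_lt hε] with n hn
    linarith [(measureReal_mono (setOf_le_sub_subset_union z)).trans
      (measureReal_union_le (μ := μ n) {ω | S n ω ≤ z * r n ω} {ω | ε ≤ |r n ω - 1|})]
  · obtain ⟨ε, hε, hpos⟩ :=
      (((hlim |z|).eventually_lt_const ha).and self_mem_nhdsWithin).exists
    have hsum := (hS (z + |z| * ε)).add (hr ε hpos)
    rw [add_zero] at hsum
    filter_upwards [hsum.eventually_lt_const hε] with n hn
    exact ((measureReal_mono (setOf_le_mul_subset_union z)).trans
      (measureReal_union_le _ _)).trans_lt hn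

end Slutsky

namespace Given

section MomentCloseMatches

variable {p q : ℕ} {ψ : Ctrl p → Ctrl p → ℝ} {κ lam R C M K η : ℝ}

open scoped Classical in
lemma exists_card_not_momentClose_influence_le (hκ : 0 < κ) (hη : 0 < η) (hψ : IsMetric ψ)
    (hdom : ∀ x y, ψ x y ≤ K * dist x y) :
    ∃ N : ℕ, ∀ {n : ℕ} {P : Given p q n} {l : Fin n → Fin n}, P.Bounded lam R C →
      P.MomentRegular ψ M → P.IsMatch ψ κ l →
      {i ∈ P.sub | ¬MomentClose P.condLaw (P.influence i) (P.influence (l i)) η}.card ≤ N := by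
  set L := (1 + (q + 2) / lam) ^ 2 * M
  obtain ⟨N, hN⟩ := exists_card_not_close_match_le M hκ
    (show 0 < η / (|L| + 1) by positivity) hψ hdom
  refine ⟨N, fun {n P l} hb hr hl => (Finset.card_le_card fun i hi => ?_).trans (hN hl hr.diam)⟩
  simp only [Finset.mem_filter] at hi ⊢
  refine ⟨hi.1, fun ⟨harm, hclose⟩ => hi.2 ?_⟩
  have hi_arm : i ∈ P.arm (P.obs i).2 := P.mem_arm.2 ⟨hi.1, rfl⟩
  have hli_arm : l i ∈ P.arm (P.obs i).2 := P.mem_arm.2 ⟨(hl i hi.1).1, harm⟩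
  refine (hb.momentClose_influence hr hi_arm hli_arm).mono ?_
  have hψ0 := hψ.nonneg (P.X i) (P.X (l i))
  calc (1 + (q + 2) / lam) ^ 2 * (M * ψ (P.X i) (P.X (l i))) = L * ψ (P.X i) (P.X (l i)) :=
        (mul_assoc _ _ _).symm
    _ ≤ (|L| + 1) * ψ (P.X i) (P.X (l i)) :=
        mul_le_mul_of_nonneg_right (by linarith [le_abs_self L]) hψ0
    _ ≤ η := by rwa [le_div_iff₀' (by positivity)] at hclose

end MomentCloseMatches

section StandardError

variable {p q : ℕ} {P : ∀ n, Given p q n} {l : ∀ n, Fin n → Fin n}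
  {ψ : Ctrl p → Ctrl p → ℝ} {κ lam R C M K : ℝ} {B : ℕ}

lemma tendstoZeroInProb_oracleVar_sub_sd_sq
    (hlarge : Tendsto (fun n => (P n).sub.card) atTop atTop)
    (hb : ∀ᶠ n in atTop, (P n).Bounded lam R C) (hψ : IsMetric ψ)
    (hdom : ∀ x y, ψ x y ≤ K * dist x y) (hreg : ∀ᶠ n in atTop, (P n).MomentRegular ψ M)
    (hκ : 0 < κ) (hl : ∀ᶠ n in atTop, (P n).IsMatch ψ κ (l n))
    (hB : ∀ᶠ n in atTop, ∀ j, {i ∈ (P n).sub | l n i = j}.card ≤ B) :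
    TendstoZeroInProb (fun n => (P n).condLaw)
      fun n Y => (P n).oracleVar (l n) Y - (P n).sd ^ 2 := by
  obtain ⟨n₀, hb₀⟩ := hb.exists
  have hconv := tendstoZeroInProb_matched_difference (fun n => (P n).measurable_influence)
    (fun n => (P n).iIndepFun_influence) hlarge
    (hl.mono fun n hl i hi => ⟨(hl i hi).1, (hl i hi).2.1⟩)
    (mul_nonneg (sq_nonneg (R / lam ^ 2)) hb₀.C_nonneg)
    (hb.mono fun n hb i hi =>
      ⟨hb.integrable_influence_pow_four hi, hb.integral_influence_pow_four_le hi⟩) hB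
    fun η hη => by
      obtain ⟨N, hN⟩ := exists_card_not_momentClose_influence_le (q := q) (lam := lam) (R := R)
        (C := C) (M := M) hκ hη hψ hdom
      refine ⟨N, ?_⟩
      filter_upwards [hb, hreg, hl] with n hb hr hl using hN hb hr hl
  refine hconv.of_mul_abs_le one_pos ?_
  filter_upwards [hb] with n hb Y
  rw [one_mul, ← hb.average_variance_influence, oracleVar, size]

lemma tendstoZeroInProb_sqrt_noise_dotProduct_self
    (hlarge : Tendsto (fun n => (P n).sub.card) atTop atTop)
    (hb : ∀ᶠ n in atTop, (P n).Bounded lam R C) :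
    TendstoZeroInProb (fun n => (P n).condLaw) fun n Y => √((P n).noise Y ⬝ᵥ (P n).noise Y) := by
  refine tendstoZeroInProb_sqrt_of_tendsto_integral (fun n Y => zero_le_dotProduct_self _)
    (hb.mono fun n hb => hb.integrable_noise_dotProduct_self) ?_
  have hbound : Tendsto (fun n => R * (1 + C) / (P n).size) atTop (𝓝 0) :=
    (tendsto_natCast_atTop_atTop.comp hlarge).const_div_atTop _
  exact squeeze_zero' (.of_forall fun n => integral_nonneg fun Y => zero_le_dotProduct_self _)
    (hb.mono fun n hb => hb.integral_noise_dotProduct_self_le) hbound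

lemma tendstoZeroInProb_sqrt_SigHat_sub_sd
    (hlarge : Tendsto (fun n => (P n).sub.card) atTop atTop)
    (hb : ∀ᶠ n in atTop, (P n).Bounded lam R C) (hψ : IsMetric ψ)
    (hdom : ∀ x y, ψ x y ≤ K * dist x y) (hreg : ∀ᶠ n in atTop, (P n).MomentRegular ψ M)
    (hκ : 0 < κ) (hl : ∀ᶠ n in atTop, (P n).IsMatch ψ κ (l n))
    (hB : ∀ᶠ n in atTop, ∀ j, {i ∈ (P n).sub | l n i = j}.card ≤ B) :
    TendstoZeroInProb (fun n => (P n).condLaw)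
      fun n Y => √((P n).SigHat (l n) Y 1 1) - (P n).sd := by
  obtain ⟨n₀, hb₀⟩ := hb.exists
  have hA : 0 < √(2 * (R / lam ^ 2) ^ 2) :=
    Real.sqrt_pos.2 (mul_pos two_pos (pow_pos (div_pos hb₀.R_pos (pow_pos hb₀.lam_pos 2)) 2))
  have hresid : TendstoZeroInProb (fun n => (P n).condLaw)
      fun n Y => √((P n).SigHat (l n) Y 1 1) - √((P n).oracleVar (l n) Y) := by
    refine (tendstoZeroInProb_sqrt_noise_dotProduct_self hlarge hb).of_mul_abs_le
      (inv_pos.2 hA) ?_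
    filter_upwards [hb, hl] with n hb hl Y
    rw [inv_mul_le_iff₀ hA, abs_of_nonneg (Real.sqrt_nonneg (_ ⬝ᵥ _))]
    exact hb.abs_sqrt_SigHat_sub_sqrt_oracleVar_le (fun i hi => (hl i hi).1) Y
  have horacle : TendstoZeroInProb (fun n => (P n).condLaw)
      fun n Y => √((P n).oracleVar (l n) Y) - (P n).sd := by
    refine (tendstoZeroInProb_oracleVar_sub_sd_sq hlarge hb hψ hdom hreg hκ hl hB).of_mul_abs_le
      (Real.sqrt_pos.2 hb₀.div_pos) ?_
    filter_upwards [hb] with n hb Y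
    rw [hb.sd_sq, sd, ← le_div_iff₀' (Real.sqrt_pos.2 hb.div_pos)]
    exact abs_sqrt_sub_le ((P n).oracleVar_nonneg (l n) Y) hb.div_pos
      hb.le_slope_dotProduct_Del_mulVec
  simpa only [sub_add_sub_cancel] using hresid.add horacle

end StandardError

section AsymptoticNormality

variable {p q : ℕ} {P : ∀ n, Given p q n} {l : ∀ n, Fin n → Fin n} {lam R C : ℝ}

lemma tendsto_measureReal_normalized_betaHat_le
    (hlarge : Tendsto (fun n => (P n).sub.card) atTop atTop)
    (hb : ∀ᶠ n in atTop, (P n).Bounded lam R C) (z : ℝ) :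
    Tendsto (fun n => (P n).condLaw.real
      {Y | √(P n).size * ((P n).betaHat Y - (P n).theta 1) / (P n).sd ≤ z})
      atTop (𝓝 (Phi z)) := by
  obtain ⟨n₀, hb₀⟩ := hb.exists
  have hclt := tendsto_measureReal_normalized_sum_le (μ := fun n => (P n).condLaw)
    (X := fun n i Y => (P n).weight i * (Y i - (P n).cexp ((P n).obs i)))
    (σ := fun n => √(P n).size * (P n).sd) (fun n i => by fun_prop)
    (fun n => (P n).iIndepFun_condLaw fun i =>
      (measurable_id.sub_const ((P n).cexp ((P n).obs i))).const_mul ((P n).weight i))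
    hlarge (hb.mono fun n hb i hi => hb.integral_const_mul_sub_cexp hi _) hb₀.div_pos
    (hb.mono fun n hb i hi => ⟨hb.integrable_weight_mul_sub_cexp_pow_four hi,
      hb.integral_weight_mul_sub_cexp_pow_four_le hi⟩)
    (by
      filter_upwards [hb] with n hb
      rw [mul_pow, Real.sq_sqrt hb.size_pos.le, hb.size_mul_sd_sq]
      exact Finset.sum_congr rfl fun i _ => (Bounded.integral_const_mul_sub_cexp_sq _ i _).symm)
    (by
      filter_upwards [hb] with n hb
      rw [mul_pow, Real.sq_sqrt hb.size_pos.le, hb.sd_sq, mul_comm]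
      exact mul_le_mul_of_nonneg_left hb.le_slope_dotProduct_Del_mulVec hb.size_pos.le) z
  refine hclt.congr fun n => ?_
  have hscale (T : ℝ) : (√(P n).size * (P n).sd)⁻¹ * T =
      √(P n).size * ((P n).size⁻¹ * T) / (P n).sd := by
    rw [← mul_assoc, ← div_eq_mul_inv, Real.sqrt_div_self]
    field
  simp only [betaHat_sub_theta_one, hscale]

lemma tendstoZeroInProb_sqrt_SigHat_div_sd_sub_one
    (hb : ∀ᶠ n in atTop, (P n).Bounded lam R C)
    (hsd : TendstoZeroInProb (fun n => (P n).condLaw)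
      fun n Y => √((P n).SigHat (l n) Y 1 1) - (P n).sd) :
    TendstoZeroInProb (fun n => (P n).condLaw)
      fun n Y => √((P n).SigHat (l n) Y 1 1) / (P n).sd - 1 := by
  obtain ⟨n₀, hb₀⟩ := hb.exists
  refine hsd.of_mul_abs_le (Real.sqrt_pos.2 hb₀.div_pos) ?_
  filter_upwards [hb] with n hb Y
  rw [div_sub_one hb.sd_pos.ne', abs_div, abs_of_pos hb.sd_pos, mul_div_assoc',
    div_le_iff₀ hb.sd_pos, mul_comm]
  exact mul_le_mul_of_nonneg_left hb.sqrt_le_sd (abs_nonneg _)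

lemma tendsto_measureReal_betaHat_sub_theta_one_le
    (hlarge : Tendsto (fun n => (P n).sub.card) atTop atTop)
    (hb : ∀ᶠ n in atTop, (P n).Bounded lam R C)
    (hsd : TendstoZeroInProb (fun n => (P n).condLaw)
      fun n Y => √((P n).SigHat (l n) Y 1 1) - (P n).sd) (z : ℝ) :
    Tendsto (fun n => (P n).condLaw.real
      {Y | (P n).betaHat Y - (P n).theta 1 ≤ z * (P n).se (l n) Y}) atTop (𝓝 (Phi z)) := by
  refine (tendsto_measureReal_le_mul continuous_Phi
    (tendsto_measureReal_normalized_betaHat_le hlarge hb)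
    (tendstoZeroInProb_sqrt_SigHat_div_sd_sub_one hb hsd) z).congr' ?_
  filter_upwards [hb] with n hb
  congr! 3 with Y
  rw [se, ← mul_div_assoc, ← mul_div_assoc, div_le_div_iff_of_pos_right hb.sd_pos,
    le_div_iff₀' (Real.sqrt_pos.2 hb.size_pos)]

lemma tendsto_measureReal_se_nonpos (hb : ∀ᶠ n in atTop, (P n).Bounded lam R C)
    (hsd : TendstoZeroInProb (fun n => (P n).condLaw)
      fun n Y => √((P n).SigHat (l n) Y 1 1) - (P n).sd) :
    Tendsto (fun n => (P n).condLaw.real {Y | (P n).se (l n) Y ≤ 0}) atTop (𝓝 0) := by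
  obtain ⟨n₀, hb₀⟩ := hb.exists
  refine squeeze_zero' (.of_forall fun n => measureReal_nonneg) ?_
    (hsd _ (Real.sqrt_pos.2 hb₀.div_pos))
  filter_upwards [hb] with n hb
  refine measureReal_mono fun Y hY => ?_
  rw [Set.mem_ofPred_eq, se, div_le_iff₀ (Real.sqrt_pos.2 hb.size_pos), zero_mul] at hY
  rw [Set.mem_ofPred_eq, abs_sub_comm]
  exact hb.sqrt_le_sd.trans ((le_sub_self_iff _).2 hY |>.trans (le_abs_self _))

end AsymptoticNormality

end Given

section LimInfLimSup

variable {ι : Type*} {F : Filter ι} [F.NeBot] {f g : ι → ℝ} {L b : ℝ}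

lemma le_liminf_of_tendsto_of_eventually_le (hf : Tendsto f F (𝓝 L)) (hfg : f ≤ᶠ[F] g)
    (hg : ∀ a, g a ≤ b) : L ≤ liminf g F := by
  rw [← hf.liminf_eq]
  exact liminf_le_liminf hfg hf.isBoundedUnder_ge (isCoboundedUnder_ge_of_le F hg)

lemma limsup_le_of_tendsto_of_eventually_le (hf : Tendsto f F (𝓝 L)) (hgf : g ≤ᶠ[F] f)
    (hg : ∀ a, b ≤ g a) : limsup g F ≤ L := by
  rw [← hf.limsup_eq]
  exact limsup_le_limsup hgf (isCoboundedUnder_le_of_le F hg) hf.isBoundedUnder_le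

end LimInfLimSup

namespace Given

section ShiftedStatistics

variable {p q n : ℕ} (P : Given p q n) (l : Fin n → Fin n) {v z : ℝ}

lemma setOf_betaHat_sub_theta_one_le_subset (hbias : |P.theta 1 - P.tau| ≤ v / √P.size) :
    {Y | P.betaHat Y - P.theta 1 ≤ z * P.se l Y} ⊆
      {Y | P.tStat l P.tau Y - v / (√P.size * P.se l Y) ≤ z} ∪ {Y | P.se l Y ≤ 0} := by
  refine fun Y hY => or_iff_not_imp_right.2 fun hpos => ?_
  simp only [Set.mem_ofPred_eq, not_le] at hY hpos ⊢
  rw [tStat, ← div_div, ← sub_div, div_le_iff₀ hpos]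
  linarith [(abs_le.1 hbias).2]

lemma setOf_tStat_add_le_subset (hbias : |P.theta 1 - P.tau| ≤ v / √P.size) :
    {Y | P.tStat l P.tau Y + v / (√P.size * P.se l Y) ≤ z} ⊆
      {Y | P.betaHat Y - P.theta 1 ≤ z * P.se l Y} ∪ {Y | P.se l Y ≤ 0} := by
  refine fun Y hY => or_iff_not_imp_right.2 fun hpos => ?_
  simp only [Set.mem_ofPred_eq, not_le] at hY hpos ⊢
  rw [tStat, ← div_div, ← add_div, div_le_iff₀ hpos] at hY
  linarith [(abs_le.1 hbias).1]

lemma setOf_betaHat_sub_theta_one_le_subset_tau_mem_robustCI {α b mc : ℝ}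
    (hb : b < quantile (1 - α / 2)) (hbias : |P.theta 1 - P.tau| ≤ mc) :
    {Y | P.betaHat Y - P.theta 1 ≤ b * P.se l Y} ⊆
      {Y | P.tau ∈ P.robustCI l α mc Y} ∪
        ({Y | P.betaHat Y - P.theta 1 ≤ quantile (α / 2) * P.se l Y} ∪ {Y | P.se l Y ≤ 0}) := by
  refine fun Y hY => or_iff_not_imp_right.2 fun hlow => ?_
  simp only [Set.mem_union, Set.mem_ofPred_eq, not_or, not_le] at hY hlow ⊢
  have hupper := mul_lt_mul_of_pos_right hb hlow.2
  obtain ⟨hbias₁, hbias₂⟩ := abs_le.1 hbias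
  exact ⟨by linarith, by linarith⟩

end ShiftedStatistics

section Inference

variable {p q : ℕ} {P : ∀ n, Given p q n} {l : ∀ n, Fin n → Fin n}

lemma Phi_le_liminf_measureReal_tStat_sub_le
    (hN : ∀ z, Tendsto (fun n => (P n).condLaw.real
      {Y | (P n).betaHat Y - (P n).theta 1 ≤ z * (P n).se (l n) Y}) atTop (𝓝 (Phi z)))
    (hse : Tendsto (fun n => (P n).condLaw.real {Y | (P n).se (l n) Y ≤ 0}) atTop (𝓝 0))
    {v τ₀ : ℕ → ℝ} (hbias : ∀ᶠ n in atTop, |(P n).theta 1 - (P n).tau| ≤ v n / √(P n).size)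
    (hτ : ∀ᶠ n in atTop, (P n).tau = τ₀ n) (z : ℝ) :
    Phi z ≤ liminf (fun n => (P n).condLaw.real
      {Y | (P n).tStat (l n) (τ₀ n) Y - v n / (√(P n).size * (P n).se (l n) Y) ≤ z}) atTop := by
  have hlim := (hN z).sub hse
  rw [sub_zero] at hlim
  refine le_liminf_of_tendsto_of_eventually_le hlim ?_ fun n => measureReal_le_one
  filter_upwards [hbias, hτ] with n hbias hτ
  rw [sub_le_iff_le_add, ← hτ]
  exact (measureReal_mono ((P n).setOf_betaHat_sub_theta_one_le_subset (l n) hbias)).trans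
    (measureReal_union_le _ _)

lemma limsup_measureReal_tStat_add_le_le_Phi
    (hN : ∀ z, Tendsto (fun n => (P n).condLaw.real
      {Y | (P n).betaHat Y - (P n).theta 1 ≤ z * (P n).se (l n) Y}) atTop (𝓝 (Phi z)))
    (hse : Tendsto (fun n => (P n).condLaw.real {Y | (P n).se (l n) Y ≤ 0}) atTop (𝓝 0))
    {v τ₀ : ℕ → ℝ} (hbias : ∀ᶠ n in atTop, |(P n).theta 1 - (P n).tau| ≤ v n / √(P n).size)
    (hτ : ∀ᶠ n in atTop, (P n).tau = τ₀ n) (z : ℝ) :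
    limsup (fun n => (P n).condLaw.real
      {Y | (P n).tStat (l n) (τ₀ n) Y + v n / (√(P n).size * (P n).se (l n) Y) ≤ z}) atTop ≤
      Phi z := by
  have hlim := (hN z).add hse
  rw [add_zero] at hlim
  refine limsup_le_of_tendsto_of_eventually_le hlim ?_ fun n => measureReal_nonneg
  filter_upwards [hbias, hτ] with n hbias hτ
  rw [← hτ]
  exact (measureReal_mono ((P n).setOf_tStat_add_le_subset (l n) hbias)).trans
    (measureReal_union_le _ _)

lemma one_sub_le_liminf_measureReal_tau_mem_robustCI
    (hN : ∀ z, Tendsto (fun n => (P n).condLaw.real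
      {Y | (P n).betaHat Y - (P n).theta 1 ≤ z * (P n).se (l n) Y}) atTop (𝓝 (Phi z)))
    (hse : Tendsto (fun n => (P n).condLaw.real {Y | (P n).se (l n) Y ≤ 0}) atTop (𝓝 0))
    {mc : ℕ → ℝ} (hbias : ∀ᶠ n in atTop, |(P n).theta 1 - (P n).tau| ≤ mc n)
    {α : ℝ} (hα₀ : 0 < α) (hα₁ : α < 1) :
    1 - α ≤ liminf (fun n => (P n).condLaw.real
      {Y | (P n).tau ∈ (P n).robustCI (l n) α (mc n) Y}) atTop := by
  -- The interval excludes its lower endpoint, so its upper quantile is approached from below.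
  have hbelow : ∀ b < quantile (1 - α / 2), Phi b - α / 2 ≤ liminf (fun n =>
      (P n).condLaw.real {Y | (P n).tau ∈ (P n).robustCI (l n) α (mc n) Y}) atTop := by
    intro b hb
    have hlim := (hN b).sub ((hN (quantile (α / 2))).add hse)
    rw [add_zero, Phi_quantile (by linarith) (by linarith)] at hlim
    refine le_liminf_of_tendsto_of_eventually_le hlim ?_ fun n => measureReal_le_one
    filter_upwards [hbias] with n hbias
    rw [sub_le_iff_le_add]
    exact (measureReal_mono ((P n).setOf_betaHat_sub_theta_one_le_subset_tau_mem_robustCI (l n)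
      hb hbias)).trans ((measureReal_union_le _ _).trans
        (add_le_add_right (measureReal_union_le _ _) _))
  have hlim : Tendsto (fun b => Phi b - α / 2) (𝓝[<] quantile (1 - α / 2)) (𝓝 (1 - α)) := by
    have hcont : ContinuousAt (fun b => Phi b - α / 2) (quantile (1 - α / 2)) :=
      (continuous_Phi.sub continuous_const).continuousAt
    convert hcont.tendsto.mono_left nhdsWithin_le_nhds using 2
    rw [Phi_quantile (by linarith) (by linarith)]
    ring
  exact le_of_tendsto hlim (eventually_nhdsWithin_of_forall hbelow)

end Inference

section Eventually

variable {p q : ℕ} {P : ∀ n, Given p q n} {l : ∀ n, Fin n → Fin n}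
  {ψ : Ctrl p → Ctrl p → ℝ} {κ : ℝ}

lemma exists_eventually_bounded
    (hGam : ∃ lam : ℝ, 0 < lam ∧
      (lam : EReal) ≤ liminf (fun n => (lambdaMin (P n).Gam : EReal)) atTop)
    (hDel : ∃ lam : ℝ, 0 < lam ∧
      (lam : EReal) ≤ liminf (fun n => (lambdaMin (P n).Del : EReal)) atTop)
    (hreg : ∃ M, ∀ᶠ n in atTop, (P n).MomentRegular ψ M) :
    ∃ lam R C, ∀ᶠ n in atTop, (P n).Bounded lam R C := by
  obtain ⟨lam₁, hlam₁, hGam⟩ := hGam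
  obtain ⟨lam₂, hlam₂, hDel⟩ := hDel
  obtain ⟨M, hreg⟩ := hreg
  have hlt {c : ℝ} (hc : 0 < c) : ((c / 2 : ℝ) : EReal) < c := EReal.coe_lt_coe (half_lt_self hc)
  refine ⟨min (lam₁ / 2) (lam₂ / 2), (q + 2) * (1 + M), M, ?_⟩
  filter_upwards [hreg,
    eventually_isCoerciveWith_of_lt_liminf_lambdaMin (fun n => (P n).isHermitian_Gam)
      ((hlt hlam₁).trans_le hGam),
    eventually_isCoerciveWith_of_lt_liminf_lambdaMin (fun n => (P n).isHermitian_Del)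
      ((hlt hlam₂).trans_le hDel)] with n hreg hG hD
  exact MomentRegular.bounded_of_isCoerciveWith hreg (lt_min (half_pos hlam₁) (half_pos hlam₂))
    (hG.mono (min_le_left _ _)) (hD.mono (min_le_right _ _))

lemma exists_eventually_card_matched_le (hκ : 0 ≤ κ) (hψ : IsMetric ψ)
    (hl : ∀ᶠ n in atTop, (P n).IsMatch ψ κ (l n))
    (huse : ((∃ N : Seminorm ℝ (Ctrl p), ∀ x y, ψ x y = N (x - y)) ∧
        ∀ᶠ n in atTop, (P n).NoTies ψ κ (l n)) ∨
      ∃ K : ℕ, ∀ᶠ n in atTop, ∀ j, {i ∈ (P n).sub | l n i = j}.card ≤ K) :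
    ∃ K : ℕ, ∀ᶠ n in atTop, ∀ j, {i ∈ (P n).sub | l n i = j}.card ≤ K := by
  refine huse.elim (fun ⟨⟨N, hN⟩, hties⟩ => ?_) id
  obtain ⟨K, hK⟩ := exists_card_matched_le hκ hψ N hN
  refine ⟨K, ?_⟩
  filter_upwards [hl, hties] with n hl hties using hK hl hties

end Eventually

end Given

end DesignPhase

theorem corollary4 {p q : ℕ}
    -- subsample, covariate function and conditional law, as functions of controls and treatments
    (S : Setup p q)
    -- the realized controls and treated statuses of a sample of `n` units, for each `n`
    (w : ∀ n : ℕ, Fin n → Obs p)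
    -- the conditional means in the definitions exist
    (hint : ∀ᶠ n : ℕ in atTop, ∀ i ∈ (S.given (w n)).sub,
      Integrable (fun y : ℝ => y) ((S.given (w n)).law (w n i)) ∧
      Integrable (fun y : ℝ => y) ((S.given (w n)).law ((w n i).1, false)))
    -- the subsample becomes large
    (hlarge : Tendsto (fun n : ℕ => (S.given (w n)).sub.card) atTop atTop)
    -- bounded second moments of `‖Z U‖`
    (hsecond : ∃ M : ℝ, ∀ᶠ n : ℕ in atTop, ∀ i ∈ (S.given (w n)).sub,
      (S.given (w n)).momentZU 2 (w n i) ≤ ENNReal.ofReal M)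
    -- the design matrix is asymptotically nonsingular
    (hGam : ∃ lam : ℝ, 0 < lam ∧
      (lam : EReal) ≤ liminf (fun n : ℕ => (lambdaMin (S.given (w n)).Gam : EReal)) atTop)
    -- so is the middle matrix of the asymptotic variance
    (hDel : ∃ lam : ℝ, 0 < lam ∧
      (lam : EReal) ≤ liminf (fun n : ℕ => (lambdaMin (S.given (w n)).Del : EReal)) atTop)
    -- bounded moments of `‖Z U‖` of order `2 + δ`
    (δ : ℝ) (hδ : 0 < δ)
    (hlyap : ∃ M : ℝ, ∀ᶠ n : ℕ in atTop, ∀ i ∈ (S.given (w n)).sub,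
      (S.given (w n)).momentZU (2 + δ) (w n i) ≤ ENNReal.ofReal M)
    -- the matching metric, and regularity of the conditional moments with respect to it
    (ψ : Ctrl p → Ctrl p → ℝ) (hψ : IsMetric ψ)
    (hdom : ∃ K : ℝ, ∀ x y, ψ x y ≤ K * dist x y)
    (hreg : ∃ M : ℝ, ∀ᶠ n : ℕ in atTop, (S.given (w n)).MomentRegular ψ M)
    -- the matches
    (κ : ℝ) (hκ : 0 < κ)
    (l : ∀ n : ℕ, Fin n → Fin n)
    (hl : ∀ᶠ n : ℕ in atTop, (S.given (w n)).IsMatch ψ κ (l n))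
    -- either `ψ` comes from a norm and there are no ties, or no unit is matched too many times
    (huse : ((∃ N : Seminorm ℝ (Ctrl p), ∀ x y, ψ x y = N (x - y)) ∧
        ∀ᶠ n : ℕ in atTop, (S.given (w n)).NoTies ψ κ (l n)) ∨
      ∃ K : ℕ, ∀ᶠ n : ℕ in atTop, ∀ j : Fin n,
        (Finset.filter (fun i => l n i = j) (S.given (w n)).sub).card ≤ K)
    -- imbalance and misspecification
    (B : BalanceMetric p)
    (m : ∀ _ : ℕ, Fin B.dim → ℝ)
    (hm : ∀ᶠ n : ℕ in atTop, B.IsMisspec (S.given (w n)) (m n))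
    -- local misspecification
    (v : ∀ n : ℕ, (Fin n → Obs p) → ℝ) (hv : ∀ n w', 0 < v n w')
    (hloc : ∀ᶠ n : ℕ in atTop,
      m n ⬝ᵥ B.imbalance (S.given (w n)) = v n (w n) / √(S.given (w n)).size) :
    -- stochastic bounds for the shifted t-statistics under the null hypothesis
    (∀ τ₀ : ∀ n : ℕ, (Fin n → Obs p) → ℝ,
      (∀ᶠ n : ℕ in atTop, (S.given (w n)).tau = τ₀ n (w n)) →
      ∀ z : ℝ,
        Phi z ≤ liminf (fun n : ℕ => (S.given (w n)).condLaw.real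
          {Y | (S.given (w n)).tStat (l n) (τ₀ n (w n)) Y -
            v n (w n) / (√(S.given (w n)).size * (S.given (w n)).se (l n) Y) ≤ z}) atTop ∧
        limsup (fun n : ℕ => (S.given (w n)).condLaw.real
          {Y | (S.given (w n)).tStat (l n) (τ₀ n (w n)) Y +
            v n (w n) / (√(S.given (w n)).size * (S.given (w n)).se (l n) Y) ≤ z}) atTop ≤ Phi z) ∧
    -- asymptotic conditional coverage of the robustified intervals
    (∀ α : ℝ, 0 < α → α < 1 → ∀ m' : ∀ _ : ℕ, Fin B.dim → ℝ,
      (∀ᶠ n : ℕ in atTop, ∀ j, m n j ≤ m' n j) →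
      1 - α ≤ liminf (fun n : ℕ => (S.given (w n)).condLaw.real
        {Y | (S.given (w n)).tau ∈ (S.given (w n)).robustCI (l n) α
          (m' n ⬝ᵥ B.imbalance (S.given (w n))) Y}) atTop) := by
  obtain ⟨lam, R, C, hb⟩ := Given.exists_eventually_bounded hGam hDel hreg
  obtain ⟨M, hreg⟩ := hreg
  obtain ⟨K, hdom⟩ := hdom
  obtain ⟨K', hmult⟩ := Given.exists_eventually_card_matched_le hκ.le hψ hl huse
  have hsd := Given.tendstoZeroInProb_sqrt_SigHat_sub_sd hlarge hb hψ hdom hreg hκ hl hmult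
  have hN := Given.tendsto_measureReal_betaHat_sub_theta_one_le hlarge hb hsd
  have hse := Given.tendsto_measureReal_se_nonpos hb hsd
  have hbias : ∀ᶠ n in atTop, |(S.given (w n)).theta 1 - (S.given (w n)).tau| ≤
      m n ⬝ᵥ B.imbalance (S.given (w n)) := by
    filter_upwards [hb, hm, hloc] with n hb hm hloc
    exact abs_theta_one_sub_tau_le hb.isUnit_Gam hm
      (hloc ▸ div_pos (hv _ _) (Real.sqrt_pos.2 hb.size_pos))
  refine ⟨fun τ₀ hτ z => ?_, fun α hα₀ hα₁ m' hm' => ?_⟩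
  · have hbias_v := (hbias.and hloc).mono fun n h => h.1.trans_eq h.2
    exact ⟨Given.Phi_le_liminf_measureReal_tStat_sub_le hN hse hbias_v hτ z,
      Given.limsup_measureReal_tStat_add_le_le_Phi hN hse hbias_v hτ z⟩
  · refine Given.one_sub_le_liminf_measureReal_tau_mem_robustCI hN hse ?_ hα₀ hα₁
    filter_upwards [hbias, hm'] with n hbias hm'
    exact hbias.trans (Finset.sum_le_sum fun j _ =>
      mul_le_mul_of_nonneg_right (hm' j) (B.imbalance_nonneg _ j))
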